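/- **Conventions.** For a string $S=S[1]\cdots S[n]$ and $i\in[1..n]$ let $\mathrm{LPF}_S[i]$ be the largest $\ell\ge 0$ for which there is $j<i$ with $S[j..j+\ell)=S[i..i+\ell)$ (where $i+\ell\le n+1$); in the non-overlapping variant $j+\ell\le i$ is required in addition. The LZ77 parsing of $S$ cuts $S$ greedily from left to right into phrases, the phrase starting at position $i$ having length $\max(1,\mathrm{LPF}_S[i])$. Let $z(S)$ be the number of phrases. All claims below hold for the overlapping variant and also for the non-overlapping variant (used throughout). An algorithm is a deterministic word RAM program: finitely many registers, random access to an array of words (initially the input followed by zeros), arithmetic, bitwise and shift operations and comparisons on words in one step each, words of $w$ bits with $w=O(\log u)$ for inputs of $O(u)$ bits. Working space is the length of the initial segment of memory in which all accessed cells lie, so input cells that are read count. The packed representation of a binary string stores $\Theta(\log n)$ consecutive symbols in each word, where $n$ is the length of the string, or of the text for an instance of Dictionary Matching. (For arguments equal to $1$ read $\log n$ as the bit length $\lfloor\log_2 n\rfloor+1$.) *LZ77 Parity*: given the packed representation of a binary string $X$, output $z(X)\bmod 2$. *Dictionary Matching*: given the packed representations of a nonempty text $T\in\{0,1\}^n$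 and of a collection $\mathcal D=\{P_1,\dots,P_k\}\subseteq\{0,1\}^m$ of $k=\Theta(n/\log n)$ distinct nonempty patterns of common length $m=\Theta(\log n)$, decide whether some $P_i$ occurs in $T$ as a substring. **Theorem.** (1) Let $T_{\rm LZ},S_{\rm LZ}$ be functions and consider an algorithm for LZ77 Parity which, on instances of $O(u)$ bits, runs in $O(T_{\rm LZ}(u))$ time and uses $O(S_{\rm LZ}(u))$ working space (that is, for every $C$ there is $K$ such that for all $u\ge1$ and all inputs of length at most $Cu$ the bounds $K\,T_{\rm LZ}(u)$ and $K\,S_{\rm LZ}(u)$ hold). Then there is an algorithm that solves Dictionary Matching in $O(T_{\rm LZ}(n))$ time and $O(S_{\rm LZ}(n))$ working space; the implied constants may depend on the algorithm and on the constants in $k=\Theta(n/\log n)$ and $m=\Theta(\log n)$. (2) Let $T\in\{0,1\}^n$ be nonempty, $m\ge3$, and let $P_1,\dots,P_k\in\{0,1\}^m$, $k\ge0$, be distinct. Let $P_i'$ be $P_i$ with $0$ replaced by $2$ and $1$ by $3$, let $P_{k+1}=0^m$, and let $$S_1=T\cdot 5,\qquad S_2=\Big(\prod_{i=1}^k P_i(1..m]\cdot4\cdot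 P_i[1..m)\cdot4\cdot P_i[m]\,P_i'\cdot4\cdot P_i'\,P_{i+1}[1]\cdot4\Big)\cdot6,\qquad S_3=\Big(\prod_{i=1}^kP_iP_i'\Big)\cdot P_{k+1}[1],$$ where products denote concatenation in increasing order of $i$, and let $S=S_1S_2S_3$. If some $P_i$ occurs in $T$, then $z(S)-z(S_1S_2)=2k$; otherwise $z(S)-z(S_1S_2)=2k+1$. (3) Let $\sigma\ge3$, let $T$ be a nonempty string of length $n$ over $\{0,\dots,\sigma-1\}$, and let $k=\lceil\log_2(\sigma+1)\rceil$. For $0\le a\le\sigma$ let $\beta(a)\in\{0,1\}^{2k}$ be the $k$-bit binary representation of $a$ (most significant bit first) with a $0$ inserted after every bit, and let $C(a)=1^{2k-1}\,0\,\beta(a)\,\beta(a)$. Let $L=\big(\prod_{a=0}^{\sigma-1}C(a)C(\sigma)\big)\cdot1$ and $R=\prod_{i=1}^nC(T[i])$. Then $z(LR)-z(L)=z(T)$. -/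

import Mathlib

/-! ## LZ77 parsings -/

/-- The two variants of the LZ77 parsing: the source of a phrase may overlap the phrase, or must
end before the phrase starts. -/
inductive LZVariant where
  | overlapping
  | nonOverlapping

/-- `v.Admits j i l`: the fragment of length `l` starting at position `j < i` may serve as the source
of the fragment of length `l` starting at position `i` (positions are counted from `0`). -/
def LZVariant.Admits : LZVariant → ℕ → ℕ → ℕ → Prop
  | .overlapping, j, i, _ => j < i
  | .nonOverlapping, j, i, l => j < i ∧ j + l ≤ i

instance (v : LZVariant) (j i l : ℕ) : Decidable (v.Admits j i l) := by
  cases v <;> unfold LZVariant.Admits <;> infer_instance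

section LZ

variable {α : Type} [DecidableEq α]

/-- The length-`l` fragment of `S` at position `i` has an earlier occurrence in `S`
(one that does not overlap it, in the non-overlapping variant). -/
def HasPrevOcc (v : LZVariant) (S : List α) (i l : ℕ) : Prop :=
  ∃ j < i, v.Admits j i l ∧ (S.drop j).take l = (S.drop i).take l

instance (v : LZVariant) (S : List α) (i : ℕ) : DecidablePred (HasPrevOcc v S i) := fun l => by
  unfold HasPrevOcc; infer_instance

/-- The entry at position `i` of the longest previous factor array of `S`
(of its non-overlapping version, for the other variant). -/
def lpf (v : LZVariant) (S : List α) (i : ℕ) : ℕ :=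
  Nat.findGreatest (HasPrevOcc v S i) (S.length - i)

/-- The number of phrases of the greedy left-to-right parsing of `S` from position `i` on; the
phrase that starts at position `i` has length `max 1 (lpf v S i)`. -/
def lzPhrasesFrom (v : LZVariant) (S : List α) (i : ℕ) : ℕ :=
  if i < S.length then lzPhrasesFrom v S (i + max 1 (lpf v S i)) + 1 else 0
termination_by S.length - i
decreasing_by omega

/-- The number of phrases of the LZ77 parsing of `S`. -/
def lzSize (v : LZVariant) (S : List α) : ℕ := lzPhrasesFrom v S 0

end LZ

/-! ## Word RAM -/

namespace WordRAM

/-- The arithmetic, bitwise and shift operations on words. -/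
inductive BinOp where
  | add | sub | mul | div | mod | and | or | xor | shl | shr

/-- The value of an operation. Subtraction is truncated at `0`; `a / 0 = 0` and `a % 0 = a`. -/
def BinOp.eval : BinOp → ℕ → ℕ → ℕ
  | .add, a, b => a + b
  | .sub, a, b => a - b
  | .mul, a, b => a * b
  | .div, a, b => a / b
  | .mod, a, b => a % b
  | .and, a, b => a &&& b
  | .or, a, b => a ||| b
  | .xor, a, b => a ^^^ b
  | .shl, a, b => a <<< b
  | .shr, a, b => a >>> b

/-- Instructions; the arguments `r`, `a`, `b` are names of registers, `c` is a literal and `l` is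
the number of an instruction of the program. -/
inductive Instr where
  /-- `r := c` -/
  | const (r c : ℕ)
  /-- `r := a o b` -/
  | op (o : BinOp) (r a b : ℕ)
  /-- `r := memory[a]` -/
  | load (r a : ℕ)
  /-- `memory[a] := r` -/
  | store (a r : ℕ)
  /-- go to `l` if `a < b` -/
  | jumpLt (a b l : ℕ)
  /-- go to `l` if `a = b` -/
  | jumpEq (a b l : ℕ)

/-- A program is a finite list of instructions. (It mentions finitely many registers only.) -/
abbrev Program := List Instr

/-- A configuration: the number of the next instruction, the registers, and the memory. -/
structure Config where
  pc : ℕ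
  reg : ℕ → ℕ
  mem : ℕ → ℕ

/-- The effect of one instruction. -/
def Instr.exec (s : Config) : Instr → Config
  | .const r c => ⟨s.pc + 1, Function.update s.reg r c, s.mem⟩
  | .op o r a b => ⟨s.pc + 1, Function.update s.reg r (o.eval (s.reg a) (s.reg b)), s.mem⟩
  | .load r a => ⟨s.pc + 1, Function.update s.reg r (s.mem (s.reg a)), s.mem⟩
  | .store a r => ⟨s.pc + 1, s.reg, Function.update s.mem (s.reg a) (s.reg r)⟩
  | .jumpLt a b l => ⟨if s.reg a < s.reg b then l else s.pc + 1, s.reg, s.mem⟩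
  | .jumpEq a b l => ⟨if s.reg a = s.reg b then l else s.pc + 1, s.reg, s.mem⟩

/-- One step of a program. The program halts by leaving the list of its instructions; a halted
configuration does not change any more. -/
def step (p : Program) (s : Config) : Config :=
  match p[s.pc]? with
  | some I => I.exec s
  | none => s

/-- The configuration after `t` steps. -/
def run (p : Program) (s : Config) (t : ℕ) : Config := (step p)^[t] s

/-- The program has halted. -/
def Halted (p : Program) (s : Config) : Prop := p.length ≤ s.pc

/-- The next step reads or writes the memory cell with address `a`. -/
def Accesses (p : Program) (s : Config) (a : ℕ) : Prop :=
  (∃ r x, p[s.pc]? = some (.load r x) ∧ s.reg x = a) ∨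
    (∃ x r, p[s.pc]? = some (.store x r) ∧ s.reg x = a)

/-- All values stored in registers and memory fit in words of `w` bits. -/
def FitsIn (w : ℕ) (s : Config) : Prop := (∀ r, s.reg r < 2 ^ w) ∧ ∀ a, s.mem a < 2 ^ w

/-- The initial configuration: the input fills the memory cells from address `0` on, all other cells
and all registers contain `0`. -/
def initial (input : List ℕ) : Config := ⟨0, fun _ => 0, fun a => input.getD a 0⟩

/-- Started on `input` on a machine with words of `w` bits, the program `p` halts within `t` steps
with `out` in register `0`, no value ever exceeds the word length, and only memory cells with
addresses below `s` are read or written (so that the input, where it is read, counts as used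
space). -/
structure Computes (p : Program) (input : List ℕ) (out t s w : ℕ) : Prop where
  halts : Halted p (run p (initial input) t)
  output : (run p (initial input) t).reg 0 = out
  space : ∀ i < t, ∀ a, Accesses p (run p (initial input) i) a → a < s
  words : ∀ i ≤ t, FitsIn w (run p (initial input) i)

end WordRAM

/-! ## Packed strings and the two computational problems -/

/-- The number of bits of the binary representation of `n` (for `n ≥ 1`), a positive version of
`log n`. -/
def bitLen (n : ℕ) : ℕ := Nat.log 2 n + 1

/-- The packed representation of a binary string with `b` symbols per word: word number `j`
consists of the symbols at positions `j * b, …, j * b + b - 1` (the last word may have fewer), the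
first of them being its least significant bit. -/
def pack (b : ℕ) (x : List Bool) : List ℕ :=
  (List.range ((x.length + b - 1) / b)).map fun j =>
    Nat.ofDigits 2 (((x.drop (j * b)).take b).map Bool.toNat)

/-- The memory image of an input of the LZ77 parity problem: the length of the string, and the
string with `bitLen n` symbols per word. -/
def lzInput (x : List Bool) : List ℕ := x.length :: pack (bitLen x.length) x

/-- The memory image of an instance of Dictionary Matching: the length of the text, the number and
the length of the patterns, then the text and the patterns one after the other, with `bitLen n`
symbols per word, where `n` is the length of the text. -/
def dmInput (T : List Bool) (m : ℕ) (D : List (List Bool)) : List ℕ :=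
  [T.length, D.length, m] ++ pack (bitLen T.length) T ++ D.flatMap (pack (bitLen T.length))

/-- The program `p` computes the parity of the number of LZ77 phrases of binary strings: on
instances of `O(u)` bits it takes `O(time u)` steps and uses `O(space u)` memory cells, on a
machine with words of `O(log u)` bits. -/
def SolvesLZParity (v : LZVariant) (p : WordRAM.Program) (time space : ℕ → ℝ) : Prop :=
  ∀ C : ℕ, ∃ K : ℕ, ∀ u ≥ 1, ∀ x : List Bool, x.length ≤ C * u →
    ∃ t s w : ℕ, WordRAM.Computes p (lzInput x) (lzSize v x % 2) t s w ∧
      (t : ℝ) ≤ K * time u ∧ (s : ℝ) ≤ K * space u ∧ w ≤ K * bitLen u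

/-- `D` is a collection of `k = Θ(n / log n)` distinct nonempty patterns of common length
`m = Θ(log n)`, and `T` is a nonempty text of length `n`, where `c` bounds the constants hidden in
the two `Θ`. -/
structure IsDMInstance (c : ℕ) (T : List Bool) (m : ℕ) (D : List (List Bool)) : Prop where
  text_nonempty : T ≠ []
  pattern_pos : 0 < m
  nodup : D.Nodup
  length_eq : ∀ P ∈ D, P.length = m
  card_lower : T.length ≤ c * (D.length * bitLen T.length)
  card_upper : D.length * bitLen T.length ≤ c * T.length
  length_lower : bitLen T.length ≤ c * m
  length_upper : m ≤ c * bitLen T.length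

open Classical in
/-- The program `q` decides Dictionary Matching (output `1` if some pattern occurs in the text, and
`0` otherwise): for texts of length `n` it takes `O(time n)` steps and uses `O(space n)` memory
cells, on a machine with words of `O(log n)` bits. -/
def SolvesDictionaryMatching (q : WordRAM.Program) (time space : ℕ → ℝ) : Prop :=
  ∀ c : ℕ, ∃ K : ℕ, ∀ (T : List Bool) (m : ℕ) (D : List (List Bool)), IsDMInstance c T m D →
    ∃ t s w : ℕ,
      WordRAM.Computes q (dmInput T m D) (if ∃ P ∈ D, P <:+: T then 1 else 0) t s w ∧
      (t : ℝ) ≤ K * time T.length ∧ (s : ℝ) ≤ K * space T.length ∧ w ≤ K * bitLen T.length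

/-! ## The string that encodes an instance of Dictionary Matching -/

/-- A binary string as a string of symbols `0`, `1`. -/
def bits (P : List Bool) : List ℕ := P.map Bool.toNat

/-- The copy of a binary string with `0` replaced by `2` and `1` replaced by `3`. -/
def primed (P : List Bool) : List ℕ := P.map fun a => if a then 3 else 2

/-- The first symbol (as a string of length one) of the first of the remaining patterns, or of
`0 ^ m` if no pattern remains. -/
def nextFirst (m : ℕ) (D : List (List Bool)) : List ℕ :=
  bits ((D.headD (List.replicate m false)).take 1)

/-- The blocks `P_i(1..m] 4 P_i[1..m) 4 P_i[m] P'_i 4 P'_i P_{i+1}[1] 4` for `i = 1, …, k`. -/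
def gadgets (m : ℕ) : List (List Bool) → List ℕ
  | [] => []
  | P :: D => bits (P.drop 1) ++ [4] ++ bits (P.take (m - 1)) ++ [4] ++
      bits (P.drop (m - 1)) ++ primed P ++ [4] ++ primed P ++ nextFirst m D ++ [4] ++ gadgets m D

def encS1 (T : List Bool) : List ℕ := bits T ++ [5]

def encS2 (m : ℕ) (D : List (List Bool)) : List ℕ := gadgets m D ++ [6]

def encS3 (m : ℕ) (D : List (List Bool)) : List ℕ :=
  D.flatMap (fun P => bits P ++ primed P) ++ nextFirst m []

/-! ## The binary encoding of strings over larger alphabets -/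

/-- The binary representation of `x < 2 ^ k` with `k` bits, most significant bit first. -/
def binRep (k x : ℕ) : List Bool := (List.range k).map fun i => x.testBit (k - 1 - i)

/-- A `0` is inserted after every symbol. -/
def padZeros (X : List Bool) : List Bool := X.flatMap fun a => [a, false]

/-- The code of the symbol `a`, where symbols are represented by `k` bits. -/
def code (k a : ℕ) : List Bool :=
  List.replicate (2 * k - 1) true ++ [false] ++ padZeros (binRep k a) ++ padZeros (binRep k a)

/-- The preamble of the encoding, for the alphabet `{0, …, σ - 1}` and `k = ⌈log₂ (σ + 1)⌉`. -/
def codePreamble (σ : ℕ) : List Bool :=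
  (List.range σ).flatMap
    (fun a => code (Nat.clog 2 (σ + 1)) a ++ code (Nat.clog 2 (σ + 1)) σ) ++ [true]

/-- The encoding of a string over the alphabet `{0, …, σ - 1}`, symbol by symbol. -/
def encodeString (σ : ℕ) (T : List ℕ) : List Bool := T.flatMap (code (Nat.clog 2 (σ + 1)))

/-!
The two counting results about encodings are proved by following the greedy parsing phrase by
phrase, and the reduction is a word RAM program whose correctness rests on both of them.

**The encoding of an instance.** The blocks of `encS2` contain `P(1..m]`, `P[1..m)`, `P[m] P'` and
`P' Q[1]`, where `Q` is the pattern after `P`, but none of these words extended by the symbol that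
follows it in the string of the pairs `P P'`. A word is a phrase if it occurs earlier and its
extension by the next symbol does not (`lzPhrasesFrom_of_infix`). As long as no pattern occurs in
the text, a pair `P P'` is therefore parsed as `P[1..m)` and `P[m] P'` (`lzPhrasesFrom_search`).
The first pattern that occurs in the text is a phrase on its own, the next phrase is `P' Q[1]`,
and from then on the parsing is one symbol ahead: the phrases for a pair `P P'` are `P(1..m]` and
`P' Q[1]` (`lzPhrasesFrom_found`). There are two phrases per pattern in both cases, but the final
symbol needs a phrase only if no pattern has been found (`lzSize_enc`).

**The binary encoding.** A code is `1^(2k-1) 0`, followed by two copies of the representation of a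
symbol in which no two symbols `1` are adjacent. So `1^(2k-1) 0` marks the beginnings of codes
(`CodeLayout.marker`), and occurrences of long words are aligned with the codes. The preamble
contains the code of every symbol, but no two consecutive codes of symbols of `T`. Hence a phrase
that starts in the marker or in the first copy of a code ends in the same part of the code at
which the corresponding phrase of `T` ends: the second copies identify the first symbol, and the
first copies the other symbols (`CodeLayout.lzPhrasesFrom_eq`). The middle symbol `1` keeps the
phrases of the preamble from reaching far into the codes of `T` (`CodeLayout.lt_of_hasPrevOcc`).

**The reduction.** By these two results, applied to an alphabet of seven symbols, the parities of
the numbers of phrases of two binary strings, `parityString true T D` and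
`parityString false T D`, decide whether a pattern occurs in the text (`lzSize_parityString`). The
patterns and the text are padded first (`padString`), so that patterns have at least three symbols
and all start with `0` and end with `1`; then the code of a pattern is that of its inner part
between fixed strings.

The program `matchingProgram p` writes both strings in packed form. It encodes half a word at a
time by means of a table: the code of a short string is a linear combination of two table entries
(`bitVal_innerCode`), and the table has only `O(√n)` entries. As the amount of memory that `p`
uses is not known in advance, the strings are written to every other cell, in an interleaved way,
and `p` is run on each of them in a version that uses every other cell and register only
(`Simulates.run`). Programs are built from a small structured language (`Stmt`) with rules for
total correctness and running time (`WP`).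

All this takes `O(n / log n)` steps and cells besides the runs of `p`, and this is within the
claimed bounds because `p` itself needs that many steps and cells (`SolvesLZParity.lower_bound`):
the parity for a string of zeros changes if two adjacent zeros in its second half are replaced by
ones, so every word in that half has to be read.
-/

/-! ### Longest previous factors and phrases -/

theorem take_drop_eq_iff {α : Type} (S : List α) (i j l : ℕ) :
    (S.drop j).take l = (S.drop i).take l ↔ ∀ t < l, S[j + t]? = S[i + t]? := by
  constructor
  · intro h t ht
    have := congrArg (fun x => x[t]?) h
    simpa [ht] using this
  · intro h
    apply List.ext_getElem?
    intro t
    by_cases ht : t < l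
    · simpa [ht] using h t ht
    · simp [ht]

theorem hasPrevOcc_iff {α : Type} {v : LZVariant} {S : List α} {i l : ℕ} :
    HasPrevOcc v S i l ↔ ∃ j < i, v.Admits j i l ∧ ∀ t < l, S[j + t]? = S[i + t]? := by
  simp only [HasPrevOcc, take_drop_eq_iff]

theorem LZVariant.Admits.mono {v : LZVariant} {j i l l' : ℕ} (h : v.Admits j i l) (hl : l' ≤ l) :
    v.Admits j i l' := by
  cases v
  · exact h
  · exact ⟨h.1, by have := h.2; omega⟩

/-- A source that ends before the phrase starts is admissible in both variants. -/
theorem LZVariant.admits_of_add_le (v : LZVariant) {j i l : ℕ} (hji : j < i) (h : j + l ≤ i) :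
    v.Admits j i l := by
  cases v
  · exact hji
  · exact ⟨hji, h⟩

theorem HasPrevOcc.mono {α : Type} {v : LZVariant} {S : List α} {i l l' : ℕ}
    (h : HasPrevOcc v S i l)
    (hl : l' ≤ l) : HasPrevOcc v S i l' := by
  rw [hasPrevOcc_iff] at h ⊢
  obtain ⟨j, hj, ha, h⟩ := h
  exact ⟨j, hj, ha.mono hl, fun t ht => h t (by omega)⟩

theorem hasPrevOcc_append {α : Type} {v : LZVariant} {A B : List α} {i l : ℕ}
    (h : i + l ≤ A.length) :
    HasPrevOcc v (A ++ B) i l ↔ HasPrevOcc v A i l := by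
  simp only [hasPrevOcc_iff]
  refine exists_congr fun j => and_congr_right fun hj => and_congr_right fun _ => ?_
  refine forall₂_congr fun t ht => ?_
  rw [List.getElem?_append_left (by omega), List.getElem?_append_left (by omega)]

section Basics

variable {α : Type} [DecidableEq α]

theorem HasPrevOcc.le_lpf {v : LZVariant} {S : List α} {i l : ℕ} (h : HasPrevOcc v S i l)
    (hl : i + l ≤ S.length) : l ≤ lpf v S i :=
  Nat.le_findGreatest (by omega) h

theorem hasPrevOcc_lpf {v : LZVariant} {S : List α} {i : ℕ} (h : 0 < lpf v S i) :
    HasPrevOcc v S i (lpf v S i) :=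
  Nat.findGreatest_of_ne_zero rfl h.ne'

theorem lpf_le (v : LZVariant) (S : List α) (i : ℕ) : lpf v S i ≤ S.length - i :=
  Nat.findGreatest_le _

theorem lpf_lt_of_not_hasPrevOcc {v : LZVariant} {S : List α} {i l : ℕ}
    (h : ¬ HasPrevOcc v S i l) (hl : 0 < l) : lpf v S i < l := by
  by_contra hc
  exact h ((hasPrevOcc_lpf (by omega)).mono (by omega))

theorem lzPhrasesFrom_of_lt {v : LZVariant} {S : List α} {i : ℕ} (h : i < S.length) :
    lzPhrasesFrom v S i = lzPhrasesFrom v S (i + max 1 (lpf v S i)) + 1 := by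
  rw [lzPhrasesFrom, if_pos h]

theorem lzPhrasesFrom_of_length_le {v : LZVariant} {S : List α} {i : ℕ} (h : S.length ≤ i) :
    lzPhrasesFrom v S i = 0 := by
  rw [lzPhrasesFrom, if_neg (by omega)]

/-- In a prefix, the longest previous factors are the same, except that they are cut off at its
end. -/
theorem lpf_append (v : LZVariant) (A B : List α) (i : ℕ) (hi : i ≤ A.length) :
    lpf v A i = min (lpf v (A ++ B) i) (A.length - i) := by
  apply le_antisymm
  · refine le_min ?_ (lpf_le v A i)
    rcases Nat.eq_zero_or_pos (lpf v A i) with h | h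
    · omega
    · have h1 := lpf_le v A i
      refine ((hasPrevOcc_append (B := B) (by omega)).2 (hasPrevOcc_lpf h)).le_lpf ?_
      simp only [List.length_append]; omega
  · rcases Nat.eq_zero_or_pos (lpf v (A ++ B) i) with h | h
    · omega
    · refine ((hasPrevOcc_append (B := B) (by omega)).1
        ((hasPrevOcc_lpf h).mono (min_le_left _ _))).le_lpf (by omega)

/-- The parsings of `A` and of `A ++ B` agree up to the phrase that reaches the end of `A`. In
`A ++ B` that phrase ends at a position `q`, possibly beyond the end of `A`. -/
theorem exists_lzPhrasesFrom_append (v : LZVariant) (A B : List α) :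
    ∀ d i, A.length - i = d → i ≤ A.length →
    ∃ q, A.length ≤ q ∧ q ≤ (A ++ B).length ∧
      lzPhrasesFrom v (A ++ B) i = lzPhrasesFrom v A i + lzPhrasesFrom v (A ++ B) q ∧
      (A.length < q → ∃ i' < A.length, HasPrevOcc v (A ++ B) i' (q - i')) := by
  intro d
  induction d using Nat.strong_induction_on with
  | _ d ih =>
    intro i hd hi
    rcases hi.eq_or_lt with hi | hi
    · refine ⟨A.length, le_rfl, by simp, ?_, by omega⟩
      rw [lzPhrasesFrom_of_length_le (S := A) hi.ge, hi, zero_add]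
    · have hlt : i < (A ++ B).length := by simp only [List.length_append]; omega
      have hle := lpf_le v (A ++ B) i
      have hA := lpf_append v A B i hi.le
      rw [lzPhrasesFrom_of_lt hi, lzPhrasesFrom_of_lt hlt]
      by_cases hp : i + max 1 (lpf v (A ++ B) i) ≤ A.length
      · obtain ⟨q, h1, h2, h3, h4⟩ := ih (A.length - (i + max 1 (lpf v (A ++ B) i))) (by omega)
          (i + max 1 (lpf v (A ++ B) i)) rfl hp
        refine ⟨q, h1, h2, ?_, h4⟩
        have hm : lpf v A i = lpf v (A ++ B) i := by rw [hA]; exact min_eq_left (by omega)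
        rw [h3, hm]; ring
      · refine ⟨i + max 1 (lpf v (A ++ B) i), by omega, by omega, ?_, fun _ => ⟨i, hi, ?_⟩⟩
        · rw [lzPhrasesFrom_of_length_le (S := A) (by omega)]; omega
        · have : i + max 1 (lpf v (A ++ B) i) - i = lpf v (A ++ B) i := by omega
          rw [this]
          exact hasPrevOcc_lpf (by omega)

end Basics

/-! ### The binary encoding of larger alphabets -/

theorem flatMap_length_const {α β : Type} (f : α → List β) (c : ℕ) (hf : ∀ a, (f a).length = c)
    (U : List α) : (U.flatMap f).length = c * U.length := by
  induction U with
  | nil => simp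
  | cons a U ih => simp [ih, hf]; ring

theorem flatMap_getElem?_const {α β : Type} (f : α → List β) (c : ℕ)
    (hf : ∀ a, (f a).length = c) :
    ∀ (U : List α) (j d : ℕ), d < c →
      (U.flatMap f)[c * j + d]? = U[j]?.bind fun a => (f a)[d]? := by
  intro U
  induction U with
  | nil => simp
  | cons a U ih =>
    intro j d hd
    rw [List.flatMap_cons]
    cases j with
    | zero => rw [List.getElem?_append_left (by rw [hf]; omega)]; simp
    | succ j =>
      rw [List.getElem?_append_right (by rw [hf]; nlinarith), hf,
        show c * (j + 1) + d - c = c * j + d by rw [Nat.mul_succ]; omega, ih j d hd]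
      simp

/-- The symbol at offset `d` of `code k a`, for `d < 6 * k`. -/
def codeBit (k a d : ℕ) : Bool :=
  if d < 2 * k - 1 then true else if d % 2 = 1 then false
    else a.testBit (k - 1 - (d / 2 - k) % k)

theorem length_binRep (k x : ℕ) : (binRep k x).length = k := by simp [binRep]

theorem length_padZeros (X : List Bool) : (padZeros X).length = 2 * X.length :=
  flatMap_length_const _ 2 (by simp) X

theorem length_code (k a : ℕ) (hk : 0 < k) : (code k a).length = 6 * k := by
  simp only [code, List.length_append, List.length_replicate, length_padZeros, length_binRep,
    List.length_singleton]
  omega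

theorem padZeros_binRep_getElem? (k a d : ℕ) (hd : d < 2 * k) :
    (padZeros (binRep k a))[d]? =
      some (if d % 2 = 1 then false else a.testBit (k - 1 - d / 2)) := by
  have := flatMap_getElem?_const (fun a => [a, false]) 2 (by simp) (binRep k a) (d / 2) (d % 2)
    (Nat.mod_lt _ (by omega))
  rw [show 2 * (d / 2) + d % 2 = d by omega] at this
  rw [padZeros, this]
  have h2 : d / 2 < k := by omega
  have h3 : (binRep k a)[d / 2]? = some (a.testBit (k - 1 - d / 2)) := by
    simp [binRep, h2]
  rw [h3]
  rcases Nat.mod_two_eq_zero_or_one d with h | h <;> simp [h]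

theorem code_getElem? (k a d : ℕ) (hk : 0 < k) (hd : d < 6 * k) :
    (code k a)[d]? = some (codeBit k a d) := by
  unfold code codeBit
  have hl : (List.replicate (2 * k - 1) true ++ [false]).length = 2 * k := by simp; omega
  have hl2 : (List.replicate (2 * k - 1) true ++ [false] ++ padZeros (binRep k a)).length
      = 4 * k := by
    rw [List.length_append, hl, length_padZeros, length_binRep]; omega
  by_cases h1 : d < 2 * k - 1
  · rw [List.getElem?_append_left (by omega), List.getElem?_append_left (by omega),
      List.getElem?_append_left (by simpa using h1)]
    simp [h1]
  rw [if_neg h1]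
  by_cases h2 : d < 2 * k
  · rw [List.getElem?_append_left (by omega), List.getElem?_append_left (by omega),
      List.getElem?_append_right (by simpa using h1)]
    have : d = 2 * k - 1 := by omega
    rw [if_pos (by omega)]
    simp [this]
  by_cases h3 : d < 4 * k
  · rw [List.getElem?_append_left (by omega), List.getElem?_append_right (by omega), hl,
      padZeros_binRep_getElem? _ _ _ (by omega)]
    rw [show (d - 2 * k) % 2 = d % 2 by omega, show (d / 2 - k) % k = (d - 2 * k) / 2 by
      rw [Nat.mod_eq_of_lt (by omega)]; omega]
  · rw [List.getElem?_append_right (by omega), hl2, padZeros_binRep_getElem? _ _ _ (by omega)]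
    rw [show (d - 4 * k) % 2 = d % 2 by omega, show (d / 2 - k) % k = (d - 4 * k) / 2 by
      rw [Nat.mod_eq_sub_mod (by omega), Nat.mod_eq_of_lt (by omega)]; omega]

/-- A symbol is determined by the symbols of its code from offset `c` to `c + 2 * k`, where `c` is
`2 * k` (the first copy of its binary representation) or `4 * k` (the second one). -/
theorem eq_of_codeBit_eq {k a b : ℕ} (c : ℕ) (hc : c = 2 * k ∨ c = 4 * k) (ha : a < 2 ^ k)
    (hb : b < 2 ^ k) (h : ∀ t < 2 * k, codeBit k a (c + t) = codeBit k b (c + t)) : a = b := by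
  apply Nat.eq_of_testBit_eq
  intro r
  by_cases hr : r < k
  · have := h (2 * (k - 1 - r)) (by omega)
    unfold codeBit at this
    rw [if_neg (by omega), if_neg (by omega), if_neg (by omega), if_neg (by omega)] at this
    have h3 : ((c + 2 * (k - 1 - r)) / 2 - k) % k = k - 1 - r := by
      rcases hc with hc | hc
      · rw [Nat.mod_eq_of_lt (by omega)]; omega
      · rw [Nat.mod_eq_sub_mod (by omega), Nat.mod_eq_of_lt (by omega)]; omega
    rw [h3, show k - 1 - (k - 1 - r) = r by omega] at this
    exact this
  · rw [Nat.testBit_lt_two_pow (lt_of_lt_of_le ha (Nat.pow_le_pow_right (by omega) (by omega))),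
      Nat.testBit_lt_two_pow (lt_of_lt_of_le hb (Nat.pow_le_pow_right (by omega) (by omega)))]

/-- Two consecutive symbols `1` occur only in the initial run of a code. -/
theorem codeBit_false_or {k a d : ℕ} (hd : 2 * k - 1 ≤ d) :
    codeBit k a d = false ∨ codeBit k a (d + 1) = false := by
  unfold codeBit
  rcases Nat.mod_two_eq_zero_or_one d with h | h
  · right; rw [if_neg (by omega), if_pos (by omega)]
  · left; rw [if_neg (by omega), if_pos (by omega)]

theorem codeBit_odd {k a d : ℕ} (hd : 2 * k - 1 ≤ d) (h : d % 2 = 1) : codeBit k a d = false := by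
  unfold codeBit
  rw [if_neg (by omega), if_pos h]

/-- `S` consists of the codes of `u 0, …, u (q - 1)`, a symbol `1`, and the codes of
`x 0, …, x (n - 1)`, where `c = 6 * k` is the length of a code. Every `x i` is among the `u j`,
but no two consecutive `u j` are both among the `x i`. -/
structure CodeLayout (S : List Bool) (k c q n : ℕ) (u x : ℕ → ℕ) : Prop where
  two_le : 2 ≤ k
  c_eq : c = 6 * k
  length_eq : S.length = c * q + 1 + c * n
  getElem_u : ∀ j < q, ∀ d < c, S[c * j + d]? = some (codeBit k (u j) d)
  getElem_mid : S[c * q]? = some true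
  getElem_x : ∀ i < n, ∀ d < c, S[c * q + 1 + c * i + d]? = some (codeBit k (x i) d)
  u_lt : ∀ j < q, u j < 2 ^ k
  x_lt : ∀ i < n, x i < 2 ^ k
  u_pair : ∀ j, j + 1 < q → ∀ i < n, ∀ i' < n, u j = x i → u (j + 1) ≠ x i'
  exists_u : ∀ i < n, ∃ j < q, u j = x i

namespace CodeLayout

variable {S : List Bool} {k c q n : ℕ} {u x : ℕ → ℕ}

/-- If `1 ^ (2 * k - 1)` occurs at offset `e` in a code, then `e = 0`: it does not fit into the
rest of the initial run, and elsewhere it would contain two adjacent symbols `1` of a padded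
representation. -/
theorem marker_offset (hk : 2 ≤ k) (hc : c = 6 * k) {b a e : ℕ}
    (hb : ∀ d < c, S[b + d]? = some (codeBit k a d)) (he : e < c)
    (h1 : ∀ t < 2 * k - 1, S[b + e + t]? = some true) : e = 0 := by
  by_contra h0
  by_cases h : e < 2 * k - 1
  · have h2 := h1 (2 * k - 1 - e) (by omega)
    rw [show b + e + (2 * k - 1 - e) = b + (2 * k - 1) by omega, hb _ (by omega),
      codeBit_odd (by omega) (by omega)] at h2
    simp at h2
  · have h2 := h1 0 (by omega)
    have h3 := h1 1 (by omega)
    rw [add_zero, hb e he] at h2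
    rcases codeBit_false_or (k := k) (a := a) (d := e) (by omega) with h4 | h4
    · rw [h4] at h2; simp at h2
    · by_cases h5 : e + 1 < c
      · rw [add_assoc, hb _ h5, h4] at h3; simp at h3
      · rw [codeBit_odd (by omega) (by omega)] at h2; simp at h2

/-- The word `1 ^ (2 * k - 1) 0` occurs at the beginnings of codes only. -/
theorem marker (H : CodeLayout S k c q n u x) {p : ℕ}
    (h1 : ∀ t < 2 * k - 1, S[p + t]? = some true) (h2 : S[p + (2 * k - 1)]? = some false) :
    (∃ j < q, p = c * j) ∨ ∃ i < n, p = c * q + 1 + c * i := by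
  have hk := H.two_le
  have hc := H.c_eq
  have hc0 : 0 < c := by omega
  rcases lt_trichotomy p (c * q) with hp | hp | hp
  · left
    have hj : p / c < q := by rw [Nat.div_lt_iff_lt_mul hc0, mul_comm]; exact hp
    have hm := Nat.div_add_mod p c
    have := marker_offset (S := S) hk hc (H.getElem_u _ hj) (Nat.mod_lt p hc0)
      (by rw [hm]; exact h1)
    exact ⟨p / c, hj, by omega⟩
  · exfalso
    have hlen : p + (2 * k - 1) < S.length := by
      by_contra h
      rw [List.getElem?_eq_none (by omega)] at h2
      simp at h2
    have hn : 0 < n := by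
      rcases Nat.eq_zero_or_pos n with h | h
      · have := H.length_eq
        rw [h, mul_zero] at this; omega
      · exact h
    have h3 := H.getElem_x 0 hn (2 * k - 2) (by omega)
    rw [show c * q + 1 + c * 0 + (2 * k - 2) = p + (2 * k - 1) by rw [mul_zero]; omega, h2] at h3
    unfold codeBit at h3
    rw [if_pos (by omega)] at h3
    simp at h3
  · right
    obtain ⟨r, rfl⟩ : ∃ r, p = c * q + 1 + r := ⟨p - (c * q + 1), by omega⟩
    have hlen : c * q + 1 + r < S.length := by
      by_contra h
      have := h1 0 (by omega)
      rw [List.getElem?_eq_none (by omega)] at this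
      simp at this
    rw [H.length_eq] at hlen
    have hj : r / c < n := by rw [Nat.div_lt_iff_lt_mul hc0, mul_comm]; omega
    have hm := Nat.div_add_mod r c
    have := marker_offset (S := S) hk hc (H.getElem_x _ hj) (Nat.mod_lt r hc0)
      (by rw [show c * q + 1 + c * (r / c) + r % c = c * q + 1 + r by omega]; exact h1)
    exact ⟨r / c, hj, by omega⟩

/-- A phrase that starts within the marker or the first half of a code and covers the marker and
the first half of a later code comes from an earlier occurrence of all symbols concerned. -/
theorem hasPrevOcc_of_code (H : CodeLayout S k c q n u x) {T : List ℕ}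
    (hT : ∀ i < n, T[i]? = some (x i)) {v : LZVariant} {i e d : ℕ} (he : 0 < e) (hi : i + e < n)
    (hd : d < 4 * k) (h : HasPrevOcc v S (c * q + 1 + c * i + d) (c * e + 4 * k - d)) :
    HasPrevOcc v T i (e + 1) := by
  have hk := H.two_le
  have hc := H.c_eq
  have hc0 : 0 < c := by omega
  have hce : c ≤ c * e := Nat.le_mul_of_pos_right c he
  rw [hasPrevOcc_iff] at h
  obtain ⟨j, hj, hadm, hs⟩ := h
  have hnext : ∀ t < c,
      S[c * q + 1 + c * i + d + (c - d + t)]? = some (codeBit k (x (i + 1)) t) := by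
    intro t ht
    rw [← H.getElem_x (i + 1) (by omega) t ht, mul_add, mul_one]
    congr 1; omega
  have hsame : ∀ t, d ≤ t → t < c →
      S[c * q + 1 + c * i + d + (t - d)]? = some (codeBit k (x i) t) := by
    intro t hdt ht
    rw [← H.getElem_x i (by omega) t ht]
    congr 1; omega
  -- The source contains a marker where the code of `x (i + 1)` begins.
  have hm := H.marker (p := j + (c - d))
    (by
      intro t ht
      rw [add_assoc, hs _ (by omega), hnext t (by omega)]
      simp [codeBit, ht])
    (by
      rw [add_assoc, hs _ (by omega), hnext _ (by omega), codeBit_odd le_rfl (by omega)])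
  rcases hm with ⟨p, hp, hpj⟩ | ⟨p, hp, hpj⟩
  · exfalso
    -- In the preamble, the source would contain the second half of the code of `u p` and the first
    -- half of the code of `u (p + 1)`, which would be `x i` and `x (i + 1)`.
    obtain ⟨p, rfl⟩ : ∃ p', p = p' + 1 := ⟨p - 1, by
      rcases Nat.eq_zero_or_pos p with h | h
      · rw [h, mul_zero] at hpj; omega
      · omega⟩
    rw [mul_add, mul_one] at hpj
    refine H.u_pair p hp i (by omega) (i + 1) (by omega) ?_ ?_
    · refine eq_of_codeBit_eq (4 * k) (Or.inr rfl) (H.u_lt _ (by omega)) (H.x_lt _ (by omega)) ?_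
      intro t ht
      have h1 := hs (4 * k + t - d) (by omega)
      rw [hsame _ (by omega) (by omega), show j + (4 * k + t - d) = c * p + (4 * k + t) by omega,
        H.getElem_u _ (by omega) _ (by omega)] at h1
      exact Option.some_injective _ h1
    · refine eq_of_codeBit_eq (2 * k) (Or.inl rfl) (H.u_lt _ (by omega)) (H.x_lt _ (by omega)) ?_
      intro t ht
      have h1 := hs (c - d + (2 * k + t)) (by omega)
      rw [hnext _ (by omega), show j + (c - d + (2 * k + t)) = c * (p + 1) + (2 * k + t) by
        rw [mul_add]; omega, H.getElem_u _ (by omega) _ (by omega)] at h1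
      exact Option.some_injective _ h1
  -- Otherwise the marker belongs to some `x (p + 1)`; it is not that of `x 0`, because the symbol
  -- before it is the last symbol of a code, which is `0`.
  · rcases Nat.eq_zero_or_pos p with h0 | h0
    · exfalso
      rw [h0, mul_zero] at hpj
      have h1 := hs (c - 1 - d) (by omega)
      rw [hsame _ (by omega) (by omega), show j + (c - 1 - d) = c * q by omega, H.getElem_mid,
        codeBit_odd (by omega) (by omega)] at h1
      simp at h1
    obtain ⟨p, rfl⟩ : ∃ p', p = p' + 1 := ⟨p - 1, by omega⟩
    have hj' : j = c * q + 1 + c * p + d := by rw [mul_add, mul_one] at hpj; omega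
    have hpi : p < i := by
      have : c * p < c * i := by omega
      exact lt_of_mul_lt_mul_left this (by omega)
    rw [hasPrevOcc_iff]
    refine ⟨p, hpi, ?_, ?_⟩
    · cases v
      · exact hpi
      · refine ⟨hpi, ?_⟩
        have h1 := hadm.2
        have : c * (p + e) < c * i := by
          have h2 : c * i ≤ c * (p + e) ∨ c * (p + e) < c * i := le_or_gt _ _
          rcases h2 with h2 | h2
          · exfalso; rw [mul_add] at h2; omega
          · exact h2
        have := lt_of_mul_lt_mul_left this (by omega)
        omega
    · intro r hr
      rw [hT _ (by omega), hT _ (by omega)]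
      congr 1
      have hcr : c * r ≤ c * e := Nat.mul_le_mul_left c (by omega)
      rcases Nat.eq_zero_or_pos r with hr0 | hr0
      · subst hr0
        refine eq_of_codeBit_eq (4 * k) (Or.inr rfl) (H.x_lt _ (by omega)) (H.x_lt _ (by omega)) ?_
        intro t ht
        have h1 := hs (4 * k + t - d) (by omega)
        rw [hsame _ (by omega) (by omega),
          show j + (4 * k + t - d) = c * q + 1 + c * p + (4 * k + t) by omega,
          H.getElem_x _ (by omega) _ (by omega)] at h1
        exact Option.some_injective _ h1
      · have hcr1 : c ≤ c * r := Nat.le_mul_of_pos_right c hr0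
        refine eq_of_codeBit_eq (2 * k) (Or.inl rfl) (H.x_lt _ (by omega)) (H.x_lt _ (by omega)) ?_
        intro t ht
        have h1 := hs (c * r - d + (2 * k + t)) (by omega)
        rw [show j + (c * r - d + (2 * k + t)) = c * q + 1 + c * (p + r) + (2 * k + t) by
            rw [mul_add]; omega,
          show c * q + 1 + c * i + d + (c * r - d + (2 * k + t))
            = c * q + 1 + c * (i + r) + (2 * k + t) by rw [mul_add]; omega,
          H.getElem_x _ (by omega) _ (by omega), H.getElem_x _ (by omega) _ (by omega)] at h1
        exact Option.some_injective _ h1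

/-- Earlier occurrences in `T`, and the codes at the beginning of `S`, are sources in `S`. -/
theorem code_hasPrevOcc (H : CodeLayout S k c q n u x) {T : List ℕ}
    (hT : ∀ i < n, T[i]? = some (x i)) {v : LZVariant} {i e d : ℕ} (hi : i + e ≤ n)
    (hd : d < c) (h : e = 1 ∨ HasPrevOcc v T i e) :
    HasPrevOcc v S (c * q + 1 + c * i + d) (c * e - d) := by
  have hc0 : 0 < c := by omega
  rw [hasPrevOcc_iff]
  rcases h with rfl | h
  · obtain ⟨j, hj, hu⟩ := H.exists_u i (by omega)
    have hjq : c * j + c ≤ c * q := by rw [← Nat.mul_succ]; exact Nat.mul_le_mul_left c hj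
    refine ⟨c * j + d, by omega, v.admits_of_add_le (by omega) (by omega), ?_⟩
    intro t ht
    rw [add_assoc, H.getElem_u _ hj _ (by omega), add_assoc (c * q + 1 + c * i),
      H.getElem_x _ (by omega) _ (by omega), hu]
  · rw [hasPrevOcc_iff] at h
    obtain ⟨j, hj, hadm, hs⟩ := h
    have hji : c * j < c * i := Nat.mul_lt_mul_of_pos_left hj hc0
    refine ⟨c * q + 1 + c * j + d, by omega, ?_, ?_⟩
    · cases v
      · simp only [LZVariant.Admits]; omega
      · refine ⟨by omega, ?_⟩
        have := Nat.mul_le_mul_left c hadm.2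
        rw [mul_add] at this
        omega
    · intro t ht
      have hm := Nat.div_add_mod (d + t) c
      have hml := Nat.mod_lt (d + t) hc0
      have hr : (d + t) / c < e := by
        rw [Nat.div_lt_iff_lt_mul hc0, mul_comm]; omega
      have h1 := hs _ hr
      rw [hT _ (by omega), hT _ (by omega)] at h1
      rw [show c * q + 1 + c * j + d + t
          = c * q + 1 + c * (j + (d + t) / c) + (d + t) % c by rw [mul_add]; omega,
        show c * q + 1 + c * i + d + t
          = c * q + 1 + c * (i + (d + t) / c) + (d + t) % c by rw [mul_add]; omega,
        H.getElem_x _ (by omega) _ hml, H.getElem_x _ (by omega) _ hml,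
        Option.some_injective _ h1]

/-- Phrase by phrase, the parsing of `S` from a position in the marker or the first half of
the code of `x i` follows the parsing of `T` from position `i`. -/
theorem lzPhrasesFrom_eq (H : CodeLayout S k c q n u x) {T : List ℕ} (hTn : T.length = n)
    (hT : ∀ i < n, T[i]? = some (x i)) (v : LZVariant) :
    ∀ r i d, n - i = r → i ≤ n → d < 4 * k →
      lzPhrasesFrom v S (c * q + 1 + c * i + d) = lzPhrasesFrom v T i := by
  have hk := H.two_le
  have hc := H.c_eq
  have hlen := H.length_eq
  intro r
  induction r using Nat.strong_induction_on with
  | _ r ih =>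
    intro i d hr hi hd
    rcases hi.eq_or_lt with rfl | hi
    · rw [lzPhrasesFrom_of_length_le (by omega), lzPhrasesFrom_of_length_le (by omega)]
    have hci : c * i + c ≤ c * n := by rw [← Nat.mul_succ]; exact Nat.mul_le_mul_left c hi
    rw [lzPhrasesFrom_of_lt (S := T) (by omega), lzPhrasesFrom_of_lt (S := S) (by omega)]
    congr 1
    obtain ⟨e, he⟩ : ∃ e, e = max 1 (lpf v T i) := ⟨_, rfl⟩
    have hle := lpf_le v T i
    have hen : i + e ≤ n := by omega
    rw [← he]
    have hcen := Nat.mul_le_mul_left c hen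
    rw [mul_add] at hcen
    have hce : c ≤ c * e := Nat.le_mul_of_pos_right c (by omega)
    have hlow : c * e - d ≤ lpf v S (c * q + 1 + c * i + d) := by
      refine (H.code_hasPrevOcc hT (v := v) hen (by omega) ?_).le_lpf (by omega)
      by_cases h1 : e = 1
      · exact Or.inl h1
      · right
        have h2 : e = lpf v T i := by omega
        rw [h2]
        exact hasPrevOcc_lpf (by omega)
    rcases hen.eq_or_lt with hen' | hen'
    · rw [lzPhrasesFrom_of_length_le (S := T) (by omega),
        lzPhrasesFrom_of_length_le (S := S)]
      rw [hlen, ← hen', mul_add]; omega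
    · have hup : lpf v S (c * q + 1 + c * i + d) < c * e + 4 * k - d := by
        refine lpf_lt_of_not_hasPrevOcc ?_ (by omega)
        intro h
        have h1 := H.hasPrevOcc_of_code hT (by omega) hen' hd h
        have h2 := h1.le_lpf (by omega)
        omega
      obtain ⟨f, hf⟩ : ∃ f, lpf v S (c * q + 1 + c * i + d) = c * e - d + f :=
        ⟨_, (Nat.add_sub_cancel' hlow).symm⟩
      rw [← ih (n - (i + e)) (by omega) (i + e) f rfl hen (by omega)]
      congr 1
      rw [mul_add]; omega

/-- No phrase that starts among the first codes extends far into the codes of the `x i`, because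
`1 ^ (2 * k)` has no occurrence before the symbol `1` in the middle. -/
theorem lt_of_hasPrevOcc (H : CodeLayout S k c q n u x) (hn : 0 < n) {v : LZVariant} {i p : ℕ}
    (hi : i < c * q + 1) (h : HasPrevOcc v S i (p - i)) : p < c * q + 2 * k := by
  have hk := H.two_le
  have hc := H.c_eq
  have hc0 : 0 < c := by omega
  by_contra hp
  rw [hasPrevOcc_iff] at h
  obtain ⟨j, hj, -, hs⟩ := h
  have key : ∀ t < 2 * k, S[j + (c * q - i) + t]? = some true := by
    intro t ht
    rw [add_assoc, hs _ (by omega), show i + (c * q - i + t) = c * q + t by omega]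
    rcases Nat.eq_zero_or_pos t with h0 | h0
    · rw [h0]; exact H.getElem_mid
    · have := H.getElem_x 0 hn (t - 1) (by omega)
      rw [mul_zero, show c * q + 1 + 0 + (t - 1) = c * q + t by omega] at this
      rw [this]
      simp only [codeBit]
      rw [if_pos (by omega)]
  obtain ⟨w, hw⟩ : ∃ w, w = j + (c * q - i) := ⟨_, rfl⟩
  rw [← hw] at key
  have hlt : w < c * q := by omega
  have hjq : w / c < q := by rw [Nat.div_lt_iff_lt_mul hc0, mul_comm]; exact hlt
  have hm := Nat.div_add_mod w c
  have h0 := marker_offset (S := S) hk hc (H.getElem_u _ hjq) (Nat.mod_lt w hc0)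
    (by rw [hm]; exact fun t ht => key t (by omega))
  have h1 := key (2 * k - 1) (by omega)
  rw [← hm, h0, add_zero, H.getElem_u _ hjq _ (by omega), codeBit_odd le_rfl (by omega)] at h1
  simp at h1

end CodeLayout

theorem codePreamble_eq (σ : ℕ) : codePreamble σ =
    ((List.range σ).flatMap fun a => [a, σ]).flatMap (code (Nat.clog 2 (σ + 1))) ++ [true] := by
  rw [codePreamble, List.flatMap_assoc]
  simp

/-- The preamble consists of the codes of `0, σ, 1, σ, …, σ - 1, σ` and a symbol `1`; the symbol
`σ` does not occur in `T`. -/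
theorem codeLayout (σ : ℕ) (T : List ℕ) (hσ : 3 ≤ σ) (hT : ∀ a ∈ T, a < σ) :
    CodeLayout (codePreamble σ ++ encodeString σ T) (Nat.clog 2 (σ + 1))
      (6 * Nat.clog 2 (σ + 1)) (2 * σ) T.length (fun j => if j % 2 = 0 then j / 2 else σ)
      (fun i => T.getD i 0) := by
  rw [codePreamble_eq, encodeString]
  set U := (List.range σ).flatMap fun a => [a, σ] with hU
  obtain ⟨k, hk⟩ : ∃ k, k = Nat.clog 2 (σ + 1) := ⟨_, rfl⟩
  rw [← hk]
  have hk2 : 2 ≤ k := by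
    rw [hk]
    by_contra h
    have h1 := Nat.le_pow_clog (b := 2) (by norm_num) (σ + 1)
    have h2 : 2 ^ Nat.clog 2 (σ + 1) ≤ 2 ^ 1 := Nat.pow_le_pow_right (by norm_num) (by omega)
    omega
  have hσk : σ < 2 ^ k := by
    have h1 := Nat.le_pow_clog (b := 2) (by norm_num) (σ + 1)
    rw [← hk] at h1; omega
  have hlc : ∀ a, (code k a).length = 6 * k := fun a => length_code k a (by omega)
  have hUl : U.length = 2 * σ := by
    rw [hU, flatMap_length_const _ 2 (by simp)]; simp
  have hUg : ∀ j < 2 * σ, U[j]? = some (if j % 2 = 0 then j / 2 else σ) := by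
    intro j hj
    have h1 := flatMap_getElem?_const (fun a => [a, σ]) 2 (by simp) (List.range σ) (j / 2) (j % 2)
      (Nat.mod_lt _ (by omega))
    rw [show 2 * (j / 2) + j % 2 = j by omega, ← hU, List.getElem?_range (by omega)] at h1
    rw [h1]
    rcases Nat.mod_two_eq_zero_or_one j with h | h <;> simp [h]
  have hTg : ∀ i < T.length, T[i]? = some (T.getD i 0) := by
    intro i hi; simp [hi]
  have hTlt : ∀ i < T.length, T.getD i 0 < σ := by
    intro i hi
    have : T.getD i 0 = T[i] := by simp [hi]
    rw [this]; exact hT _ (List.getElem_mem hi)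
  have hLl : (U.flatMap (code k)).length = 6 * k * (2 * σ) := by
    rw [flatMap_length_const _ _ hlc, hUl]
  have hLl' : (U.flatMap (code k) ++ [true]).length = 6 * k * (2 * σ) + 1 := by
    rw [List.length_append, hLl]; simp
  refine ⟨hk2, rfl, ?_, ?_, ?_, ?_, ?_, ?_, ?_, ?_⟩
  · rw [List.length_append, hLl', flatMap_length_const _ _ hlc]
  · intro j hj d hd
    have hjq : 6 * k * j + 6 * k ≤ 6 * k * (2 * σ) := by
      rw [← Nat.mul_succ]; exact Nat.mul_le_mul_left _ hj
    rw [List.getElem?_append_left (by omega), List.getElem?_append_left (by omega),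
      flatMap_getElem?_const _ _ hlc _ _ _ hd, hUg j hj]
    simp only [Option.bind_some]
    exact code_getElem? k _ d (by omega) hd
  · rw [List.getElem?_append_left (by omega), List.getElem?_append_right (by omega), hLl]
    simp
  · intro i hi d hd
    rw [List.getElem?_append_right (by omega), hLl',
      show 6 * k * (2 * σ) + 1 + 6 * k * i + d - (6 * k * (2 * σ) + 1) = 6 * k * i + d by omega,
      flatMap_getElem?_const _ _ hlc _ _ _ hd, hTg i hi]
    simp only [Option.bind_some]
    exact code_getElem? k _ d (by omega) hd
  · intro j hj
    split_ifs <;> omega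
  · intro i hi
    have := hTlt i hi; omega
  · intro j hj i hi i' hi' h1 h2
    have h3 := hTlt i hi
    have h4 := hTlt i' hi'
    split_ifs at h1 h2 <;> omega
  · intro i hi
    have h3 := hTlt i hi
    exact ⟨2 * T.getD i 0, by omega, by simp⟩

/-- The first phrase that reaches the end of the preamble ends within the marker or the first half
of the first code, and from there on the parsing follows that of `T`. -/
theorem lzSize_codePreamble_append (v : LZVariant) (σ : ℕ) (T : List ℕ) (hσ : 3 ≤ σ) (hT0 : T ≠ [])
    (hT : ∀ a ∈ T, a < σ) :
    lzSize v (codePreamble σ ++ encodeString σ T) = lzSize v (codePreamble σ) + lzSize v T := by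
  have H := codeLayout σ T hσ hT
  have hk := H.two_le
  have hn : 0 < T.length := List.length_pos_of_ne_nil hT0
  have hlen : (codePreamble σ).length = 6 * Nat.clog 2 (σ + 1) * (2 * σ) + 1 := by
    have h1 := H.length_eq
    rw [List.length_append, encodeString,
      flatMap_length_const _ _ fun a => length_code (Nat.clog 2 (σ + 1)) a (by omega)] at h1
    omega
  obtain ⟨q, h1, -, h3, h4⟩ := exists_lzPhrasesFrom_append v (codePreamble σ) (encodeString σ T)
    _ 0 rfl (by omega)
  unfold lzSize
  rw [h3]
  congr 1
  have hq : q < (codePreamble σ).length + 4 * Nat.clog 2 (σ + 1) := by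
    rcases h1.eq_or_lt with h | h
    · omega
    · obtain ⟨i, hi, hp⟩ := h4 h
      have := H.lt_of_hasPrevOcc hn (by omega) hp
      omega
  have h5 := H.lzPhrasesFrom_eq rfl (by intro i hi; simp [hi]) v _ 0
    (q - (codePreamble σ).length) rfl (by omega) (by omega)
  rw [← h5, mul_zero]
  congr 1; omega

/-! ### Phrases of an explicitly given string -/

section Infix

variable {α : Type}

theorem infix_of_infix_append_of_head_notMem {x : α} {w M Z : List α} (hx : x ∉ M)
    (h : x :: w <:+: M ++ Z) : x :: w <:+: Z := by
  induction M with
  | nil => exact h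
  | cons y M ih =>
    simp only [List.mem_cons, not_or] at hx
    rw [List.cons_append, List.infix_cons_iff] at h
    rcases h with h | h
    · exact absurd (List.cons_prefix_cons.1 h).1 hx.1
    · exact ih hx.2 h

theorem infix_or_infix_of_notMem {w A B : List α} {s : α} (hs : s ∉ w) (h : w <:+: A ++ s :: B) :
    w <:+: A ∨ w <:+: B := by
  rcases List.infix_append_iff_ne_nil.1 h with h | h | ⟨w₁, w₂, -, h2, rfl, -, h3⟩
  · exact Or.inl h
  · rcases List.infix_cons_iff.1 h with h | h
    · cases w with
      | nil => exact Or.inl A.nil_infix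
      | cons x w => exact absurd (List.cons_prefix_cons.1 h).1 (by rintro rfl; simp at hs)
    · exact Or.inr h
  · cases w₂ with
    | nil => exact absurd rfl h2
    | cons x w₂ => exact absurd (List.cons_prefix_cons.1 h3).1 (by rintro rfl; simp at hs)

theorem infix_or_infix_of_disjoint {w A M B : List α} (hw : w ≠ []) (hM : M ≠ [])
    (hs : ∀ s ∈ M, s ∉ w) (h : w <:+: A ++ (M ++ B)) : w <:+: A ∨ w <:+: B := by
  cases M with
  | nil => exact absurd rfl hM
  | cons s M =>
    rw [List.cons_append] at h
    rcases infix_or_infix_of_notMem (hs s (by simp)) h with h | h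
    · exact Or.inl h
    · right
      cases w with
      | nil => exact absurd rfl hw
      | cons x w =>
        exact infix_of_infix_append_of_head_notMem (fun hx => hs x (by simp [hx]) (by simp)) h

end Infix

/-- A word `X` that occurs in the part `A` of the string before it is a phrase if its extension by
one symbol has no earlier occurrence. -/
theorem lzPhrasesFrom_of_infix {α : Type} [DecidableEq α] (v : LZVariant) {S A X B : List α}
    (hS : S = A ++ X ++ B) (hX : X ≠ []) (hXA : X <:+: A)
    (hB : ∀ c B', B = c :: B' → ¬ X ++ [c] <:+: A ++ X) :
    lzPhrasesFrom v S A.length = lzPhrasesFrom v S (A ++ X).length + 1 := by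
  have hX0 : 0 < X.length := List.length_pos_of_ne_nil hX
  have hSl : S.length = A.length + X.length + B.length := by rw [hS]; simp; ring
  have hlow : X.length ≤ lpf v S A.length := by
    refine HasPrevOcc.le_lpf ?_ (by omega)
    obtain ⟨s, t, hst⟩ := hXA
    have hl : s.length + X.length + t.length = A.length := by rw [← hst]; simp; ring
    refine ⟨s.length, by omega, v.admits_of_add_le (by omega) (by omega), ?_⟩
    have h1 : S.drop A.length = X ++ B := by rw [hS, List.append_assoc, List.drop_left]
    have h2 : S.drop s.length = X ++ (t ++ (X ++ B)) := by
      rw [hS, ← hst]; simp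
    rw [h1, h2, List.take_left, List.take_left]
  have hup : lpf v S A.length ≤ X.length := by
    cases hBc : B with
    | nil =>
      have := lpf_le v S A.length
      rw [hBc] at hSl
      simp only [List.length_nil] at hSl; omega
    | cons c B' =>
      refine Nat.lt_succ_iff.1 (lpf_lt_of_not_hasPrevOcc ?_ (Nat.succ_pos _))
      rintro ⟨j, hj, -, h⟩
      refine hB c B' hBc ?_
      have h1 : (S.drop A.length).take X.length.succ = X ++ [c] := by
        rw [hS, List.append_assoc, List.drop_left, hBc,
          show X ++ c :: B' = (X ++ [c]) ++ B' by simp, List.take_left' (by simp)]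
      have h2 : (S.drop j).take X.length.succ = ((A ++ X).drop j).take X.length.succ := by
        rw [hS, List.drop_append_of_le_length (by simp; omega),
          List.take_append_of_le_length (by simp; omega)]
      rw [← h1, ← h, h2]
      exact (List.take_prefix _ _).isInfix.trans (List.drop_suffix _ _).isInfix
  rw [lzPhrasesFrom_of_lt (by omega), show max 1 (lpf v S A.length) = X.length by omega,
    List.length_append]

theorem lzPhrasesFrom_last {α : Type} [DecidableEq α] (v : LZVariant) {S A : List α} {c : α}
    (hS : S = A ++ [c]) : lzPhrasesFrom v S A.length = 1 := by
  have : S.length = A.length + 1 := by rw [hS]; simp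
  rw [lzPhrasesFrom_of_lt (by omega), lzPhrasesFrom_of_length_le (by omega)]

/-- No phrase crosses the first occurrence of a symbol. -/
theorem lzSize_append_of_notMem {α : Type} [DecidableEq α] (v : LZVariant) {A B : List α} {c : α}
    (hc : c ∉ A) : lzSize v (A ++ [c] ++ B) =
      lzSize v (A ++ [c]) + lzPhrasesFrom v (A ++ [c] ++ B) (A ++ [c]).length := by
  obtain ⟨q, h1, -, h3, h4⟩ := exists_lzPhrasesFrom_append v (A ++ [c]) B _ 0 rfl (by omega)
  rcases h1.eq_or_lt with h | h
  · rw [h]; exact h3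
  · exfalso
    obtain ⟨i, hi, hp⟩ := h4 h
    rw [hasPrevOcc_iff] at hp
    obtain ⟨j, hj, -, hs⟩ := hp
    simp only [List.length_append, List.length_singleton] at hi h
    have h5 := hs (A.length - i) (by omega)
    rw [show i + (A.length - i) = A.length by omega, List.append_assoc,
      List.getElem?_append_left (by omega), List.getElem?_append_right le_rfl] at h5
    simp only [Nat.sub_self, List.singleton_append, List.getElem?_cons_zero] at h5
    exact hc (List.mem_of_getElem? h5)

/-! ### The string that encodes an instance of Dictionary Matching -/

theorem le_one_of_mem_bits {P : List Bool} {x : ℕ} (h : x ∈ bits P) : x ≤ 1 := by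
  simp only [bits, List.mem_map] at h
  obtain ⟨a, -, rfl⟩ := h
  cases a <;> simp

theorem of_mem_primed {P : List Bool} {x : ℕ} (h : x ∈ primed P) : 2 ≤ x ∧ x ≤ 3 := by
  simp only [primed, List.mem_map] at h
  obtain ⟨a, -, rfl⟩ := h
  cases a <;> simp

theorem length_bits (P : List Bool) : (bits P).length = P.length := by simp [bits]

theorem length_primed (P : List Bool) : (primed P).length = P.length := by simp [primed]

theorem bits_append (P Q : List Bool) : bits (P ++ Q) = bits P ++ bits Q := by simp [bits]

theorem bits_injective : Function.Injective bits :=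
  List.map_injective_iff.2 (by intro a b; cases a <;> cases b <;> simp)

theorem primed_injective : Function.Injective primed :=
  List.map_injective_iff.2 (by intro a b; cases a <;> cases b <;> simp)

theorem bits_ne_nil {P : List Bool} (h : 0 < P.length) : bits P ≠ [] :=
  List.ne_nil_of_length_pos (by rwa [length_bits])

theorem bits_infix_bits {P T : List Bool} : bits P <:+: bits T ↔ P <:+: T := by
  constructor
  · rintro ⟨s, t, h⟩
    rw [bits, bits, eq_comm, List.map_eq_append_iff] at h
    obtain ⟨T₁, T₂, rfl, h1, -⟩ := h
    rw [List.map_eq_append_iff] at h1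
    obtain ⟨T₃, T₄, rfl, -, h2⟩ := h1
    rw [bits_injective h2]
    exact List.infix_append _ _ _
  · intro h; exact h.map _

theorem exists_nextFirst (m : ℕ) (F : List (List Bool)) :
    ∃ d : List Bool, d.length ≤ 1 ∧ nextFirst m F = bits d :=
  ⟨_, by simp, rfl⟩

/-- The pieces between the separators `4` of the gadgets. -/
theorem infix_gadgets {m : ℕ} {w : List ℕ} (h4 : 4 ∉ w) (hw : w ≠ []) :
    ∀ {D : List (List Bool)}, w <:+: gadgets m D → ∃ P ∈ D,
      w <:+: bits (P.drop 1) ∨ w <:+: bits (P.take (m - 1)) ∨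
        w <:+: bits (P.drop (m - 1)) ++ primed P ∨
        ∃ d : List Bool, d.length ≤ 1 ∧ w <:+: primed P ++ bits d := by
  intro D
  induction D with
  | nil => intro h; exact absurd (List.infix_nil.1 h) hw
  | cons P D ih =>
    intro h
    rw [gadgets] at h
    simp only [List.append_assoc, List.singleton_append] at h
    rcases infix_or_infix_of_notMem h4 h with h | h
    · exact ⟨P, by simp, Or.inl h⟩
    rcases infix_or_infix_of_notMem h4 h with h | h
    · exact ⟨P, by simp, Or.inr (Or.inl h)⟩
    have h' : w <:+: (bits (P.drop (m - 1)) ++ primed P) ++ 4 ::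
        (primed P ++ (nextFirst m D ++ 4 :: gadgets m D)) := by simpa using h
    rcases infix_or_infix_of_notMem h4 h' with h | h
    · exact ⟨P, by simp, Or.inr (Or.inr (Or.inl h))⟩
    rw [← List.append_assoc] at h
    rcases infix_or_infix_of_notMem h4 h with h | h
    · obtain ⟨d, hd, hd'⟩ := exists_nextFirst m D
      exact ⟨P, by simp, Or.inr (Or.inr (Or.inr ⟨d, hd, hd' ▸ h⟩))⟩
    · obtain ⟨Q, hQ, h⟩ := ih h
      exact ⟨Q, by simp [hQ], h⟩

theorem infix_encS {m : ℕ} {T : List Bool} {D : List (List Bool)} {w Z : List ℕ}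
    (hw : ∀ x ∈ w, x ≤ 3) (h : w <:+: encS1 T ++ encS2 m D ++ Z) :
    w <:+: bits T ∨ w <:+: gadgets m D ∨ w <:+: Z := by
  rw [encS1, encS2] at h
  simp only [List.append_assoc, List.singleton_append] at h
  rcases infix_or_infix_of_notMem (s := 5) (fun h5 => by have := hw _ h5; omega) h with h | h
  · exact Or.inl h
  have h' : w <:+: gadgets m D ++ 6 :: Z := by simpa using h
  rcases infix_or_infix_of_notMem (s := 6) (fun h5 => by have := hw _ h5; omega) h' with h | h
  · exact Or.inr (Or.inl h)
  · exact Or.inr (Or.inr h)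

theorem gadgets_infix (m : ℕ) (P : List Bool) (F : List (List Bool)) :
    ∀ E, bits (P.drop 1) <:+: gadgets m (E ++ P :: F) ∧
      bits (P.take (m - 1)) <:+: gadgets m (E ++ P :: F) ∧
      bits (P.drop (m - 1)) ++ primed P <:+: gadgets m (E ++ P :: F) ∧
      primed P ++ nextFirst m F <:+: gadgets m (E ++ P :: F) := by
  intro E
  induction E with
  | nil =>
    rw [List.nil_append, gadgets]
    refine ⟨?_, ?_, ?_, ?_⟩
    · exact ⟨[], _, by simp only [List.nil_append, List.append_assoc]; rfl⟩
    · exact ⟨bits (P.drop 1) ++ [4], _, by simp only [List.append_assoc]; rfl⟩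
    · exact ⟨bits (P.drop 1) ++ [4] ++ bits (P.take (m - 1)) ++ [4], _, by
        simp only [List.append_assoc]; rfl⟩
    · exact ⟨bits (P.drop 1) ++ [4] ++ bits (P.take (m - 1)) ++ [4] ++ bits (P.drop (m - 1)) ++
        primed P ++ [4], _, by simp only [List.append_assoc]; rfl⟩
  | cons Q E ih =>
    rw [List.cons_append, gadgets]
    exact ⟨List.infix_append_of_infix_right ih.1, List.infix_append_of_infix_right ih.2.1,
      List.infix_append_of_infix_right ih.2.2.1, List.infix_append_of_infix_right ih.2.2.2⟩

/-- The string of the patterns, each followed by its primed copy. -/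
def patternPairs (E : List (List Bool)) : List ℕ := E.flatMap fun P => bits P ++ primed P

theorem patternPairs_append (E F : List (List Bool)) :
    patternPairs (E ++ F) = patternPairs E ++ patternPairs F := by simp [patternPairs]

theorem patternPairs_cons (P : List Bool) (F : List (List Bool)) :
    patternPairs (P :: F) = bits P ++ (primed P ++ patternPairs F) := by simp [patternPairs]

section Occurrences

variable {m : ℕ} {P : List Bool}

/-- A maximal run of primed symbols can only be matched with a whole primed pattern. -/
theorem primed_infix_step {Q : List Bool} {y R : List ℕ} (hP : 0 < P.length)
    (hPQ : P.length = Q.length) (hy : ∃ c y', y = c :: y' ∧ c ≤ 1)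
        (hR : ∀ c R', R = c :: R' → c ≤ 1)
    (h : primed P ++ y <:+: bits Q ++ (primed Q ++ R)) :
    P = Q ∧ y <+: R ∨ primed P ++ y <:+: R := by
  obtain ⟨c, y', rfl, hc⟩ := hy
  have h1 : primed P ++ c :: y' <:+: primed Q ++ R := by
    cases hp : primed P with
    | nil => rw [← List.length_eq_zero_iff, length_primed] at hp; omega
    | cons x u =>
      rw [hp] at h
      refine infix_of_infix_append_of_head_notMem (fun hx => ?_) h
      have h2 := le_one_of_mem_bits hx
      have h3 := of_mem_primed (P := P) (x := x) (by rw [hp]; simp)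
      omega
  rcases List.infix_append_iff_ne_nil.1 h1 with h2 | h2 | ⟨w₁, w₂, -, hw2, heq, h3, h4⟩
  · exfalso
    have := of_mem_primed (h2.subset (show c ∈ primed P ++ c :: y' by simp))
    omega
  · exact Or.inr h2
  · have key : w₁ = primed P ∧ w₂ = c :: y' := by
      rcases List.append_eq_append_iff.1 heq with ⟨as, ha, hb⟩ | ⟨bs, ha, hb⟩
      · have hl := h3.length_le
        rw [ha, List.length_append, length_primed, length_primed, ← hPQ] at hl
        have : as = [] := by rw [← List.length_eq_zero_iff]; omega
        subst this
        simp only [List.append_nil, List.nil_append] at ha hb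
        exact ⟨ha, hb.symm⟩
      · cases bs with
        | nil =>
          simp only [List.append_nil, List.nil_append] at ha hb
          exact ⟨ha.symm, hb⟩
        | cons x bs =>
          exfalso
          rw [hb] at h4
          obtain ⟨R', hR'⟩ := h4
          have h5 := hR x _ (by rw [← hR']; rfl)
          have h6 := of_mem_primed (P := P) (x := x) (by rw [ha]; simp)
          omega
    obtain ⟨rfl, rfl⟩ := key
    left
    refine ⟨primed_injective (h3.eq_of_length ?_), h4⟩
    rw [length_primed, length_primed, hPQ]

theorem head_patternPairs_append {E : List (List Bool)} (hE : ∀ Q ∈ E, 0 < Q.length) {z : List ℕ}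
    (hz : ∀ c z', z = c :: z' → c ≤ 1) : ∀ c R', patternPairs E ++ z = c :: R' → c ≤ 1 := by
  cases E with
  | nil => simpa [patternPairs] using hz
  | cons Q E =>
    intro c R' h
    cases Q with
    | nil => exact absurd (hE [] (by simp)) (by simp)
    | cons a Q =>
      rw [patternPairs_cons] at h
      simp only [bits, List.map_cons, List.cons_append, List.cons.injEq] at h
      rw [← h.1]
      cases a <;> simp

/-- The primed copy of the last pattern, followed by `y`, occurs in the pairs at the end only. -/
theorem primed_infix_patternPairs (hm : 0 < m) (hP : P.length = m) {y z : List ℕ}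
    (hy : ∃ c y', y = c :: y' ∧ c ≤ 1) (hz : ∀ c z', z = c :: z' → c ≤ 1)
    (hz1 : z.length ≤ 1) : ∀ {E : List (List Bool)}, (∀ Q ∈ E, Q.length = m) → P ∉ E →
      primed P ++ y <:+: patternPairs (E ++ [P]) ++ z → y <+: z := by
  intro E
  induction E with
  | nil =>
    intro _ _ h
    rw [List.nil_append, patternPairs_cons, List.append_assoc, List.append_assoc] at h
    rcases primed_infix_step (by omega) rfl hy (by simpa [patternPairs] using hz) h with h | h
    · simpa [patternPairs] using h.2
    · exfalso
      obtain ⟨c, y', rfl, hc⟩ := hy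
      simp only [patternPairs, List.flatMap_nil, List.nil_append] at h
      have hl := h.length_le
      simp only [List.length_append, length_primed, List.length_cons] at hl
      omega
  | cons Q E ih =>
    intro hE hPE h
    simp only [List.mem_cons, not_or] at hPE
    rw [List.cons_append, patternPairs_cons, List.append_assoc, List.append_assoc] at h
    rcases primed_infix_step (by omega) (by rw [hP, hE Q (by simp)]) hy
      (head_patternPairs_append (by
        intro R hR
        rcases List.mem_append.1 hR with hR | hR
        · rw [hE R (by simp [hR])]; exact hm
        · rw [List.mem_singleton.1 hR, hP]; exact hm) hz) h with h | h
    · exact absurd h.1 hPE.1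
    · exact ih (fun R hR => hE R (by simp [hR])) hPE.2 h

/-- A word that consists of all but the first symbol of a pattern and of the first symbol of its
primed copy determines the pattern. -/
theorem tail_infix_step {a b : Bool} {P Q : List Bool} {R : List ℕ} (hP : 0 < P.length)
    (hPQ : P.length = Q.length)
    (h : bits P ++ primed [a] <:+: bits (b :: Q) ++ (primed (b :: Q) ++ R)) :
    a = b ∧ P = Q ∨ bits P ++ primed [a] <:+: R := by
  have hx := of_mem_primed (P := [a]) (x := if a then 3 else 2) (by simp [primed])
  rcases List.infix_append_iff_ne_nil.1 h with h | h | ⟨w₁, w₂, -, hw2, heq, h3, h4⟩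
  · exfalso
    have := le_one_of_mem_bits (h.subset
      (show (if a then 3 else 2) ∈ bits P ++ primed [a] by simp [primed]))
    omega
  · right
    cases hp : bits P with
    | nil => rw [← List.length_eq_zero_iff, length_bits] at hp; omega
    | cons x u =>
      rw [hp] at h
      refine infix_of_infix_append_of_head_notMem (fun hx => ?_) h
      have h2 := of_mem_primed hx
      have h3 := le_one_of_mem_bits (P := P) (x := x) (by rw [hp]; simp)
      omega
  · left
    cases w₂ with
    | nil => exact absurd rfl hw2
    | cons x w₂ =>
      simp only [primed, List.map_cons, List.cons_append] at h4
      have hxb := (List.cons_prefix_cons.1 h4).1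
      have hx2 := of_mem_primed (P := [b]) (x := x) (by simp [primed, hxb])
      have key : w₁ = bits P ∧ (if a then 3 else 2) = x := by
        rcases List.append_eq_append_iff.1 heq with ⟨as, ha, hb⟩ | ⟨bs, ha, hb⟩
        · cases as with
          | nil =>
            simp only [List.append_nil] at ha
            simp only [primed, List.map_cons, List.map_nil, List.nil_append, List.cons.injEq] at hb
            exact ⟨ha, hb.1⟩
          | cons y as =>
            exfalso
            have hl := congrArg List.length hb
            simp [primed] at hl
        · cases bs with
          | nil =>
            simp only [List.append_nil] at ha
            simp only [primed, List.map_cons, List.map_nil, List.nil_append, List.cons.injEq] at hb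
            exact ⟨ha.symm, hb.1.symm⟩
          | cons y bs =>
            exfalso
            simp only [List.cons_append, List.cons.injEq] at hb
            have := le_one_of_mem_bits (P := P) (x := y) (by rw [ha]; simp)
            omega
      obtain ⟨rfl, hax⟩ := key
      refine ⟨?_, ?_⟩
      · have := hax.trans hxb
        revert this; cases a <;> cases b <;> simp
      · obtain ⟨s, hs⟩ := h3
        have hl := congrArg List.length hs
        rw [List.length_append, length_bits, length_bits, List.length_cons] at hl
        have hs' : s ++ bits P = [b.toNat] ++ bits Q := by rw [hs]; simp [bits]
        exact bits_injective (List.append_inj_right hs' (by simp; omega))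

end Occurrences

section Parsing

variable {m : ℕ} {T : List Bool} {D : List (List Bool)}

theorem le_three_of_mem {P Q R : List Bool} {x : ℕ} (h : x ∈ bits P ++ primed Q ++ bits R) :
    x ≤ 3 := by
  simp only [List.mem_append] at h
  rcases h with (h | h) | h
  · have := le_one_of_mem_bits h; omega
  · exact (of_mem_primed h).2
  · have := le_one_of_mem_bits h; omega

/-- A word that contains a primed symbol and is longer than the pieces of the gadgets with primed
symbols does not occur in the gadgets. -/
theorem not_infix_gadgets_of_primed (hD : ∀ P ∈ D, P.length = m) (hm : 0 < m) {P Q R : List Bool}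
    (hQ : 0 < Q.length) (hl : m + 1 < P.length + Q.length + R.length) :
    ¬ bits P ++ primed Q ++ bits R <:+: gadgets m D := by
  intro h
  have hlen : (bits P ++ primed Q ++ bits R).length = P.length + Q.length + R.length := by
    simp [bits, primed, add_assoc]
  obtain ⟨x, hx⟩ := List.exists_mem_of_length_pos (l := primed Q) (by rwa [length_primed])
  have hx' : x ∈ bits P ++ primed Q ++ bits R := by simp [hx]
  have hx2 := of_mem_primed hx
  have hno : ∀ {U : List Bool}, ¬ bits P ++ primed Q ++ bits R <:+: bits U := by
    intro U hU
    have := le_one_of_mem_bits (hU.subset hx')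
    omega
  obtain ⟨P', hP', h | h | h | ⟨d, hd, h⟩⟩ := infix_gadgets
    (fun h4 => by have := le_three_of_mem h4; omega) (List.ne_nil_of_mem hx') h
  · exact hno h
  · exact hno h
  · have hl' := h.length_le
    rw [hlen, List.length_append, length_bits, length_primed, List.length_drop, hD P' hP'] at hl'
    omega
  · have hl' := h.length_le
    rw [hlen, List.length_append, length_bits, length_primed, hD P' hP'] at hl'
    omega

theorem not_infix_bits_of_primed {P Q R U : List Bool} (hQ : 0 < Q.length) :
    ¬ bits P ++ primed Q ++ bits R <:+: bits U := by
  intro h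
  obtain ⟨x, hx⟩ := List.exists_mem_of_length_pos (l := primed Q) (by rwa [length_primed])
  have := le_one_of_mem_bits (h.subset (show x ∈ bits P ++ primed Q ++ bits R by simp [hx]))
  have := of_mem_primed hx
  omega

/-- The gadgets contain no whole pattern: their pieces without primed symbols are too short. -/
theorem not_infix_gadgets_bits (hD : ∀ P ∈ D, P.length = m) {P : List Bool} (hm : 2 ≤ m)
    (hP : P.length = m) : ¬ bits P <:+: gadgets m D := by
  intro h
  have hP0 : bits P ≠ [] := bits_ne_nil (by omega)
  have hdis : ∀ Q : List Bool, ∀ s ∈ primed Q, s ∉ bits P := by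
    intro Q s hs hs'
    have := of_mem_primed hs
    have := le_one_of_mem_bits hs'
    omega
  have hpr : ∀ Q ∈ D, primed Q ≠ [] := fun Q hQ =>
    List.ne_nil_of_length_pos (by rw [length_primed, hD Q hQ]; omega)
  have hshort : ∀ U : List Bool, U.length < m → ¬ bits P <:+: bits U := by
    intro U hU hPU
    have := hPU.length_le
    rw [length_bits, length_bits] at this
    omega
  obtain ⟨Q, hQ, h | h | h | ⟨d, hd, h⟩⟩ := infix_gadgets
    (fun h4 => by have := le_one_of_mem_bits h4; omega) hP0 h
  · exact hshort _ (by rw [List.length_drop, hD Q hQ]; omega) h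
  · exact hshort _ (by rw [List.length_take, hD Q hQ]; omega) h
  · rw [← List.append_nil (primed Q)] at h
    rcases infix_or_infix_of_disjoint hP0 (hpr Q hQ) (hdis Q) h with h | h
    · exact hshort _ (by rw [List.length_drop, hD Q hQ]; omega) h
    · exact hP0 (List.infix_nil.1 h)
  · rcases infix_or_infix_of_disjoint (A := []) hP0 (hpr Q hQ) (hdis Q) h with h | h
    · exact hP0 (List.infix_nil.1 h)
    · exact hshort d (by omega) h

/-- A pattern occurs neither in the pairs of other patterns nor in a shorter word after them. -/
theorem not_infix_patternPairs_bits (hm : 0 < m) {P U : List Bool} (hP : P.length = m)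
    (hU : U.length < m) : ∀ {E : List (List Bool)}, (∀ Q ∈ E, Q.length = m) → P ∉ E →
      ¬ bits P <:+: patternPairs E ++ bits U := by
  have hP0 : bits P ≠ [] := bits_ne_nil (by omega)
  intro E
  induction E with
  | nil =>
    intro _ _ h
    have := h.length_le
    simp only [patternPairs, List.flatMap_nil, List.nil_append, length_bits] at this
    omega
  | cons Q E ih =>
    intro hE hPE h
    have hQ := hE Q (by simp)
    simp only [List.mem_cons, not_or] at hPE
    rw [patternPairs_cons, List.append_assoc, List.append_assoc] at h
    rcases infix_or_infix_of_disjoint hP0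
      (List.ne_nil_of_length_pos (by rw [length_primed, hQ]; omega)) (by
        intro s hs hs'
        have := of_mem_primed hs
        have := le_one_of_mem_bits hs'
        omega) h with h | h
    · exact hPE.1 (bits_injective (h.eq_of_length (by rw [length_bits, length_bits, hP, hQ])))
    · exact ih (fun R hR => hE R (by simp [hR])) hPE.2 h

/-- In the gadgets, all but the first symbol of a pattern is never followed by a primed symbol,
because only a single symbol of a pattern stands before its primed copy. -/
theorem not_infix_gadgets_tail (hD : ∀ P ∈ D, P.length = m) {a : Bool} {P : List Bool}
    (hm : 3 ≤ m) (hP : P.length + 1 = m) : ¬ bits P ++ primed [a] <:+: gadgets m D := by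
  intro h
  obtain ⟨b, c, P, rfl⟩ : ∃ b c P', P = b :: c :: P' := by
    match P, hP with
    | [], hP => simp at hP; omega
    | [_], hP => simp at hP; omega
    | b :: c :: P', _ => exact ⟨b, c, P', rfl⟩
  have hno : ∀ {U : List Bool}, ¬ bits (b :: c :: P) ++ primed [a] <:+: bits U := by
    intro U hU
    exact not_infix_bits_of_primed (P := b :: c :: P) (Q := [a]) (R := []) (U := U) (by simp)
      (by simpa [bits] using hU)
  have hnot : ∀ (x : Bool) (Q : List Bool), x.toNat ∉ primed Q := by
    intro x Q hx
    have := of_mem_primed hx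
    cases x <;> simp at this
  obtain ⟨Q, hQ, h | h | h | ⟨d, hd, h⟩⟩ := infix_gadgets (fun h4 => by
    have := le_three_of_mem (P := b :: c :: P) (Q := [a]) (R := []) (x := 4)
      (by rw [show bits [] = [] from rfl, List.append_nil]; exact h4)
    omega) (by simp [bits]) h
  · exact hno h
  · exact hno h
  · have hl : (Q.drop (m - 1)).length = 1 := by rw [List.length_drop, hD Q hQ]; omega
    obtain ⟨y, hy⟩ := List.length_eq_one_iff.1 hl
    rw [hy] at h
    simp only [bits, List.map_cons, List.map_nil, List.cons_append, List.nil_append] at h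
    rcases List.infix_cons_iff.1 h with h | h
    · obtain ⟨t, ht⟩ := (List.cons_prefix_cons.1 h).2
      exact hnot c Q (by rw [← ht]; simp)
    · exact hnot c Q (h.subset (by simp))
  · simp only [bits, List.map_cons, List.cons_append] at h
    have h1 := infix_of_infix_append_of_head_notMem (hnot b Q) h
    have := h1.length_le
    simp [primed] at this
    omega

/-- All but the first symbol of a pattern, followed by the first symbol of its primed copy, does
not occur in the pairs of other patterns. -/
theorem not_infix_patternPairs_tail {a : Bool} {P : List Bool} (hP : P.length + 1 = m)
    (hm : 2 ≤ m) : ∀ {E : List (List Bool)}, (∀ Q ∈ E, Q.length = m) → (a :: P) ∉ E →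
      ¬ bits P ++ primed [a] <:+: patternPairs E ++ bits (a :: P) := by
  intro E
  induction E with
  | nil =>
    intro _ _ h
    exact not_infix_bits_of_primed (P := P) (Q := [a]) (R := []) (U := a :: P) (by simp)
      (by simpa [bits, patternPairs] using h)
  | cons Q E ih =>
    intro hE hPE h
    simp only [List.mem_cons, not_or] at hPE
    have hQ := hE Q (by simp)
    cases Q with
    | nil => simp at hQ; omega
    | cons b Q =>
      rw [patternPairs_cons, List.append_assoc, List.append_assoc] at h
      simp only [List.length_cons] at hQ
      rcases tail_infix_step (by omega) (by omega) h with ⟨rfl, rfl⟩ | h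
      · exact hPE.1 rfl
      · exact ih (fun R hR => hE R (by simp [hR])) hPE.2 h

/-- The part of the encoding before the pattern that follows the patterns `E`. -/
def encBefore (T : List Bool) (m : ℕ) (D E : List (List Bool)) : List ℕ :=
  encS1 T ++ encS2 m D ++ patternPairs E

/-- What follows the first symbol of the pairs of the patterns `F` and of the final symbol. -/
def encRest : List (List Bool) → List ℕ
  | [] => []
  | P :: F => bits (P.drop 1) ++ primed P ++ patternPairs F ++ [0]

theorem nextFirst_nil (hm : 0 < m) : nextFirst m [] = [0] := by
  cases m with
  | zero => omega
  | succ m => simp [nextFirst, bits, List.replicate_succ]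

theorem nextFirst_append_encRest (hm : 0 < m) (F : List (List Bool)) :
    patternPairs F ++ [0] = nextFirst m F ++ encRest F := by
  cases F with
  | nil => rw [nextFirst_nil hm]; simp [patternPairs, encRest]
  | cons P F =>
    have : bits P = bits (P.take 1) ++ bits (P.drop 1) := by
      rw [← bits_append, List.take_append_drop]
    simp only [patternPairs_cons, nextFirst, encRest, List.headD_cons, List.append_assoc]
    rw [this, List.append_assoc]

theorem length_nextFirst (hm : 0 < m) {F : List (List Bool)} (hF : ∀ P ∈ F, P.length = m) :
    (nextFirst m F).length = 1 := by
  cases F with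
  | nil => rw [nextFirst_nil hm]; rfl
  | cons P F =>
    have := hF P (by simp)
    simp [nextFirst, bits]; omega

theorem infix_encBefore {w Z : List ℕ} {E : List (List Bool)} (h : w <:+: gadgets m D) :
    w <:+: encBefore T m D E ++ Z := by
  refine List.infix_append_of_infix_left (List.infix_append_of_infix_left
    (List.infix_append_of_infix_right ?_))
  exact List.infix_append_of_infix_left h

section Step

variable {E F : List (List Bool)} {P : List Bool}

theorem enc_eq (hm : 0 < m) (hE : D = E ++ P :: F) : encBefore T m D D ++ [0] =
    encBefore T m D E ++ bits P ++ primed P ++ nextFirst m F ++ encRest F := by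
  rw [List.append_assoc _ (nextFirst m F), ← nextFirst_append_encRest hm]
  unfold encBefore
  conv_lhs => rw [hE]
  rw [patternPairs_append, patternPairs_cons]
  simp only [List.append_assoc]
  rw [← hE]

theorem notMem_of_nodup (hnd : D.Nodup) (hE : D = E ++ P :: F) : P ∉ E := by
  rw [hE, List.nodup_append] at hnd
  exact fun h => hnd.2.2 P h P (by simp) rfl

/-- The phrase that ends with the last symbol of a pattern cannot be extended by the first symbol of
the primed copy. -/
theorem not_infix_encBefore_tail (hm : 3 ≤ m) (hD : ∀ P ∈ D, P.length = m)
    (hEm : ∀ Q ∈ E, Q.length = m) {a : Bool} (hP : P.length + 1 = m) (hPE : a :: P ∉ E) :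
    ¬ bits P ++ primed [a] <:+: encBefore T m D E ++ bits (a :: P) := by
  intro h
  rw [encBefore, List.append_assoc] at h
  have e : bits P ++ primed [a] ++ bits [] = bits P ++ primed [a] := List.append_nil _
  rcases infix_encS (fun x hx => le_three_of_mem (e ▸ hx)) h with h | h | h
  · exact not_infix_bits_of_primed (by simp) (e.symm ▸ h)
  · exact not_infix_gadgets_tail hD hm hP h
  · exact not_infix_patternPairs_tail hP (by omega) hEm hPE h

/-- The phrase that consists of a primed pattern and the first symbol of the next pattern. -/
theorem lzPhrasesFrom_primed (v : LZVariant) (hm : 3 ≤ m) (hnd : D.Nodup)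
    (hD : ∀ P ∈ D, P.length = m) (hE : D = E ++ P :: F) :
    lzPhrasesFrom v (encBefore T m D D ++ [0]) (encBefore T m D E ++ bits P).length =
      lzPhrasesFrom v (encBefore T m D D ++ [0]) ((encBefore T m D (E ++ [P])).length + 1) + 1 := by
  have hPm : P.length = m := hD P (by simp [hE])
  have hEm : ∀ Q ∈ E, Q.length = m := fun Q hQ => hD Q (by simp [hE, hQ])
  have hFm : ∀ Q ∈ F, Q.length = m := fun Q hQ => hD Q (by simp [hE, hQ])
  have hPE := notMem_of_nodup hnd hE
  have hg := gadgets_infix m P F E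
  rw [← hE] at hg
  obtain ⟨u, hu1, hu⟩ := exists_nextFirst m F
  have hul : u.length = 1 := by
    have := length_nextFirst (m := m) (by omega) hFm
    rwa [hu, length_bits] at this
  obtain ⟨d, rfl⟩ := List.length_eq_one_iff.1 hul
  rw [lzPhrasesFrom_of_infix v (S := encBefore T m D D ++ [0])
    (A := encBefore T m D E ++ bits P) (X := primed P ++ nextFirst m F)
    (B := encRest F) (by rw [enc_eq (by omega) hE]; simp only [List.append_assoc])
    (by rw [hu]; simp [bits]) (infix_encBefore hg.2.2.2) ?_]
  · congr 2
    simp only [encBefore, patternPairs_append, patternPairs_cons, List.length_append, hu]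
    simp [patternPairs, bits]; omega
  intro c B' hB h
  obtain ⟨c', rfl⟩ : ∃ c' : Bool, c = c'.toNat := by
    cases F with
    | nil => simp [encRest] at hB
    | cons Q F =>
      have hQ := hFm Q (by simp)
      match Q, hQ with
      | [], hQ => simp at hQ; omega
      | [_], hQ => simp at hQ; omega
      | x :: y :: Q, _ =>
        simp only [encRest, List.drop_one, List.tail_cons, bits, List.map_cons,
          List.cons_append, List.cons.injEq] at hB
        exact ⟨y, hB.1.symm⟩
  have hw : primed P ++ nextFirst m F ++ [c'.toNat] = bits [] ++ primed P ++ bits [d, c'] := by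
    rw [hu]; simp [bits]
  have hZ : encBefore T m D E ++ bits P ++ (primed P ++ nextFirst m F) =
      encS1 T ++ encS2 m D ++ (patternPairs (E ++ [P]) ++ nextFirst m F) := by
    rw [encBefore, patternPairs_append, patternPairs_cons]
    simp [patternPairs]
  rw [hZ, hw] at h
  rcases infix_encS (fun x hx => le_three_of_mem hx) h with h | h | h
  · exact not_infix_bits_of_primed (by omega) h
  · exact not_infix_gadgets_of_primed hD (by omega) (by omega) (by rw [hPm]; simp) h
  · have hd1 : ∀ b : Bool, b.toNat ≤ 1 := by intro b; cases b <;> simp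
    have h3 := primed_infix_patternPairs (m := m) (by omega) hPm
      (y := bits [d, c']) (z := nextFirst m F) ⟨d.toNat, [c'.toNat], rfl, hd1 d⟩ (by
        rw [hu]; intro c z' hz
        simp only [bits, List.map_cons, List.map_nil, List.cons.injEq] at hz
        rw [← hz.1]; exact hd1 d) (by rw [hu]; simp [bits]) hEm hPE h
    have h4 := h3.length_le
    rw [hu] at h4
    simp [bits] at h4

end Step

/-- Once a whole pattern has been a phrase, the parsing stays one symbol ahead of the pairs, and
every remaining pattern accounts for two phrases. -/
theorem lzPhrasesFrom_found (v : LZVariant) (hm : 3 ≤ m) (hnd : D.Nodup)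
    (hD : ∀ P ∈ D, P.length = m) : ∀ (F E : List (List Bool)), D = E ++ F →
      lzPhrasesFrom v (encBefore T m D D ++ [0]) ((encBefore T m D E).length + 1) =
        2 * F.length := by
  intro F
  induction F with
  | nil =>
    intro E hE
    rw [List.append_nil] at hE
    rw [← hE, lzPhrasesFrom_of_length_le (by simp)]
    simp
  | cons P F ih =>
    intro E hE
    have hPm : P.length = m := hD P (by simp [hE])
    have hEm : ∀ Q ∈ E, Q.length = m := fun Q hQ => hD Q (by simp [hE, hQ])
    have hPE := notMem_of_nodup hnd hE
    have hg := gadgets_infix m P F E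
    rw [← hE] at hg
    obtain ⟨a, P', rfl⟩ : ∃ a P', P = a :: P' := by
      cases P with
      | nil => simp at hPm; omega
      | cons a P' => exact ⟨a, P', rfl⟩
    simp only [List.length_cons] at hPm
    have h1 := lzPhrasesFrom_of_infix v (S := encBefore T m D D ++ [0])
      (A := encBefore T m D E ++ [a.toNat]) (X := bits P')
      (B := primed (a :: P') ++ nextFirst m F ++ encRest F)
      (by rw [enc_eq (by omega) hE]; simp [bits])
      (bits_ne_nil (by omega)) (infix_encBefore hg.1) (by
        intro c B' hB h
        have hc : primed [a] = [c] := by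
          simp only [primed, List.map_cons, List.cons_append, List.cons.injEq] at hB
          simp [primed, hB.1]
        rw [← hc, List.append_assoc, show [a.toNat] ++ bits P' = bits (a :: P') by simp [bits]] at h
        exact not_infix_encBefore_tail hm hD hEm hPm hPE h)
    have e1 : (encBefore T m D E ++ [a.toNat]).length = (encBefore T m D E).length + 1 := by simp
    have e2 : (encBefore T m D E ++ [a.toNat] ++ bits P').length
        = (encBefore T m D E ++ bits (a :: P')).length := by simp [bits]
    rw [← e1, h1, e2, lzPhrasesFrom_primed v hm hnd hD hE, ih (E ++ [a :: P']) (by rw [hE]; simp)]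
    simp; ring

open Classical in
/-- As long as no pattern has been found in the text, every pattern accounts for two phrases, the
second of which ends with its primed copy. -/
theorem lzPhrasesFrom_search (v : LZVariant) (hm : 3 ≤ m) (hnd : D.Nodup)
    (hD : ∀ P ∈ D, P.length = m) : ∀ (F E : List (List Bool)), D = E ++ F →
      lzPhrasesFrom v (encBefore T m D D ++ [0]) (encBefore T m D E).length =
        if ∃ P ∈ F, P <:+: T then 2 * F.length else 2 * F.length + 1 := by
  intro F
  induction F with
  | nil =>
    intro E hE
    rw [List.append_nil] at hE
    rw [← hE, lzPhrasesFrom_last v rfl]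
    simp
  | cons P F ih =>
    intro E hE
    have hPm : P.length = m := hD P (by simp [hE])
    have hEm : ∀ Q ∈ E, Q.length = m := fun Q hQ => hD Q (by simp [hE, hQ])
    have hFm : ∀ Q ∈ F, Q.length = m := fun Q hQ => hD Q (by simp [hE, hQ])
    have hPE := notMem_of_nodup hnd hE
    have hg := gadgets_infix m P F E
    rw [← hE] at hg
    have hE' : D = (E ++ [P]) ++ F := by rw [hE]; simp
    by_cases hPT : P <:+: T
    · rw [if_pos ⟨P, by simp, hPT⟩, lzPhrasesFrom_of_infix v (X := bits P)
        (B := primed P ++ nextFirst m F ++ encRest F)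
        (by rw [enc_eq (by omega) hE]; simp only [List.append_assoc])
            (bits_ne_nil (by omega)) ?_ ?_,
        lzPhrasesFrom_primed v hm hnd hD hE, lzPhrasesFrom_found v hm hnd hD F _ hE']
      · simp; ring
      · simp only [encBefore, encS1, List.append_assoc]
        exact List.infix_append_of_infix_left (bits_infix_bits.2 hPT)
      · intro c B' hB h
        obtain ⟨a, P', rfl⟩ : ∃ a P', P = a :: P' := by
          cases P with
          | nil => simp at hPm; omega
          | cons a P' => exact ⟨a, P', rfl⟩
        have hc : primed [a] = [c] := by
          simp only [primed, List.map_cons, List.cons_append, List.cons.injEq] at hB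
          simp [primed, hB.1]
        rw [← hc] at h
        refine not_infix_encBefore_tail hm hD hEm (by simpa using hPm) hPE (List.IsInfix.trans ?_ h)
        exact ⟨[a.toNat], [], by simp [bits]⟩
    · have hPsplit : bits P = bits (P.take (m - 1)) ++ bits (P.drop (m - 1)) := by
        rw [← bits_append, List.take_append_drop]
      obtain ⟨y, hy⟩ : ∃ y, P.drop (m - 1) = [y] :=
        List.length_eq_one_iff.1 (by rw [List.length_drop]; omega)
      have h1 := lzPhrasesFrom_of_infix v (S := encBefore T m D D ++ [0])
        (A := encBefore T m D E) (X := bits (P.take (m - 1)))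
        (B := bits (P.drop (m - 1)) ++ primed P ++ nextFirst m F ++ encRest F)
        (by rw [enc_eq (by omega) hE, hPsplit]; simp only [List.append_assoc])
        (bits_ne_nil (by rw [List.length_take]; omega))
        (by have := infix_encBefore (T := T) (E := E) (Z := []) hg.2.1;
            rwa [List.append_nil] at this)
        (by
          intro c B' hB h
          have hc : bits P = bits (P.take (m - 1)) ++ [c] := by
            rw [hPsplit, hy]
            rw [hy] at hB
            simp only [bits, List.map_cons, List.cons_append, List.cons.injEq] at hB
            simp [bits, hB.1]
          rw [← hc, encBefore, List.append_assoc] at h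
          rcases infix_encS (fun x hx => by have := le_one_of_mem_bits hx; omega) h with h | h | h
          · exact hPT (bits_infix_bits.1 h)
          · exact not_infix_gadgets_bits hD (by omega) hPm h
          · exact not_infix_patternPairs_bits (by omega) hPm (by rw [List.length_take]; omega)
              hEm hPE h)
      have h2 := lzPhrasesFrom_of_infix v (S := encBefore T m D D ++ [0])
        (A := encBefore T m D E ++ bits (P.take (m - 1))) (X := bits (P.drop (m - 1)) ++ primed P)
        (B := nextFirst m F ++ encRest F)
        (by rw [enc_eq (by omega) hE, hPsplit]; simp only [List.append_assoc])
        (by simp [hy, bits]) (infix_encBefore hg.2.2.1)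
        (by
          intro c B' hB h
          have hc1 : c ≤ 1 := by
            rw [← nextFirst_append_encRest (by omega)] at hB
            exact head_patternPairs_append (fun Q hQ => by rw [hFm Q hQ]; omega)
              (by intro c z' hz; simp only [List.cons.injEq] at hz; omega) _ _ hB
          obtain ⟨c', rfl⟩ : ∃ c' : Bool, c = c'.toNat := by
            interval_cases c
            · exact ⟨false, rfl⟩
            · exact ⟨true, rfl⟩
          have hw : bits (P.drop (m - 1)) ++ primed P ++ [c'.toNat] =
              bits (P.drop (m - 1)) ++ primed P ++ bits [c'] := rfl
          have hZ : encBefore T m D E ++ bits (P.take (m - 1)) ++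
              (bits (P.drop (m - 1)) ++ primed P) =
              encS1 T ++ encS2 m D ++ patternPairs (E ++ [P]) := by
            rw [encBefore, patternPairs_append, patternPairs_cons, hPsplit]
            simp [patternPairs]
          rw [hZ, hw] at h
          rcases infix_encS (fun x hx => le_three_of_mem hx) h with h | h | h
          · exact not_infix_bits_of_primed (by omega) h
          · exact not_infix_gadgets_of_primed hD (by omega) (by omega)
              (by rw [hPm, hy]; simp) h
          · have h3 := primed_infix_patternPairs (m := m) (by omega) hPm
              (y := bits [c']) (z := []) ⟨c'.toNat, [], rfl, hc1⟩ (by simp) (by simp) hEm hPE (by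
                rw [List.append_nil]
                refine List.IsInfix.trans ?_ h
                rw [List.append_assoc]
                exact List.infix_append_right)
            have h4 := h3.length_le
            simp [bits] at h4)
      have e1 : (encBefore T m D E ++ bits (P.take (m - 1)) ++
          (bits (P.drop (m - 1)) ++ primed P)).length = (encBefore T m D (E ++ [P])).length := by
        simp only [encBefore, patternPairs_append, patternPairs_cons, hPsplit]
        simp [patternPairs]
      rw [h1, h2, e1, ih _ hE']
      have hiff : (∃ Q ∈ P :: F, Q <:+: T) ↔ ∃ Q ∈ F, Q <:+: T := by simp [hPT]
      simp only [hiff, List.length_cons]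
      split_ifs <;> ring

end Parsing

open Classical in
/-- The pairs of patterns and primed patterns add an even number of phrases if and only if some
pattern occurs in the text. -/
theorem lzSize_enc (v : LZVariant) (T : List Bool) {m : ℕ} {D : List (List Bool)} (hm : 3 ≤ m)
    (hnd : D.Nodup) (hD : ∀ P ∈ D, P.length = m) :
    lzSize v (encS1 T ++ encS2 m D ++ encS3 m D) = lzSize v (encS1 T ++ encS2 m D) +
      if ∃ P ∈ D, P <:+: T then 2 * D.length else 2 * D.length + 1 := by
  have h6 : 6 ∉ encS1 T ++ gadgets m D := by
    intro h
    rw [encS1] at h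
    simp only [List.mem_append, List.mem_singleton] at h
    rcases h with (h | h) | h
    · have := le_one_of_mem_bits h; omega
    · omega
    · have h6 : [6] <:+: gadgets m D := by
        obtain ⟨s, t, hst⟩ := List.append_of_mem h
        exact ⟨s, t, by rw [hst]; simp⟩
      obtain ⟨P, -, h | h | h | ⟨d, -, h⟩⟩ := infix_gadgets (by simp) (by simp) h6
      all_goals have h6 := h.subset (show 6 ∈ [6] by simp)
      · have := le_one_of_mem_bits h6; omega
      · have := le_one_of_mem_bits h6; omega
      · rcases List.mem_append.1 h6 with h6 | h6
        · have := le_one_of_mem_bits h6; omega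
        · have := of_mem_primed h6; omega
      · rcases List.mem_append.1 h6 with h6 | h6
        · have := of_mem_primed h6; omega
        · have := le_one_of_mem_bits h6; omega
  have h := lzSize_append_of_notMem v (B := encS3 m D) h6
  have e1 : encS1 T ++ gadgets m D ++ [6] = encS1 T ++ encS2 m D := by simp [encS2]
  have e2 : encS1 T ++ encS2 m D ++ encS3 m D = encBefore T m D D ++ [0] := by
    rw [encS3, nextFirst_nil (by omega), encBefore, patternPairs, List.append_assoc _ _ [0]]
  have e3 : encBefore T m D [] = encS1 T ++ encS2 m D := by simp [encBefore, patternPairs]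
  rw [e1] at h
  rw [h, e2, ← e3, lzPhrasesFrom_search v hm hnd hD D [] rfl]

/-! ### Every program for the parity reads a constant fraction of its input -/

theorem lzSize_append_singleton_of_notMem {α : Type} [DecidableEq α] (v : LZVariant) {A : List α}
    {c : α} (hc : c ∉ A) : lzSize v (A ++ [c]) = lzSize v A + 1 := by
  obtain ⟨q, h1, h2, h3, h4⟩ := exists_lzPhrasesFrom_append v A [c] _ 0 rfl (by omega)
  rcases h1.eq_or_lt with h | h
  · subst h
    rw [lzPhrasesFrom_last v rfl] at h3
    exact h3
  · exfalso
    obtain ⟨i, hi, hp⟩ := h4 h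
    rw [hasPrevOcc_iff] at hp
    obtain ⟨j, hj, -, hs⟩ := hp
    have h5 := hs (A.length - i) (by omega)
    rw [show i + (A.length - i) = A.length by omega, List.getElem?_append_left (by omega),
      List.getElem?_append_right le_rfl] at h5
    simp only [Nat.sub_self, List.getElem?_cons_zero] at h5
    exact hc (List.mem_of_getElem? h5)

/-- The phrases after the initial zeros are `1`, `1` and the remaining zeros. -/
theorem lzSize_zeros_ones_zeros (v : LZVariant) {a b : ℕ} (hb : 0 < b) (hba : b ≤ a) :
    lzSize v (List.replicate a false ++ [true, true] ++ List.replicate b false) =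
      lzSize v (List.replicate a false) + 3 := by
  have hc : true ∉ List.replicate a false := by simp
  have h := lzSize_append_of_notMem v (B := true :: List.replicate b false) hc
  rw [lzSize_append_singleton_of_notMem v hc] at h
  have e : List.replicate a false ++ [true, true] ++ List.replicate b false =
      List.replicate a false ++ [true] ++ true :: List.replicate b false := by simp
  rw [e, h, lzPhrasesFrom_of_infix v (X := [true]) (B := List.replicate b false) (by simp) (by simp)
    List.infix_append_right ?_, lzPhrasesFrom_of_infix v (X := List.replicate b false) (B := [])
    (by simp) (by simp; omega) ?_ (by simp), lzPhrasesFrom_of_length_le (by simp)]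
  · refine List.infix_append_of_infix_left (List.infix_append_of_infix_left ?_)
    exact ⟨[], List.replicate (a - b) false, by simp; omega⟩
  · intro c B' hB h
    have hcf : c = false := by
      have : c ∈ List.replicate b false := by rw [hB]; simp
      exact (List.mem_replicate.1 this).2
    subst hcf
    rw [List.append_assoc] at h
    have := infix_of_infix_append_of_head_notMem hc h
    revert this
    decide

theorem lpf_zeros_overlapping {n i : ℕ} (hi : 0 < i) (hin : i ≤ n) :
    lpf .overlapping (List.replicate n false) i = n - i := by
  apply le_antisymm
  · simpa using lpf_le .overlapping (List.replicate n false) i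
  · refine HasPrevOcc.le_lpf ?_ (by simp; omega)
    rw [hasPrevOcc_iff]
    refine ⟨0, hi, hi, fun t ht => ?_⟩
    rw [List.getElem?_replicate_of_lt (by omega), List.getElem?_replicate_of_lt (by omega)]

theorem lpf_zeros_nonOverlapping {n i : ℕ} (hi : 0 < i) (hin : i ≤ n) :
    lpf .nonOverlapping (List.replicate n false) i = min i (n - i) := by
  apply le_antisymm
  · refine le_min ?_ (by simpa using lpf_le .nonOverlapping (List.replicate n false) i)
    rcases Nat.eq_zero_or_pos (lpf .nonOverlapping (List.replicate n false) i) with h | h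
    · omega
    · obtain ⟨j, -, h1, -⟩ := hasPrevOcc_lpf h
      have := h1.2
      omega
  · refine HasPrevOcc.le_lpf ?_ (by simp; omega)
    rw [hasPrevOcc_iff]
    refine ⟨0, hi, ⟨hi, by omega⟩, fun t ht => ?_⟩
    rw [List.getElem?_replicate_of_lt (by omega), List.getElem?_replicate_of_lt (by omega)]

theorem lzPhrasesFrom_zeros_overlapping {n i : ℕ} (hi : 0 < i) (hin : i < n) :
    lzPhrasesFrom .overlapping (List.replicate n false) i = 1 := by
  rw [lzPhrasesFrom_of_lt (by simpa using hin), lpf_zeros_overlapping hi hin.le,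
    lzPhrasesFrom_of_length_le (by simp; omega)]

theorem lzPhrasesFrom_zeros_nonOverlapping {n i : ℕ} (hi : 0 < i) (hin : i < n) :
    lzPhrasesFrom .nonOverlapping (List.replicate n false) i =
      lzPhrasesFrom .nonOverlapping (List.replicate n false) (min (i * 2) n) + 1 := by
  rw [lzPhrasesFrom_of_lt (by simpa using hin), lpf_zeros_nonOverlapping hi hin.le]
  congr 2
  omega

/-- The parsings of two strings of zeros whose lengths lie between the same powers of two differ
in the length of the last phrase only. -/
theorem lzSize_zeros_eq (v : LZVariant) {e a : ℕ} (h1 : 2 ^ e < a) (h2 : a ≤ 2 ^ (e + 1)) :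
    lzSize v (List.replicate a false) = lzSize v (List.replicate (2 ^ (e + 1)) false) := by
  have hpow : 0 < 2 ^ e := by positivity
  have h0 : ∀ n, 0 < n → lzSize v (List.replicate n false) =
      lzPhrasesFrom v (List.replicate n false) 1 + 1 := by
    intro n hn
    have : lpf v (List.replicate n false) 0 = 0 := by
      by_contra h
      obtain ⟨j, hj, -⟩ := hasPrevOcc_lpf (Nat.pos_of_ne_zero h)
      omega
    rw [lzSize, lzPhrasesFrom_of_lt (by simpa using hn), this]
    rfl
  rw [pow_succ] at h2 ⊢
  rw [h0 _ (by omega), h0 _ (by omega)]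
  congr 1
  cases v with
  | overlapping =>
    rw [lzPhrasesFrom_zeros_overlapping (by omega) (by omega),
      lzPhrasesFrom_zeros_overlapping (by omega) (by omega)]
  | nonOverlapping =>
    suffices H : ∀ d r, r + d = e → lzPhrasesFrom .nonOverlapping (List.replicate a false) (2 ^ r) =
        lzPhrasesFrom .nonOverlapping (List.replicate (2 ^ e * 2) false) (2 ^ r) from
      H e 0 (by omega)
    intro d
    induction d with
    | zero =>
      intro r hr
      obtain rfl : r = e := by omega
      rw [lzPhrasesFrom_zeros_nonOverlapping (n := a) (by omega) (by omega),
        lzPhrasesFrom_zeros_nonOverlapping (n := 2 ^ r * 2) (by omega) (by omega),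
        lzPhrasesFrom_of_length_le (S := List.replicate a false) (by simp; omega),
        lzPhrasesFrom_of_length_le (S := List.replicate (2 ^ r * 2) false) (by simp)]
    | succ d ih =>
      intro r hr
      have hr' : 2 ^ (r + 1) ≤ 2 ^ e := Nat.pow_le_pow_right (by norm_num) (by omega)
      have h3 := ih (r + 1) (by omega)
      have hr0 : 0 < 2 ^ r := by positivity
      rw [pow_succ] at hr' h3
      rw [lzPhrasesFrom_zeros_nonOverlapping (n := a) (by omega) (by omega),
        lzPhrasesFrom_zeros_nonOverlapping (n := 2 ^ e * 2) (by omega) (by omega),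
        min_eq_left (by omega), min_eq_left (by omega), h3]

namespace WordRAM

theorem step_of_halted {p : Program} {s : Config} (h : Halted p s) : step p s = s := by
  unfold step
  rw [List.getElem?_eq_none h]

theorem run_succ (p : Program) (s : Config) (t : ℕ) : run p s (t + 1) = step p (run p s t) :=
  Function.iterate_succ_apply' _ _ _

theorem run_add (p : Program) (s : Config) (t t' : ℕ) :
    run p s (t + t') = run p (run p s t) t' := by
  unfold run
  rw [add_comm, Function.iterate_add_apply]

theorem run_of_halted {p : Program} {s : Config} (h : Halted p s) (t : ℕ) : run p s t = s := by
  induction t with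
  | zero => rfl
  | succ t ih => rw [run_succ, ih, step_of_halted h]

theorem run_eq_of_halted {p : Program} {s : Config} {t t' : ℕ} (h : Halted p (run p s t))
    (h' : Halted p (run p s t')) : run p s t = run p s t' := by
  rcases le_total t t' with hle | hle
  · obtain ⟨d, rfl⟩ := Nat.exists_eq_add_of_le hle
    rw [run_add, run_of_halted h]
  · obtain ⟨d, rfl⟩ := Nat.exists_eq_add_of_le hle
    rw [run_add, run_of_halted h']

theorem Accesses.unique {p : Program} {s : Config} {a b : ℕ} (ha : Accesses p s a)
    (hb : Accesses p s b) : a = b := by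
  rcases ha with ⟨r, x, h, rfl⟩ | ⟨r, x, h, rfl⟩ <;>
    rcases hb with ⟨r', x', h', rfl⟩ | ⟨r', x', h', rfl⟩ <;>
    · rw [h] at h'
      simp_all

/-- The configurations agree, except possibly on the contents of the cell `a`. -/
def AgreeOff (a : ℕ) (s s' : Config) : Prop :=
  s.pc = s'.pc ∧ s.reg = s'.reg ∧ ∀ x ≠ a, s.mem x = s'.mem x

theorem AgreeOff.step {p : Program} {a : ℕ} {s s' : Config} (h : AgreeOff a s s')
    (ha : ¬ Accesses p s a) : AgreeOff a (step p s) (step p s') := by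
  obtain ⟨h1, h2, h3⟩ := h
  unfold WordRAM.step
  rw [← h1]
  cases hI : p[s.pc]? with
  | none => exact ⟨h1, h2, h3⟩
  | some I =>
    cases I with
    | const r c => exact ⟨by simp [Instr.exec, h1], by simp [Instr.exec, h2], h3⟩
    | op o r x y => exact ⟨by simp [Instr.exec, h1], by simp [Instr.exec, h2], h3⟩
    | load r x =>
      refine ⟨by simp [Instr.exec, h1], ?_, h3⟩
      have : s.reg x ≠ a := fun hx => ha (Or.inl ⟨r, x, hI, hx⟩)
      simp only [Instr.exec]
      rw [← h2, h3 _ this]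
    | store x r =>
      refine ⟨by simp [Instr.exec, h1], h2, ?_⟩
      intro y hy
      simp only [Instr.exec]
      rw [← h2]
      by_cases hyx : y = s.reg x
      · rw [hyx]; simp
      · rw [Function.update_of_ne hyx, Function.update_of_ne hyx, h3 y hy]
    | jumpLt x y l => exact ⟨by simp [Instr.exec, h1, h2], h2, h3⟩
    | jumpEq x y l => exact ⟨by simp [Instr.exec, h1, h2], h2, h3⟩

theorem AgreeOff.run {p : Program} {a : ℕ} {s s' : Config} (h : AgreeOff a s s') (t : ℕ)
    (ha : ∀ i < t, ¬ Accesses p (run p s i) a) : AgreeOff a (run p s t) (run p s' t) := by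
  induction t with
  | zero => exact h
  | succ t ih =>
    rw [run_succ, run_succ]
    exact (ih fun i hi => ha i (by omega)).step (ha t (by omega))

/-- A cell is accessed if its contents have an influence on the output. -/
theorem Computes.exists_accesses {p : Program} {x x' : List ℕ} {out out' t s w t' s' w' : ℕ}
    (h : Computes p x out t s w) (h' : Computes p x' out' t' s' w') {a : ℕ}
    (hx : ∀ i ≠ a, x[i]? = x'[i]?) (hout : out ≠ out') :
    ∃ i < t, Accesses p (run p (initial x) i) a := by
  by_contra hc
  simp only [not_exists, not_and] at hc
  have h0 : AgreeOff a (initial x) (initial x') :=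
    ⟨rfl, rfl, fun i hi => by simp [initial, List.getD_eq_getElem?_getD, hx i hi]⟩
  obtain ⟨h1, h2, -⟩ := h0.run (p := p) t hc
  have h3 : Halted p (run p (initial x') t) := by
    unfold Halted
    rw [← h1]; exact h.halts
  apply hout
  rw [← h.output, ← h'.output, h2, run_eq_of_halted h3 h'.halts]

theorem Computes.card_le {p : Program} {x : List ℕ} {out t s w : ℕ} (h : Computes p x out t s w)
    (J : Finset ℕ) (hJ : ∀ a ∈ J, ∃ i < t, Accesses p (run p (initial x) i) a) :
    J.card ≤ t ∧ J.card ≤ s := by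
  choose! f hf1 hf2 using hJ
  constructor
  · have := Finset.card_le_card_of_injOn (t := Finset.range t) f
      (fun a ha => Finset.mem_coe.2 (Finset.mem_range.2 (hf1 a ha))) (fun a ha b hb hab =>
        (hf2 a ha).unique (hab ▸ hf2 b hb))
    simpa using this
  · have : J ⊆ Finset.range s := fun a ha =>
      Finset.mem_range.2 (h.space _ (hf1 a ha) a (hf2 a ha))
    simpa using Finset.card_le_card this

end WordRAM

theorem lzInput_getElem?_eq {x x' : List Bool} {j : ℕ} (hl : x.length = x'.length)
    (h : ∀ q, q / bitLen x.length ≠ j → x[q]? = x'[q]?) :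
    ∀ i ≠ j + 1, (lzInput x)[i]? = (lzInput x')[i]? := by
  intro i hi
  unfold lzInput pack
  rw [← hl]
  cases i with
  | zero => simp
  | succ i =>
    rw [List.getElem?_cons_succ, List.getElem?_cons_succ, List.getElem?_map, List.getElem?_map]
    by_cases hi' : i < (x.length + bitLen x.length - 1) / bitLen x.length
    · rw [List.getElem?_range hi', Option.map_some, Option.map_some]
      congr 3
      apply List.ext_getElem?
      intro t
      by_cases ht : t < bitLen x.length
      · simp only [List.getElem?_take, ht, if_true, List.getElem?_drop]
        apply h
        rw [mul_comm, Nat.mul_add_div (by omega), Nat.div_eq_of_lt ht]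
        omega
      · simp [ht]
    · rw [List.getElem?_eq_none (by simpa using hi')]
      rfl

theorem bitLen_le_self {u : ℕ} (hu : 1 ≤ u) : bitLen u ≤ u :=
  Nat.log_lt_self 2 (by omega)

/-- The number of cells that hold a string of length `u` is, up to a constant factor, a lower
bound for time and space: a string of zeros and the string with two adjacent ones in one of the
cells of its second half have numbers of phrases of different parities. -/
theorem SolvesLZParity.lower_bound {v : LZVariant} {p : WordRAM.Program} {time space : ℕ → ℝ}
    (H : SolvesLZParity v p time space) :
    ∃ K : ℕ, ∀ u ≥ 1, ((u / bitLen u + 1 : ℕ) : ℝ) ≤ K * time u ∧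
      ((u / bitLen u + 1 : ℕ) : ℝ) ≤ K * space u := by
  -- The strings have a power of two `N` of symbols, where `N ≤ 1024 * u` is so large that the
  -- second half of them fills more than `u / bitLen u + 1` words, each with `B = bitLen u + 10`
  -- symbols.
  obtain ⟨K, hK⟩ := H 1024
  refine ⟨K, fun u hu => ?_⟩
  obtain ⟨e, he⟩ : ∃ e, e = Nat.log 2 u + 9 := ⟨_, rfl⟩
  have hlog := Nat.pow_log_le_self 2 (show u ≠ 0 by omega)
  have hlog' := Nat.lt_pow_succ_log_self (b := 2) (by norm_num) u
  have hNu : 2 ^ (e + 1) = 1024 * 2 ^ Nat.log 2 u := by rw [he]; ring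
  have hNe : 2 ^ (e + 1) = 2 * 2 ^ e := by ring
  rw [Nat.succ_eq_add_one, pow_succ] at hlog'
  obtain ⟨N, hN⟩ : ∃ N, N = 2 ^ (e + 1) := ⟨_, rfl⟩
  obtain ⟨B, hB⟩ : ∃ B, B = bitLen N := ⟨_, rfl⟩
  have hBe : B = bitLen u + 10 := by
    rw [hB, hN, bitLen, Nat.log_pow (by norm_num), bitLen]; omega
  have hbl : 1 ≤ bitLen u := by unfold bitLen; omega
  have hlen0 : (List.replicate N false).length = N := by simp
  have hY : (u / bitLen u + 1) * (4 * B) ≤ N := by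
    have h1 : 1 ≤ u / bitLen u := (Nat.one_le_div_iff (by omega)).2 (bitLen_le_self hu)
    have h2 : bitLen u * (u / bitLen u) ≤ u := Nat.mul_div_le _ _
    have h3 : bitLen u ≤ bitLen u * (u / bitLen u) := Nat.le_mul_of_pos_right _ h1
    have h4 : u / bitLen u ≤ bitLen u * (u / bitLen u) := Nat.le_mul_of_pos_left _ hbl
    have h5 : (u / bitLen u + 1) * (4 * B) =
        4 * (bitLen u * (u / bitLen u)) + 40 * (u / bitLen u) + 4 * bitLen u + 40 := by
      rw [hBe]; ring
    rw [h5]; omega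
  obtain ⟨t, s, w, hc, ht, hs, -⟩ := hK u hu (List.replicate N false) (by rw [hlen0]; omega)
  -- All these words are read: two ones at the beginning of such a word change the parity.
  have hcells : ∀ i < u / bitLen u + 1, ∃ τ < t, WordRAM.Accesses p
      (WordRAM.run p (WordRAM.initial (lzInput (List.replicate N false))) τ)
          (N / 2 / B + 1 + i + 1) := by
    intro i hi
    obtain ⟨j, hj⟩ : ∃ j, j = N / 2 / B + 1 + i := ⟨_, rfl⟩
    have h1 : N / 2 < j * B := by
      have h2 := Nat.lt_div_mul_add (a := N / 2) (b := B) (by omega)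
      have h3 : j * B = N / 2 / B * B + B + i * B := by rw [hj]; ring
      omega
    have h2 : j * B + 2 < N := by
      have h2 := Nat.div_mul_le_self (N / 2) B
      have h3 : j * B = N / 2 / B * B + (i + 1) * B := by rw [hj]; ring
      have h4 : (i + 1) * B ≤ (u / bitLen u + 1) * B := Nat.mul_le_mul_right B (by omega)
      have h5 : (u / bitLen u + 1) * (4 * B) = 4 * ((u / bitLen u + 1) * B) := by ring
      omega
    obtain ⟨b, hb⟩ : ∃ b, N = j * B + 2 + b := ⟨N - (j * B + 2), by omega⟩
    have hlen :
        (List.replicate (j * B) false ++ [true, true] ++ List.replicate b false).length = N := by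
      simp; omega
    obtain ⟨t', s', w', hc', -, -, -⟩ := hK u hu
      (List.replicate (j * B) false ++ [true, true] ++ List.replicate b false) (by rw [hlen]; omega)
    rw [← hj]
    refine hc.exists_accesses hc' (lzInput_getElem?_eq (by rw [hlen0, hlen]) ?_) ?_
    · intro q hq
      rw [hlen0, ← hB] at hq
      by_cases hq1 : q < j * B
      · rw [List.append_assoc, List.getElem?_append_left (by simpa using hq1),
          List.getElem?_replicate_of_lt (by omega), List.getElem?_replicate_of_lt hq1]
      · have hq2 : j * B + 2 ≤ q := by
          by_contra h
          apply hq
          rw [show q = B * j + (q - j * B) by rw [mul_comm]; omega, Nat.mul_add_div (by omega),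
            Nat.div_eq_of_lt (by omega)]
          omega
        rw [List.getElem?_append_right (by simpa using hq2)]
        simp only [List.getElem?_replicate, List.length_append, List.length_replicate,
          List.length_cons, List.length_nil]
        exact if_congr (by omega) rfl rfl
    · rw [lzSize_zeros_ones_zeros v (by omega) (by omega), lzSize_zeros_eq v (e := e)
          (a := j * B) (by omega)
        (by omega), ← hN]
      omega
  have hcard := hc.card_le ((Finset.range (u / bitLen u + 1)).image fun i => N / 2 / B + 1 + i + 1)
    (by
      intro a ha
      obtain ⟨i, hi, rfl⟩ := Finset.mem_image.1 ha
      exact hcells i (Finset.mem_range.1 hi))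
  rw [Finset.card_image_of_injective _ (fun a b hab => by simpa using hab),
    Finset.card_range] at hcard
  exact ⟨(Nat.cast_le.2 hcard.1).trans ht, (Nat.cast_le.2 hcard.2).trans hs⟩

/-! ### Structured programs for the word RAM -/

namespace WordRAM

/-- The registers and the memory of a configuration. -/
structure Store where
  reg : ℕ → ℕ
  mem : ℕ → ℕ

/-- The configuration with the given registers and memory that is about to execute instruction
`pc`. -/
def Store.at (s : Store) (pc : ℕ) : Config := ⟨pc, s.reg, s.mem⟩

/-- All values in the store fit in words of `w` bits. -/
def Store.Fits (w : ℕ) (s : Store) : Prop := (∀ r, s.reg r < 2 ^ w) ∧ ∀ a, s.mem a < 2 ^ w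

/-- The run of `q` from `c` arrives at `c'` after `t` steps; all values on the way fit in words of
`w` bits, and only cells below `S` are accessed. -/
structure Reaches (q : Program) (w S : ℕ) (c c' : Config) (t : ℕ) : Prop where
  run_eq : run q c t = c'
  space : ∀ i < t, ∀ a, Accesses q (run q c i) a → a < S
  words : ∀ i ≤ t, FitsIn w (run q c i)

section Reaches

variable {q : Program} {w S : ℕ} {c c' c'' : Config}

theorem Reaches.refl (h : FitsIn w c) : Reaches q w S c c 0 :=
  ⟨rfl, by simp, by intro i hi; obtain rfl : i = 0 := by omega
                    exact h⟩

theorem Reaches.trans {t t' : ℕ} (h : Reaches q w S c c' t) (h' : Reaches q w S c' c'' t') :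
    Reaches q w S c c'' (t + t') := by
  refine ⟨by rw [run_add, h.run_eq, h'.run_eq], ?_, ?_⟩
  · intro i hi
    by_cases hit : i < t
    · exact h.space i hit
    · obtain ⟨d, rfl⟩ := Nat.exists_eq_add_of_le (not_lt.1 hit)
      rw [run_add, h.run_eq]
      exact h'.space d (by omega)
  · intro i hi
    by_cases hit : i < t
    · exact h.words i hit.le
    · obtain ⟨d, rfl⟩ := Nat.exists_eq_add_of_le (not_lt.1 hit)
      rw [run_add, h.run_eq]
      exact h'.words d (by omega)

theorem Reaches.fitsIn {t : ℕ} (h : Reaches q w S c c' t) : FitsIn w c' := by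
  rw [← h.run_eq]; exact h.words t le_rfl

theorem Reaches.of_step {I : Instr} (hI : q[c.pc]? = some I) (hc : FitsIn w c)
    (hc' : FitsIn w (I.exec c)) (hl : ∀ r x, I = .load r x → c.reg x < S)
    (hs : ∀ x r, I = .store x r → c.reg x < S) : Reaches q w S c (I.exec c) 1 := by
  have hrun : run q c 1 = I.exec c := by
    rw [run_succ]
    simp only [run, Function.iterate_zero, id_eq, step, hI]
  refine ⟨hrun, ?_, ?_⟩
  · intro i hi a ha
    obtain rfl : i = 0 := by omega
    rcases ha with ⟨r, x, h, rfl⟩ | ⟨r, x, h, rfl⟩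
    · exact hl r x (by simpa [run, hI] using h)
    · exact hs r x (by simpa [run, hI] using h)
  · intro i hi
    rcases Nat.le_one_iff_eq_zero_or_eq_one.1 hi with rfl | rfl
    · exact hc
    · rw [hrun]; exact hc'

end Reaches

/-- The effect of an instruction on the store. -/
def Instr.apply (I : Instr) (s : Store) : Store := ⟨(I.exec (s.at 0)).reg, (I.exec (s.at 0)).mem⟩

/-- The instruction is not a jump; it produces a value of `w` bits, and accesses only cells
below `S`. -/
def Instr.Ok (w S : ℕ) (s : Store) : Instr → Prop
  | .const _ c => c < 2 ^ w
  | .op o _ a b => o.eval (s.reg a) (s.reg b) < 2 ^ w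
  | .load _ a => s.reg a < S
  | .store a _ => s.reg a < S
  | .jumpLt _ _ _ => False
  | .jumpEq _ _ _ => False

/-- The effect of a list of instructions without jumps. -/
def applyAll : List Instr → Store → Store
  | [], s => s
  | I :: l, s => applyAll l (I.apply s)

/-- Every instruction of the list is allowed at the moment of its execution. -/
def OkAll (w S : ℕ) : List Instr → Store → Prop
  | [], _ => True
  | I :: l, s => I.Ok w S s ∧ OkAll w S l (I.apply s)

/-- Structured programs. -/
inductive Stmt where
  /-- a list of instructions without jumps -/
  | block (l : List Instr)
  | seq (a b : Stmt)
  /-- repeat the body as long as the first register is less than the second one -/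
  | whileLt (x y : ℕ) (body : Stmt)

infixr:60 " ;; " => Stmt.seq

/-- The number of instructions of the translation of a structured program. -/
def Stmt.size : Stmt → ℕ
  | .block l => l.length
  | .seq a b => a.size + b.size
  | .whileLt _ _ body => body.size + 3

/-- The translation of a structured program to code that starts with instruction number `o`. -/
def Stmt.compile : ℕ → Stmt → List Instr
  | _, .block l => l
  | o, .seq a b => a.compile o ++ b.compile (o + a.size)
  | o, .whileLt x y body =>
    [.jumpLt x y (o + 2), .jumpEq x x (o + (body.size + 3))] ++ body.compile (o + 2) ++
        [.jumpEq x x o]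

theorem Stmt.length_compile (st : Stmt) (o : ℕ) : (st.compile o).length = st.size := by
  induction st generalizing o with
  | block l => rfl
  | seq a b iha ihb => simp [compile, size, iha, ihb]
  | whileLt x y body ih => simp [compile, size, ih]

/-- The big-step semantics: from the first store, the structured program leads to the second store
in the given number of steps. -/
inductive Exec (w S : ℕ) : Stmt → Store → Store → ℕ → Prop
  | block {l : List Instr} {s : Store} (h : OkAll w S l s) :
      Exec w S (.block l) s (applyAll l s) l.length
  | seq {a b : Stmt} {s s' s'' : Store} {t t' : ℕ} (h : Exec w S a s s' t)
      (h' : Exec w S b s' s'' t') :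
      Exec w S (.seq a b) s s'' (t + t')
  | while_false {x y : ℕ} {body : Stmt} {s : Store} (h : ¬ s.reg x < s.reg y) :
      Exec w S (.whileLt x y body) s s 2
  | while_true {x y : ℕ} {body : Stmt} {s s' s'' : Store} {t t' : ℕ} (h : s.reg x < s.reg y)
      (h' : Exec w S body s s' t) (h'' : Exec w S (.whileLt x y body) s' s'' t') :
      Exec w S (.whileLt x y body) s s'' (t + t' + 2)

/-- The program `q` contains the given code from instruction number `o` on. -/
def CodeAt (q : Program) (o : ℕ) (code : List Instr) : Prop :=
  ∀ i I, code[i]? = some I → q[o + i]? = some I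

theorem CodeAt.left {q : Program} {o : ℕ} {a b : List Instr} (h : CodeAt q o (a ++ b)) :
    CodeAt q o a := fun i I hi => h i I (by
  rw [List.getElem?_append_left (List.getElem?_eq_some_iff.1 hi).1]; exact hi)

theorem CodeAt.right {q : Program} {o : ℕ} {a b : List Instr} (h : CodeAt q o (a ++ b)) :
    CodeAt q (o + a.length) b := fun i I hi => by
  rw [add_assoc]
  refine h _ I ?_
  rw [List.getElem?_append_right (by omega), Nat.add_sub_cancel_left]; exact hi

theorem CodeAt.head {q : Program} {o : ℕ} {I : Instr} {l : List Instr} (h : CodeAt q o (I :: l)) :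
    q[o]? = some I := h 0 I rfl

theorem CodeAt.tail {q : Program} {o : ℕ} {I : Instr} {l : List Instr} (h : CodeAt q o (I :: l)) :
    CodeAt q (o + 1) l := CodeAt.right (a := [I]) h

theorem Instr.Ok.exec_eq {w S : ℕ} {s : Store} {I : Instr} (h : I.Ok w S s) (pc : ℕ) :
    I.exec (s.at pc) = (I.apply s).at (pc + 1) := by
  cases I <;> first | rfl | exact absurd h id

theorem Instr.Ok.fits {w S : ℕ} {s : Store} {I : Instr} (h : I.Ok w S s) (hs : s.Fits w) :
    (I.apply s).Fits w := by
  have upd : ∀ (f : ℕ → ℕ) (a v : ℕ), (∀ x, f x < 2 ^ w) → v < 2 ^ w →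
      ∀ x, Function.update f a v x < 2 ^ w := by
    intro f a v hf hv x
    by_cases hx : x = a
    · rw [hx, Function.update_self]; exact hv
    · rw [Function.update_of_ne hx]; exact hf x
  cases I with
  | const r c => exact ⟨upd _ _ _ hs.1 h, hs.2⟩
  | op o r a b => exact ⟨upd _ _ _ hs.1 h, hs.2⟩
  | load r a => exact ⟨upd _ _ _ hs.1 (hs.2 _), hs.2⟩
  | store a r => exact ⟨hs.1, upd _ _ _ hs.2 (hs.1 _)⟩
  | jumpLt a b l => exact absurd h id
  | jumpEq a b l => exact absurd h id

theorem Instr.Ok.reaches {q : Program} {w S pc : ℕ} {s : Store} {I : Instr} (h : I.Ok w S s)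
    (hs : s.Fits w) (hI : q[pc]? = some I) : Reaches q w S (s.at pc)
        ((I.apply s).at (pc + 1)) 1 := by
  rw [← h.exec_eq]
  refine Reaches.of_step hI hs ?_ ?_ ?_
  · rw [h.exec_eq]; exact h.fits hs
  · rintro r x rfl; exact h
  · rintro x r rfl; exact h

theorem reaches_applyAll {q : Program} {w S : ℕ} {l : List Instr} : ∀ {pc : ℕ} {s : Store},
    OkAll w S l s → s.Fits w → CodeAt q pc l →
      Reaches q w S (s.at pc) ((applyAll l s).at (pc + l.length)) l.length := by
  induction l with
  | nil => intro pc s _ hs _; exact Reaches.refl hs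
  | cons I l ih =>
    intro pc s hok hs hc
    have h1 := hok.1.reaches hs hc.head
    have h2 := ih hok.2 (hok.1.fits hs) hc.tail
    have h3 := h1.trans h2
    rw [List.length_cons, add_comm l.length 1, ← add_assoc]
    exact h3

theorem reaches_jumpLt {q : Program} {w S pc x y l : ℕ} {s : Store} (hs : s.Fits w)
    (hI : q[pc]? = some (.jumpLt x y l)) :
    Reaches q w S (s.at pc) (s.at (if s.reg x < s.reg y then l else pc + 1)) 1 :=
  Reaches.of_step (c := s.at pc) hI hs hs (by simp) (by simp)

theorem reaches_jumpEq {q : Program} {w S pc x y l : ℕ} {s : Store} (hs : s.Fits w)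
    (hI : q[pc]? = some (.jumpEq x y l)) :
    Reaches q w S (s.at pc) (s.at (if s.reg x = s.reg y then l else pc + 1)) 1 :=
  Reaches.of_step (c := s.at pc) hI hs hs (by simp) (by simp)

/-- The translation of structured programs is correct. -/
theorem Exec.reaches {q : Program} {w S : ℕ} {st : Stmt} {s s' : Store} {t : ℕ}
    (h : Exec w S st s s' t) : ∀ {o : ℕ}, s.Fits w → CodeAt q o (st.compile o) →
      Reaches q w S (s.at o) (s'.at (o + st.size)) t := by
  induction h with
  | block h => intro o hs hc; exact reaches_applyAll h hs hc
  | @seq a b s s' s'' t t' h h' ih ih' =>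
    intro o hs hc
    have h1 := ih hs hc.left
    have hc2 := hc.right
    rw [Stmt.length_compile] at hc2
    have h2 := ih' h1.fitsIn hc2
    rw [Stmt.size, ← add_assoc]
    exact h1.trans h2
  | @while_false x y body s h =>
    intro o hs hc
    have hc1 := hc.left.left
    have h1 := reaches_jumpLt (S := S) hs hc1.head
    rw [if_neg h] at h1
    have h2 := reaches_jumpEq (S := S) hs hc1.tail.head
    rw [if_pos rfl] at h2
    exact h1.trans h2
  | @while_true x y body s s' s'' t t' h h' h'' ih ih' =>
    intro o hs hc
    have h1 := reaches_jumpLt (S := S) hs hc.left.left.head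
    rw [if_pos h] at h1
    have h2 := ih hs hc.left.right
    have hc3 := hc.right
    rw [List.length_append, Stmt.length_compile, ← add_assoc] at hc3
    have h3 := reaches_jumpEq (S := S) h2.fitsIn hc3.head
    rw [if_pos rfl] at h3
    have h4 := ih' h3.fitsIn hc
    have h5 := h1.trans (h2.trans (h3.trans h4))
    rwa [show 1 + (t + (1 + t')) = t + t' + 2 by omega] at h5

/-- From the store `s`, the structured program terminates within `t` steps in a store that
satisfies `Q`. -/
def WP (w S : ℕ) (st : Stmt) (t : ℕ) (Q : Store → Prop) (s : Store) : Prop :=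
  ∃ s' t', Exec w S st s s' t' ∧ t' ≤ t ∧ Q s'

section WP

variable {w S : ℕ} {Q Q' : Store → Prop} {s : Store} {t t' : ℕ} {a b : Stmt}

theorem WP.mono (h : WP w S a t Q s) (ht : t ≤ t') (hQ : ∀ s, Q s → Q' s) : WP w S a t' Q' s := by
  obtain ⟨s', t'', h1, h2, h3⟩ := h
  exact ⟨s', t'', h1, h2.trans ht, hQ s' h3⟩

theorem WP.block {l : List Instr} (h : OkAll w S l s) (hQ : Q (applyAll l s)) (ht : l.length ≤ t) :
    WP w S (.block l) t Q s :=
  ⟨_, _, .block h, ht, hQ⟩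

theorem WP.seq (h : WP w S a t Q' s) (h' : ∀ s, Q' s → WP w S b t' Q s) :
    WP w S (a ;; b) (t + t') Q s := by
  obtain ⟨s', t₁, h1, h2, h3⟩ := h
  obtain ⟨s'', t₂, h4, h5, h6⟩ := h' s' h3
  exact ⟨s'', _, .seq h1 h4, by omega, h6⟩

/-- The rule for loops; `I n` is the invariant when at most `n` iterations remain. -/
theorem WP.while {x y : ℕ} (I : ℕ → Store → Prop)
    (hbody : ∀ n s, I n s → s.reg x < s.reg y → ∃ n', n = n' + 1 ∧ WP w S a t (I n') s)
    (hexit : ∀ n s, I n s → ¬ s.reg x < s.reg y → Q s) :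
    ∀ n s, I n s → WP w S (.whileLt x y a) (n * (t + 2) + 2) Q s := by
  intro n
  induction n with
  | zero =>
    intro s hI
    by_cases h : s.reg x < s.reg y
    · obtain ⟨n', hn, -⟩ := hbody 0 s hI h
      omega
    · exact ⟨s, 2, .while_false h, by omega, hexit 0 s hI h⟩
  | succ n ih =>
    intro s hI
    by_cases h : s.reg x < s.reg y
    · obtain ⟨n', hn, s', t₁, h1, h2, h3⟩ := hbody _ s hI h
      obtain rfl : n = n' := by omega
      obtain ⟨s'', t₂, h4, h5, h6⟩ := ih s' h3
      refine ⟨s'', _, .while_true h h1 h4, ?_, h6⟩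
      rw [Nat.succ_mul]; omega
    · exact ⟨s, 2, .while_false h, by omega, hexit _ s hI h⟩

end WP

/-- The instruction changes no registers but those with numbers from `lo` to `hi - 1`. -/
def Instr.writesIn (lo hi : ℕ) : Instr → Bool
  | .const r _ => decide (lo ≤ r) && decide (r < hi)
  | .op _ r _ _ => decide (lo ≤ r) && decide (r < hi)
  | .load r _ => decide (lo ≤ r) && decide (r < hi)
  | _ => true

/-- The structured program changes no registers but those with numbers from `lo` to `hi - 1`. -/
def Stmt.writesIn (lo hi : ℕ) : Stmt → Bool
  | .block l => l.all fun I => I.writesIn lo hi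
  | .seq a b => a.writesIn lo hi && b.writesIn lo hi
  | .whileLt _ _ body => body.writesIn lo hi

theorem applyAll_reg_eq {lo hi : ℕ} {l : List Instr} (h : l.all fun I => I.writesIn lo hi) {r : ℕ}
    (hr : r < lo ∨ hi ≤ r) : ∀ s, (applyAll l s).reg r = s.reg r := by
  induction l with
  | nil => intro s; rfl
  | cons I l ih =>
    intro s
    rw [List.all_cons, Bool.and_eq_true] at h
    rw [applyAll, ih h.2]
    have hI := h.1
    cases I with
    | const r' c =>
      simp only [Instr.writesIn, Bool.and_eq_true, decide_eq_true_eq] at hI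
      exact Function.update_of_ne (by omega) _ _
    | op o r' a b =>
      simp only [Instr.writesIn, Bool.and_eq_true, decide_eq_true_eq] at hI
      exact Function.update_of_ne (by omega) _ _
    | load r' a =>
      simp only [Instr.writesIn, Bool.and_eq_true, decide_eq_true_eq] at hI
      exact Function.update_of_ne (by omega) _ _
    | store a r' => rfl
    | jumpLt a b l => rfl
    | jumpEq a b l => rfl

theorem Exec.reg_eq {w S lo hi : ℕ} {st : Stmt} {s s' : Store} {t : ℕ} (h : Exec w S st s s' t)
    (hst : st.writesIn lo hi) {r : ℕ} (hr : r < lo ∨ hi ≤ r) : s'.reg r = s.reg r := by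
  induction h with
  | block _ => exact applyAll_reg_eq hst hr _
  | seq _ _ ih ih' =>
    rw [Stmt.writesIn, Bool.and_eq_true] at hst
    rw [ih' hst.2, ih hst.1]
  | while_false _ => rfl
  | while_true _ _ _ ih ih' => rw [ih' hst, ih hst]

/-- A structured program changes only the registers that it assigns to. -/
theorem WP.frame {w S lo hi t : ℕ} {st : Stmt} {Q : Store → Prop} {s : Store} (h : WP w S st t Q s)
    (hst : st.writesIn lo hi) :
    WP w S st t (fun s' => Q s' ∧ ∀ r, r < lo ∨ hi ≤ r → s'.reg r = s.reg r) s := by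
  obtain ⟨s', t', h1, h2, h3⟩ := h
  exact ⟨s', t', h1, h2, h3, fun r hr => h1.reg_eq hst hr⟩

/-! ### A program on every other cell -/

/-- The instructions that execute `I` on the registers `R + 2 * r` and on the cells with addresses
`B + 2 * a`, where register `b` contains `B`, and `tmp` is a scratch register. They are the
instructions number `o + 3 * j`, `o + 3 * j + 1`, `o + 3 * j + 2` if `I` is number `j` of a
program with `len` instructions. -/
def Instr.relocate (o len R b tmp : ℕ) : Instr → List Instr
  | .const r c => [.const tmp 0, .const tmp 0, .const (R + 2 * r) c]
  | .op e r x y => [.const tmp 0, .const tmp 0, .op e (R + 2 * r) (R + 2 * x) (R + 2 * y)]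
  | .load r x => [.op .add tmp (R + 2 * x) (R + 2 * x), .op .add tmp tmp b, .load (R + 2 * r) tmp]
  | .store x r => [.op .add tmp (R + 2 * x) (R + 2 * x), .op .add tmp tmp b, .store tmp (R + 2 * r)]
  | .jumpLt x y l =>
    [.const tmp 0, .const tmp 0, .jumpLt (R + 2 * x) (R + 2 * y) (o + 3 * min l len)]
  | .jumpEq x y l =>
    [.const tmp 0, .const tmp 0, .jumpEq (R + 2 * x) (R + 2 * y) (o + 3 * min l len)]

/-- The program `p`, moved to the instructions from number `o` on, and to every other register and
cell. -/
def relocate (p : Program) (o R b tmp : ℕ) : List Instr :=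
  p.flatMap (Instr.relocate o p.length R b tmp)

theorem length_relocate (p : Program) (o R b tmp : ℕ) :
    (relocate p o R b tmp).length = 3 * p.length :=
  flatMap_length_const _ 3 (by intro I; cases I <;> rfl) p

/-- The store contains the registers and the memory of `c`, and agrees with the store `s₀`
elsewhere, except possibly on the register `tmp`. -/
structure Simulates (R b B tmp : ℕ) (s₀ : Store) (c : Config) (s : Store) : Prop where
  reg : ∀ r, s.reg (R + 2 * r) = c.reg r
  mem : ∀ a, s.mem (B + 2 * a) = c.mem a
  base : s.reg b = B
  reg_frame : ∀ r, r ≠ tmp → (∀ r', r ≠ R + 2 * r') → s.reg r = s₀.reg r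
  mem_frame : ∀ a, (∀ a', a ≠ B + 2 * a') → s.mem a = s₀.mem a

theorem Simulates.set_tmp {R b B tmp : ℕ} {s₀ s : Store} {c : Config}
    (h : Simulates R b B tmp s₀ c s) (hb : b ≠ tmp) (ht : tmp < R) (v : ℕ) :
    Simulates R b B tmp s₀ c ⟨Function.update s.reg tmp v, s.mem⟩ := by
  refine ⟨fun r => ?_, h.mem, ?_, fun r hr hr' => ?_, h.mem_frame⟩
  · rw [← h.reg]; exact Function.update_of_ne (by omega) _ _
  · rw [← h.base]; exact Function.update_of_ne hb _ _
  · rw [← h.reg_frame r hr hr']; exact Function.update_of_ne hr _ _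

theorem Simulates.set_reg {R b B tmp : ℕ} {s₀ s : Store} {c : Config}
    (h : Simulates R b B tmp s₀ c s) (hb : b < R) (r v pc : ℕ) :
    Simulates R b B tmp s₀ ⟨pc, Function.update c.reg r v, c.mem⟩
      ⟨Function.update s.reg (R + 2 * r) v, s.mem⟩ := by
  refine ⟨fun r' => ?_, h.mem, ?_, fun r' hr hr' => ?_, h.mem_frame⟩
  · simp only
    by_cases hr : r' = r
    · rw [hr]; simp
    · rw [Function.update_of_ne hr, Function.update_of_ne (by omega)]; exact h.reg r'
  · rw [← h.base]; exact Function.update_of_ne (by omega) _ _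
  · rw [← h.reg_frame r' hr hr']; exact Function.update_of_ne (hr' r) _ _

theorem Simulates.set_mem {R b B tmp : ℕ} {s₀ s : Store} {c : Config}
    (h : Simulates R b B tmp s₀ c s) (a v pc : ℕ) :
    Simulates R b B tmp s₀ ⟨pc, c.reg, Function.update c.mem a v⟩
      ⟨s.reg, Function.update s.mem (B + 2 * a) v⟩ := by
  refine ⟨h.reg, fun a' => ?_, h.base, h.reg_frame, fun a' ha' => ?_⟩
  · simp only
    by_cases ha : a' = a
    · rw [ha]; simp
    · rw [Function.update_of_ne ha, Function.update_of_ne (by omega)]; exact h.mem a'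
  · rw [← h.mem_frame a' ha']; exact Function.update_of_ne (ha' a) _ _

theorem Simulates.pc {R b B tmp : ℕ} {s₀ s : Store} {c : Config} (h : Simulates R b B tmp s₀ c s)
    (pc : ℕ) : Simulates R b B tmp s₀ ⟨pc, c.reg, c.mem⟩ s :=
  ⟨h.reg, h.mem, h.base, h.reg_frame, h.mem_frame⟩

section Relocate

variable {p q : Program} {o R b B tmp w w' S S' : ℕ} {s₀ : Store}

/-- One step of `p` takes three steps of the relocated program. Jumps out of `p`, to whatever
number, lead to the end of the relocated program, as is expressed by the minima. -/
theorem Simulates.step (hq : CodeAt q o (relocate p o R b tmp)) (hbt : b ≠ tmp) (hb : b < R)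
    (ht : tmp < R) (hww : w ≤ w') (hS : B + 2 * S ≤ S') (hSw : S' ≤ 2 ^ w') {c : Config} {s : Store}
    (h : Simulates R b B tmp s₀ c s) (hs : s.Fits w') (hc : c.pc < p.length)
    (hacc : ∀ a, Accesses p c a → a < S) (hfit : FitsIn w (WordRAM.step p c)) :
    ∃ s', Reaches q w' S' (s.at (o + 3 * min c.pc p.length))
      (s'.at (o + 3 * min (WordRAM.step p c).pc p.length)) 3 ∧
        Simulates R b B tmp s₀ (WordRAM.step p c) s' := by
  obtain ⟨I, hI⟩ : ∃ I, p[c.pc]? = some I := ⟨p[c.pc], List.getElem?_eq_getElem hc⟩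
  have hstep : WordRAM.step p c = I.exec c := by unfold WordRAM.step; rw [hI]
  rw [hstep] at hfit ⊢
  have hpow : 2 ^ w ≤ 2 ^ w' := Nat.pow_le_pow_right (by norm_num) hww
  have hcode : CodeAt q (o + 3 * c.pc) (I.relocate o p.length R b tmp) := by
    intro i J hJ
    have hi : i < 3 := by
      have := (List.getElem?_eq_some_iff.1 hJ).1
      cases I <;> exact this
    rw [add_assoc]
    refine hq _ J ?_
    rw [relocate, flatMap_getElem?_const _ 3 (by intro I; cases I <;> rfl) _ _ _ hi, hI]
    exact hJ
  have hmin : min c.pc p.length = c.pc := min_eq_left hc.le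
  have hmin' : min (c.pc + 1) p.length = c.pc + 1 := min_eq_left hc
  rw [hmin]
  have h0 : (0 : ℕ) < 2 ^ w' := by positivity
  -- Two initial assignments to the scratch register that have no effect on the simulation.
  have hnop : ∀ {J : Instr}, CodeAt q (o + 3 * c.pc) [.const tmp 0, .const tmp 0, J] →
      ∃ s₁, Reaches q w' S' (s.at (o + 3 * c.pc)) (s₁.at (o + 3 * c.pc + 2)) 2 ∧
        Simulates R b B tmp s₀ c s₁ ∧ q[o + 3 * c.pc + 2]? = some J := by
    intro J hJ
    refine ⟨_, reaches_applyAll (l := [.const tmp 0, .const tmp 0]) ⟨h0, h0, trivial⟩ hs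
      (CodeAt.left (b := [J]) hJ), (h.set_tmp hbt ht 0).set_tmp hbt ht 0, hJ.tail.tail.head⟩
  -- The two additions that compute the address.
  have haddr : ∀ {J : Instr} {x : ℕ}, c.reg x < S →
      CodeAt q (o + 3 * c.pc) [.op .add tmp (R + 2 * x) (R + 2 * x), .op .add tmp tmp b, J] →
      ∃ s₁, Reaches q w' S' (s.at (o + 3 * c.pc)) (s₁.at (o + 3 * c.pc + 2)) 2 ∧
        Simulates R b B tmp s₀ c s₁ ∧ s₁.reg tmp = B + 2 * c.reg x ∧
          q[o + 3 * c.pc + 2]? = some J := by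
    intro J x hx hJ
    refine ⟨_, reaches_applyAll (l := [.op .add tmp (R + 2 * x) (R + 2 * x), .op .add tmp tmp b])
      ⟨?_, ?_, trivial⟩ hs (CodeAt.left (b := [J]) hJ),
      (h.set_tmp hbt ht _).set_tmp hbt ht _, ?_, hJ.tail.tail.head⟩
    · simp only [Instr.Ok, BinOp.eval, h.reg]; omega
    · simp only [Instr.Ok, BinOp.eval, Instr.apply, Instr.exec, Store.at, Function.update_self,
        Function.update_of_ne hbt, h.reg, h.base]
      omega
    · simp only [applyAll, BinOp.eval, Instr.apply, Instr.exec, Store.at, Function.update_self,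
        Function.update_of_ne hbt, h.reg, h.base]
      omega
  cases I with
  | const r v =>
    obtain ⟨s₁, h1, h2, h3⟩ := hnop hcode
    have hv : v < 2 ^ w := by simpa [Instr.exec] using hfit.1 r
    have h4 := Instr.Ok.reaches (S := S') (show (Instr.const (R + 2 * r) v).Ok w' S' s₁ from
      lt_of_lt_of_le hv hpow) h1.fitsIn h3
    refine ⟨_, ?_, h2.set_reg hb r v _⟩
    have h5 := h1.trans h4
    simp only [Instr.exec, hmin']
    exact h5
  | op e r x y =>
    obtain ⟨s₁, h1, h2, h3⟩ := hnop hcode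
    have hv : e.eval (c.reg x) (c.reg y) < 2 ^ w := by simpa [Instr.exec] using hfit.1 r
    have h4 := Instr.Ok.reaches (S := S')
      (show (Instr.op e (R + 2 * r) (R + 2 * x) (R + 2 * y)).Ok w' S' s₁ by
        simp only [Instr.Ok, h2.reg]; omega) h1.fitsIn h3
    refine ⟨_, ?_, h2.set_reg hb r (e.eval (c.reg x) (c.reg y)) _⟩
    have h5 := h1.trans h4
    simp only [Instr.apply, Instr.exec, Store.at, h2.reg] at h5
    simp only [Instr.exec, hmin']
    exact h5
  | load r x =>
    have hx := hacc _ (Or.inl ⟨r, x, hI, rfl⟩)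
    obtain ⟨s₁, h1, h2, h6, h3⟩ := haddr hx hcode
    have h4 := Instr.Ok.reaches (S := S')
      (show (Instr.load (R + 2 * r) tmp).Ok w' S' s₁ by
        simp only [Instr.Ok, h6]; omega) h1.fitsIn h3
    refine ⟨_, ?_, h2.set_reg hb r (c.mem (c.reg x)) _⟩
    have h5 := h1.trans h4
    simp only [Instr.apply, Instr.exec, Store.at, h6, h2.mem] at h5
    simp only [Instr.exec, hmin']
    exact h5
  | store x r =>
    have hx := hacc _ (Or.inr ⟨x, r, hI, rfl⟩)
    obtain ⟨s₁, h1, h2, h6, h3⟩ := haddr hx hcode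
    have h4 := Instr.Ok.reaches (S := S')
      (show (Instr.store tmp (R + 2 * r)).Ok w' S' s₁ by
        simp only [Instr.Ok, h6]; omega) h1.fitsIn h3
    refine ⟨_, ?_, h2.set_mem (c.reg x) (c.reg r) _⟩
    have h5 := h1.trans h4
    simp only [Instr.apply, Instr.exec, Store.at, h6, h2.reg] at h5
    simp only [Instr.exec, hmin']
    exact h5
  | jumpLt x y l =>
    obtain ⟨s₁, h1, h2, h3⟩ := hnop hcode
    have h4 := reaches_jumpLt (S := S') h1.fitsIn h3
    refine ⟨_, ?_, h2.pc _⟩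
    have h5 := h1.trans h4
    rw [h2.reg, h2.reg] at h5
    simp only [Instr.exec]
    split_ifs at h5 ⊢ with hxy
    · exact h5
    · rw [hmin']; exact h5
  | jumpEq x y l =>
    obtain ⟨s₁, h1, h2, h3⟩ := hnop hcode
    have h4 := reaches_jumpEq (S := S') h1.fitsIn h3
    refine ⟨_, ?_, h2.pc _⟩
    have h5 := h1.trans h4
    rw [h2.reg, h2.reg] at h5
    simp only [Instr.exec]
    split_ifs at h5 ⊢ with hxy
    · exact h5
    · rw [hmin']; exact h5

/-- The relocated program simulates the original one, three steps for one. -/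
theorem Simulates.run (hq : CodeAt q o (relocate p o R b tmp)) (hbt : b ≠ tmp) (hb : b < R)
    (ht : tmp < R) (hww : w ≤ w') (hS : B + 2 * S ≤ S') (hSw : S' ≤ 2 ^ w') :
    ∀ (t : ℕ) {c : Config} {s : Store}, Simulates R b B tmp s₀ c s → s.Fits w' →
      Halted p (run p c t) → (∀ i < t, ∀ a, Accesses p (run p c i) a → a < S) →
      (∀ i ≤ t, FitsIn w (run p c i)) →
      ∃ s' t', Reaches q w' S' (s.at (o + 3 * min c.pc p.length)) (s'.at (o + 3 * p.length)) t' ∧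
        t' ≤ 3 * t ∧ Simulates R b B tmp s₀ (run p c t) s' := by
  intro t
  induction t with
  | zero =>
    intro c s h hs hh _ _
    have hmin : min c.pc p.length = p.length := min_eq_right hh
    rw [hmin]
    exact ⟨s, 0, Reaches.refl hs, by omega, h⟩
  | succ t ih =>
    intro c s h hs hh hacc hfit
    by_cases hc : c.pc < p.length
    · have e : ∀ i, WordRAM.run p c (i + 1) = WordRAM.run p (WordRAM.step p c) i := by
        intro i; rw [add_comm, run_add]; rfl
      obtain ⟨s₁, h1, h2⟩ := h.step hq hbt hb ht hww hS hSw hs hc (hacc 0 (by omega))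
        (hfit 1 (by omega))
      obtain ⟨s₂, t₂, h3, h4, h5⟩ := ih h2 h1.fitsIn (by rw [← e]; exact hh)
        (fun i hi => by rw [← e]; exact hacc _ (by omega))
        (fun i hi => by rw [← e]; exact hfit _ (by omega))
      exact ⟨s₂, _, h1.trans h3, by omega, by rw [e]; exact h5⟩
    · have hc' : Halted p c := not_lt.1 hc
      have hmin : min c.pc p.length = p.length := min_eq_right hc'
      rw [hmin, run_of_halted hc']
      exact ⟨s, 0, Reaches.refl hs, by omega, h⟩

end Relocate

end WordRAM

/-! ### Instances with patterns that start with `0` and end with `1` -/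

/-- The string with `0 1` before every symbol and at the end. Patterns are padded in order to have
at least three symbols, the first of which is `0` and the last of which is `1`, regardless of the
pattern. -/
def padString (T : List Bool) : List Bool := T.flatMap (fun a => [false, true, a]) ++ [false, true]

theorem padString_cons (a : Bool) (T : List Bool) :
    padString (a :: T) = false :: true :: a :: padString T := by simp [padString]

theorem padString_eq (T : List Bool) :
    padString T = false :: (T.flatMap fun a => [true, a, false]) ++ [true] := by
  induction T with
  | nil => rfl
  | cons a T ih => rw [padString_cons, ih]; simp

theorem length_padString (T : List Bool) : (padString T).length = 3 * T.length + 2 := by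
  rw [padString, List.length_append, flatMap_length_const _ 3 (by simp)]
  rfl

theorem padString_injective : Function.Injective padString := by
  intro P Q h
  induction P generalizing Q with
  | nil =>
    cases Q with
    | nil => rfl
    | cons a Q => simpa [length_padString] using congrArg List.length h
  | cons a P ih =>
    cases Q with
    | nil => simpa [length_padString] using congrArg List.length h
    | cons b Q =>
      rw [padString_cons, padString_cons] at h
      simp only [List.cons.injEq, true_and] at h
      rw [h.1, ih h.2]

theorem padString_prefix_iff {P T : List Bool} : padString P <+: padString T ↔ P <+: T := by
  induction P generalizing T with
  | nil =>
    cases T with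
    | nil => simp
    | cons a T => simp [padString]
  | cons a P ih =>
    cases T with
    | nil =>
      refine iff_of_false (fun h => ?_) (by simp)
      have := h.length_le
      simp [length_padString] at this
    | cons b T => simp [padString_cons, List.cons_prefix_cons, ih]

/-- Occurrences in padded strings are aligned, because `0 1` is followed by `0 1` at distance
three. -/
theorem padString_infix_iff {P T : List Bool} (hP : P ≠ []) :
    padString P <:+: padString T ↔ P <:+: T := by
  obtain ⟨a, P, rfl⟩ := List.exists_cons_of_ne_nil hP
  induction T with
  | nil =>
    refine iff_of_false (fun h => ?_) (by simp)
    have := h.length_le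
    simp [length_padString] at this
  | cons b T ih =>
    rw [List.infix_cons_iff, ← ih, ← padString_prefix_iff, padString_cons b, List.infix_cons_iff,
      List.infix_cons_iff, List.infix_cons_iff]
    have h1 : ¬ padString (a :: P) <+: true :: b :: padString T := by
      rw [padString_cons, List.cons_prefix_cons]; simp
    have h2 : ¬ padString (a :: P) <+: b :: padString T := by
      have hT : ∃ u, padString T = false :: u := ⟨_, padString_eq T⟩
      obtain ⟨u, hu⟩ := hT
      rw [padString_cons, List.cons_prefix_cons, hu, List.cons_prefix_cons]; simp
    simp [h1, h2]

/-! ### The binary string for the parity problem -/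

/-- The concatenation of the codes of symbols below `7`, of which the encoding of an instance
consists; a symbol has `3` bits, and a code has `18`. -/
def codes (l : List ℕ) : List Bool := l.flatMap (code 3)

theorem clog_eight : Nat.clog 2 (7 + 1) = 3 := by decide

theorem encodeString_seven (l : List ℕ) : encodeString 7 l = codes l := by
  rw [encodeString, clog_eight, codes]

theorem length_codes (l : List ℕ) : (codes l).length = 18 * l.length :=
  flatMap_length_const _ 18 (fun a => length_code 3 a (by norm_num)) l

theorem codes_append (l l' : List ℕ) : codes (l ++ l') = codes l ++ codes l' := by simp [codes]

/-- The code of the three symbols that represent the symbol `a` of a text or pattern, or of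
their primed versions. -/
def symbolCode (prime a : Bool) : List Bool :=
  if prime then codes [3, 2 + a.toNat, 2] else codes [1, a.toNat, 0]

theorem length_symbolCode (prime a : Bool) : (symbolCode prime a).length = 54 := by
  unfold symbolCode; split_ifs <;> simp [length_codes]

/-- The code of the padded string (or of its primed copy) without its first and its last symbol. The
padding has been regrouped: every symbol `a` contributes the symbols `1 a 0`. -/
def innerCode (prime : Bool) (P : List Bool) : List Bool := P.flatMap (symbolCode prime)

theorem length_innerCode (prime : Bool) (P : List Bool) :
    (innerCode prime P).length = 54 * P.length :=
  flatMap_length_const _ 54 (length_symbolCode prime) P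

theorem codes_bits_padString (P : List Bool) :
    codes (bits (padString P)) = codes [0] ++ innerCode false P ++ codes [1] := by
  rw [padString_eq]
  have : bits (P.flatMap fun a => [true, a, false]) = P.flatMap fun a => [1, a.toNat, 0] := by
    simp [bits, List.map_flatMap]
  rw [List.cons_append, show bits (false :: ((P.flatMap fun a => [true, a, false]) ++ [true])) =
    [0] ++ bits (P.flatMap fun a => [true, a, false]) ++ [1] by simp [bits], this, codes_append,
    codes_append]
  congr 2
  rw [codes, List.flatMap_assoc]
  rfl

theorem codes_primed_padString (P : List Bool) :
    codes (primed (padString P)) = codes [2] ++ innerCode true P ++ codes [3] := by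
  rw [padString_eq]
  have : primed (P.flatMap fun a => [true, a, false]) = P.flatMap fun a => [3, 2 + a.toNat, 2] := by
    simp only [primed, List.map_flatMap]
    congr 1
    funext a
    cases a <;> rfl
  rw [List.cons_append, show primed (false :: ((P.flatMap fun a => [true, a, false]) ++ [true])) =
    [2] ++ primed (P.flatMap fun a => [true, a, false]) ++ [3] by simp [primed], this, codes_append,
    codes_append]
  congr 2
  rw [codes, List.flatMap_assoc]
  rfl

/-- A piece of the encoding of a pattern: a fixed string or the code of the pattern. -/
inductive Piece where
  | lit (y : List Bool)
  | pat (prime : Bool)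

/-- The string that a piece stands for. -/
def Piece.out (P : List Bool) : Piece → List Bool
  | .lit y => y
  | .pat prime => innerCode prime P

/-- The pieces of the code of the gadgets for a pattern. -/
def gadgetPieces : List Piece :=
  [.pat false, .lit (codes [1, 4, 0]), .pat false, .lit (codes [4, 1, 2]), .pat true,
    .lit (codes [3, 4, 2]), .pat true, .lit (codes [3, 0, 4])]

/-- The pieces of the code of a pattern followed by its primed copy. -/
def pairPieces : List Piece :=
  [.lit (codes [0]), .pat false, .lit (codes [1, 2]), .pat true, .lit (codes [3])]

/-- The string described by pieces, for every pattern of a collection. -/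
def piecesOut (ps : List Piece) (D : List (List Bool)) : List Bool :=
  D.flatMap fun P => ps.flatMap (Piece.out P)

theorem codes_patternPairs (D : List (List Bool)) :
    codes (patternPairs (D.map padString)) = piecesOut pairPieces D := by
  induction D with
  | nil => rfl
  | cons P D ih =>
    rw [List.map_cons, patternPairs_cons, codes_append, codes_append, ih, codes_bits_padString,
      codes_primed_padString]
    simp only [piecesOut, pairPieces, List.flatMap_cons, List.flatMap_nil, Piece.out,
      List.append_assoc, List.append_nil]
    rw [show codes [1, 2] = codes [1] ++ codes [2] from codes_append [1] [2], List.append_assoc]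

theorem nextFirst_map_padString {m : ℕ} (hm : 0 < m) (D : List (List Bool)) :
    nextFirst m (D.map padString) = [0] := by
  cases D with
  | nil => exact nextFirst_nil hm
  | cons P D => simp [nextFirst, padString_eq, bits]

theorem codes_gadgets {m : ℕ} (D : List (List Bool)) (hD : ∀ P ∈ D, P.length = m) :
    codes (gadgets (3 * m + 2) (D.map padString)) = piecesOut gadgetPieces D := by
  induction D with
  | nil => rfl
  | cons P D ih =>
    have hP := hD P (by simp)
    have e : ∀ l : List ℕ, ∀ a, codes (a :: l) = codes [a] ++ codes l := fun l a =>
      codes_append [a] l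
    have hb := codes_bits_padString P
    obtain ⟨F, hF⟩ : ∃ F, F = P.flatMap fun a => [true, a, false] := ⟨_, rfl⟩
    have hpad := padString_eq P
    rw [← hF] at hpad
    have hlen : F.length = 3 * m := by
      rw [hF, flatMap_length_const _ 3 (by simp), hP]
    have hFc : codes (bits F) = innerCode false P := by
      rw [hpad, List.cons_append, show bits (false :: (F ++ [true])) = [0] ++ bits F ++ [1] by
        simp [bits], codes_append, codes_append] at hb
      exact List.append_cancel_left (List.append_cancel_right hb)
    have h1 : (padString P).drop 1 = F ++ [true] := by rw [hpad]; rfl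
    have h2 : (padString P).take (3 * m + 2 - 1) = false :: F := by
      rw [hpad, List.take_left' (by simp; omega)]
    have h3 : (padString P).drop (3 * m + 2 - 1) = [true] := by
      rw [hpad, List.drop_left' (by simp; omega)]
    rw [List.map_cons, gadgets, h1, h2, h3, nextFirst_map_padString (by omega)]
    simp only [codes_append, ih fun Q hQ => hD Q (by simp [hQ]), codes_primed_padString]
    rw [show bits (F ++ [true]) = bits F ++ [1] by simp [bits],
      show bits (false :: F) = [0] ++ bits F by simp [bits], show bits [true] = [1] from rfl]
    simp only [codes_append, hFc]
    simp only [piecesOut, gadgetPieces, List.flatMap_cons, List.flatMap_nil, Piece.out,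
      List.append_assoc, List.append_nil]
    rw [e [4, 0] 1, e [0] 4, e [1, 2] 4, e [2] 1, e [4, 2] 3, e [2] 4, e [0, 4] 3, e [4] 0]
    simp only [List.append_assoc]

/-- The string whose number of phrases is computed: the preamble and the codes of the symbols of
`encS1`, `encS2` and, possibly, `encS3`, for the padded text and the padded patterns; `full` tells
whether it includes the pairs of patterns and primed patterns. -/
def parityString (full : Bool) (T : List Bool) (D : List (List Bool)) : List Bool :=
  (codePreamble 7 ++ codes [0]) ++ innerCode false T ++ codes [1, 5] ++ piecesOut gadgetPieces D ++
    codes [6] ++ if full then piecesOut pairPieces D ++ codes [0] else []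

theorem codePreamble_encS (T : List Bool) {m : ℕ} {D : List (List Bool)}
    (hD : ∀ P ∈ D, P.length = m) :
    codePreamble 7 ++ codes (encS1 (padString T) ++ encS2 (3 * m + 2) (D.map padString)) =
      parityString false T D := by
  rw [encS1, encS2]
  simp only [codes_append, codes_bits_padString, codes_gadgets D hD, parityString]
  rw [show codes [1, 5] = codes [1] ++ codes [5] from codes_append [1] [5]]
  simp

theorem codePreamble_encS3 (T : List Bool) {m : ℕ} {D : List (List Bool)}
    (hD : ∀ P ∈ D, P.length = m) :
    codePreamble 7 ++ codes (encS1 (padString T) ++ encS2 (3 * m + 2) (D.map padString) ++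
      encS3 (3 * m + 2) (D.map padString)) = parityString true T D := by
  rw [codes_append, ← List.append_assoc, codePreamble_encS T hD, encS3, nextFirst_nil (by omega),
    codes_append]
  change _ ++ (codes (patternPairs (D.map padString)) ++ codes [0]) = _
  rw [codes_patternPairs]
  simp [parityString]

theorem length_codePreamble_seven : (codePreamble 7).length = 253 := by
  rw [codePreamble_eq, clog_eight, List.length_append,
    flatMap_length_const _ 18 (fun a => length_code 3 a (by norm_num)),
    flatMap_length_const _ 2 (by simp)]
  simp

theorem length_parityString (full : Bool) (T : List Bool) {m : ℕ} {D : List (List Bool)}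
    (hD : ∀ P ∈ D, P.length = m) : (parityString full T D).length =
      ((3 * m + 2) * (if full then 6 else 4) + 4) * D.length * 18 + T.length * 3 * 18 +
        (if full then 5 else 4) * 18 + 253 := by
  have hpieces : ∀ (ps : List Piece) (c : ℕ), (∀ P ∈ D, (ps.flatMap (Piece.out P)).length = c) →
      (piecesOut ps D).length = c * D.length := by
    intro ps c h
    rw [piecesOut]
    clear hD
    induction D with
    | nil => simp
    | cons P D ih =>
      rw [List.flatMap_cons, List.length_append, h P (by simp), ih fun Q hQ => h Q (by simp [hQ]),
        List.length_cons]
      ring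
  have h1 := hpieces gadgetPieces (18 * (4 * (3 * m + 2) + 4)) (by
    intro P hP
    simp only [gadgetPieces, List.flatMap_cons, List.flatMap_nil, Piece.out, List.length_append,
      length_innerCode, length_codes, hD P hP]
    simp; omega)
  have h2 := hpieces pairPieces (18 * (2 * (3 * m + 2))) (by
    intro P hP
    simp only [pairPieces, List.flatMap_cons, List.flatMap_nil, Piece.out, List.length_append,
      length_innerCode, length_codes, hD P hP]
    simp; omega)
  cases full
  · simp [parityString, h1, length_codes, length_innerCode, length_codePreamble_seven]
    ring
  · simp [parityString, h1, h2, length_codes, length_innerCode, length_codePreamble_seven]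
    ring

open Classical in
/-- The parity of the sum of the two numbers of phrases decides whether some pattern occurs in
the text. -/
theorem lzSize_parityString (v : LZVariant) {T : List Bool} {m : ℕ} {D : List (List Bool)}
    (hm : 0 < m) (hnd : D.Nodup) (hD : ∀ P ∈ D, P.length = m) :
    (lzSize v (parityString true T D) % 2 + lzSize v (parityString false T D) % 2 + 1) % 2 =
      if ∃ P ∈ D, P <:+: T then 1 else 0 := by
  have hnd' : (D.map padString).Nodup := hnd.map padString_injective
  have hD' : ∀ P ∈ D.map padString, P.length = 3 * m + 2 := by
    intro P hP
    obtain ⟨Q, hQ, rfl⟩ := List.mem_map.1 hP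
    rw [length_padString, hD Q hQ]
  have hiff : (∃ P ∈ D.map padString, P <:+: padString T) ↔ ∃ P ∈ D, P <:+: T := by
    simp only [List.mem_map, exists_exists_and_eq_and]
    refine exists_congr fun P => and_congr_right fun hP => padString_infix_iff ?_
    exact List.ne_nil_of_length_pos (by rw [hD P hP]; exact hm)
  have h := lzSize_enc v (padString T) (m := 3 * m + 2) (by omega) hnd' hD'
  simp only [hiff, List.length_map] at h
  have hsym : ∀ x ∈ encS1 (padString T) ++ encS2 (3 * m + 2) (D.map padString) ++
      encS3 (3 * m + 2) (D.map padString), x < 7 := by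
    have hb : ∀ {P : List Bool}, ∀ x ∈ bits P, x < 7 := fun x hx => by
      have := le_one_of_mem_bits hx; omega
    have hp : ∀ {P : List Bool}, ∀ x ∈ primed P, x < 7 := fun x hx => by
      have := of_mem_primed hx; omega
    have hg : ∀ {m : ℕ} {D : List (List Bool)}, ∀ x ∈ gadgets m D, x < 7 := by
      intro m D
      induction D with
      | nil => simp [gadgets]
      | cons P D ih =>
        intro x hx
        simp only [gadgets, nextFirst, List.mem_append, List.mem_singleton] at hx
        rcases hx with (((((((((((h | h) | h) | h) | h) | h) | h) | h) | h) | h) | h))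
        all_goals first | exact hb x h | exact hp x h | exact ih x h | omega
    intro x hx
    simp only [encS1, encS2, encS3, nextFirst, List.mem_append, List.mem_singleton,
      List.mem_flatMap] at hx
    rcases hx with ((h | h) | h | h) | ⟨P, -, h | h⟩ | h
    all_goals first | exact hb x h | exact hp x h | exact hg x h | omega
  have h1 := lzSize_codePreamble_append v 7 _ (by norm_num) (by simp [encS1]) hsym
  have h2 := lzSize_codePreamble_append v 7 (encS1 (padString T) ++
    encS2 (3 * m + 2) (D.map padString)) (by norm_num) (by simp [encS1])
    (fun x hx => hsym x (by rw [List.mem_append]; exact Or.inl hx))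
  rw [encodeString_seven, codePreamble_encS3 T hD] at h1
  rw [encodeString_seven, codePreamble_encS T hD] at h2
  rw [h1, h2, h]
  split_ifs <;> omega

/-! ### Numbers as strings of bits -/

/-- The number whose binary digits are the given symbols, least significant digit first. -/
def bitVal (y : List Bool) : ℕ := Nat.ofDigits 2 (y.map Bool.toNat)

theorem bitVal_nil : bitVal [] = 0 := rfl

theorem bitVal_cons (a : Bool) (y : List Bool) : bitVal (a :: y) = a.toNat + 2 * bitVal y := by
  simp [bitVal, Nat.ofDigits_cons]

theorem bitVal_append (y z : List Bool) : bitVal (y ++ z) = bitVal y + 2 ^ y.length * bitVal z := by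
  simp [bitVal, Nat.ofDigits_append]

theorem bitVal_lt (y : List Bool) : bitVal y < 2 ^ y.length := by
  have := Nat.ofDigits_lt_base_pow_length (b := 2) (l := y.map Bool.toNat) (by norm_num) (by
    intro x hx
    obtain ⟨a, -, rfl⟩ := List.mem_map.1 hx
    cases a <;> simp)
  simpa [bitVal] using this

theorem bitVal_mod_div (y : List Bool) {d : ℕ} (hd : d ≤ y.length) :
    bitVal y % 2 ^ d = bitVal (y.take d) ∧ bitVal y / 2 ^ d = bitVal (y.drop d) := by
  have h1 := bitVal_append (y.take d) (y.drop d)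
  have h2 := bitVal_lt (y.take d)
  have hl : (y.take d).length = d := by simp [hd]
  rw [List.take_append_drop, hl] at h1
  rw [hl] at h2
  rw [h1]
  constructor
  · rw [Nat.add_mul_mod_self_left, Nat.mod_eq_of_lt h2]
  · rw [Nat.add_mul_div_left _ _ (by positivity), Nat.div_eq_of_lt h2, zero_add]

/-- The number whose digits to the base `2 ^ 54` are the binary digits of `i`. -/
def spread (i : ℕ) : ℕ := Nat.ofDigits (2 ^ 54) (Nat.digits 2 i)

theorem spread_zero : spread 0 = 0 := by simp [spread]

theorem spread_eq {i : ℕ} (hi : 0 < i) : spread i = i % 2 + 2 ^ 54 * spread (i / 2) := by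
  rw [spread, Nat.digits_of_two_le_of_pos le_rfl hi, Nat.ofDigits_cons]
  simp [spread]

theorem spread_add_two_mul (a : Bool) (i : ℕ) :
    spread (a.toNat + 2 * i) = a.toNat + 2 ^ 54 * spread i := by
  rcases Nat.eq_zero_or_pos (a.toNat + 2 * i) with h | h
  · have h1 : a.toNat = 0 := by omega
    have h2 : i = 0 := by omega
    rw [h1, h2]; simp [spread_zero]
  · rw [spread_eq h]
    have : a.toNat < 2 := by cases a <;> simp
    congr 1
    · omega
    · congr 2; omega

/-- The difference between the codes of `1` and `0`, as numbers; it is the same for primed symbols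
(`bitVal_symbolCode`). -/
def symbolDiff : ℕ := bitVal (symbolCode false true) - bitVal (symbolCode false false)

theorem bitVal_symbolCode (prime a : Bool) :
    bitVal (symbolCode prime a) = symbolDiff * a.toNat + bitVal (symbolCode prime false) := by
  revert prime a
  decide +kernel

/-- The code of a string is a linear combination of two values of `spread`. -/
theorem bitVal_innerCode (prime : Bool) (y : List Bool) :
    bitVal (innerCode prime y) = spread (bitVal y) * symbolDiff +
      spread (2 ^ y.length - 1) * bitVal (symbolCode prime false) := by
  induction y with
  | nil => simp [innerCode, bitVal_nil, spread_zero]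
  | cons a y ih =>
    have h1 : 2 ^ (a :: y).length - 1 = true.toNat + 2 * (2 ^ y.length - 1) := by
      have : 0 < 2 ^ y.length := by positivity
      rw [List.length_cons, pow_succ, Bool.toNat_true]; omega
    rw [h1, innerCode, List.flatMap_cons, bitVal_append, length_symbolCode, bitVal_cons,
      spread_add_two_mul, spread_add_two_mul, bitVal_symbolCode, ← innerCode, ih, Bool.toNat_true]
    ring

/-! ### The program that writes the strings

The registers have fixed roles. Registers `1`, `2`, `3` contain the constants `0`, `1`, `2`.
Registers `4` to `11` contain the parameters of the instance (`Layout.BaseRegs`), registers `12`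
and `13` the addresses of the two strings, and registers `14` to `17` the word length `B` of the
current string, `B - 1`, `2 ^ B` and the length of the string. Register `20` is the output
pointer, and registers `21` and `22` contain the pending bits and their number. The remaining
registers up to `33` are local: `23` and `24` contain the bits to be appended and their number,
`25` and `26` are temporary, `27` and `28` contain an input word and the number of its symbols,
`29` the length of a chunk, `30` and `31` the address and the length of a string, `32` and `33`
the address of a pattern and the number of patterns left.

The bounds on the numbers of steps are sums of the lengths of blocks, with two more steps for
every test of a loop.
-/

namespace WordRAM

/-- Append the bits of the number in register `23`, whose count is in register `24`, to the pending
bits, and write complete words to the output. -/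
def appendStmt : Stmt :=
  .block [.op .shl 25 23 22, .op .add 21 21 25, .op .add 22 22 24] ;;
  .whileLt 15 22 (.block [.op .mod 25 21 16, .store 20 25, .op .div 21 21 16, .op .sub 22 22 14,
    .op .add 20 20 3])

/-- The quantities that do not change while a string is written: the word length `w` and the number
`S` of cells of the machine; the length `n` of the text, the number `k` and the length `m` of the
patterns; the number `b` of symbols per input word, the number `pw` of words per pattern and the
address `pat` of the patterns; the chunk length `h` and the address `tab` of the table
for chunks; the length `N` of the output, the number `B` of symbols per output word, the
address `base` of the output (which occupies every other cell), and the initial memory `M`. -/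
structure Layout where
  (w S n k m b pw pat h tab N B base : ℕ)
  M : ℕ → ℕ

/-- The conditions under which strings are written correctly. -/
structure Layout.Valid (G : Layout) : Prop where
  B_pos : 0 < G.B
  b_pos : 0 < G.b
  b_le : G.b ≤ 2 * G.h
  h_le : G.h ≤ G.B
  le_w : G.B + (54 * G.h + 271) ≤ G.w
  le_S : G.base + 2 * (G.N / G.B + 2) ≤ G.S
  S_le : G.S ≤ 2 ^ G.w
  N_lt : G.N < 2 ^ G.w
  tab_le : G.tab + 2 ^ G.h ≤ G.base
  table : ∀ i < 2 ^ G.h, G.M (G.tab + i) = spread i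

/-- The registers that contain the parameters of the instance. -/
structure Layout.BaseRegs (G : Layout) (s : Store) : Prop where
  r1 : s.reg 1 = 0
  r2 : s.reg 2 = 1
  r3 : s.reg 3 = 2
  r4 : s.reg 4 = G.n
  r5 : s.reg 5 = G.k
  r6 : s.reg 6 = G.m
  r7 : s.reg 7 = G.b
  r8 : s.reg 8 = G.h
  r9 : s.reg 9 = G.tab
  r10 : s.reg 10 = G.pw
  r11 : s.reg 11 = G.pat

/-- The registers with constant contents. -/
structure Layout.Regs (G : Layout) (s : Store) : Prop extends G.BaseRegs s where
  r14 : s.reg 14 = G.B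
  r15 : s.reg 15 = G.B - 1
  r16 : s.reg 16 = 2 ^ G.B

theorem Layout.BaseRegs.of_eq {G : Layout} {s s' : Store} (h : G.BaseRegs s)
    (he : ∀ r < 12, s'.reg r = s.reg r) : G.BaseRegs s' := by
  constructor <;> rw [he _ (by norm_num)]
  exacts [h.r1, h.r2, h.r3, h.r4, h.r5, h.r6, h.r7, h.r8, h.r9, h.r10, h.r11]

theorem Layout.Regs.of_eq {G : Layout} {s s' : Store} (h : G.Regs s)
    (he : ∀ r < 20, s'.reg r = s.reg r) : G.Regs s' := by
  refine ⟨h.toBaseRegs.of_eq fun r hr => he r (by omega), ?_, ?_, ?_⟩ <;> rw [he _ (by norm_num)]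
  exacts [h.r14, h.r15, h.r16]

/-- The string `l` has been output so far, `f` complete words of it to the memory. -/
structure Layout.Written (G : Layout) (l : List Bool) (f : ℕ) (s : Store) : Prop where
  regs : G.Regs s
  ptr : s.reg 20 = G.base + 2 * (f + 1)
  acc : s.reg 21 = bitVal (l.drop (f * G.B))
  cnt : s.reg 22 = l.length - f * G.B
  le : f * G.B ≤ l.length
  word : ∀ j < f, s.mem (G.base + 2 * (j + 1)) = bitVal ((l.drop (j * G.B)).take G.B)
  frame : ∀ a, (∀ j < f, a ≠ G.base + 2 * (j + 1)) → s.mem a = G.M a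

/-- The string `l` has been output so far, all complete words of it to the memory. -/
def Layout.Output (G : Layout) (l : List Bool) (s : Store) : Prop :=
  ∃ f, G.Written l f s ∧ l.length < (f + 1) * G.B

theorem Layout.Output.regs {G : Layout} {l : List Bool} {s : Store} (h : G.Output l s) :
    G.Regs s := by
  obtain ⟨f, h, -⟩ := h
  exact h.regs

theorem Layout.Output.mem_of_lt {G : Layout} {l : List Bool} {s : Store} (h : G.Output l s) {a : ℕ}
    (ha : a < G.base) : s.mem a = G.M a := by
  obtain ⟨f, h, -⟩ := h
  exact h.frame a fun j _ => by omega

theorem Layout.Output.of_eq {G : Layout} {l : List Bool} {s s' : Store} (h : G.Output l s)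
    (hr : ∀ r < 23, s'.reg r = s.reg r) (hm : s'.mem = s.mem) : G.Output l s' := by
  obtain ⟨f, h, hf⟩ := h
  refine ⟨f, ⟨h.regs.of_eq fun r hr' => hr r (by omega), ?_, ?_, ?_, h.le, ?_, ?_⟩, hf⟩
  · rw [hr _ (by norm_num), h.ptr]
  · rw [hr _ (by norm_num), h.acc]
  · rw [hr _ (by norm_num), h.cnt]
  · rw [hm]; exact h.word
  · rw [hm]; exact h.frame

attribute [local simp] OkAll applyAll Instr.Ok Instr.apply Instr.exec Store.at BinOp.eval
  Function.update_apply

variable {G : Layout}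

/-- Fewer than `B` bits are pending, so at most `54 * h + 271 ≤ 325 * B` additional bits complete at
most `325` words. -/
theorem wp_append (hG : G.Valid) {l y : List Bool} {s : Store} (h : G.Output l s)
    (hV : s.reg 23 = bitVal y) (hL : s.reg 24 = y.length) (hy : y.length ≤ 54 * G.h + 271)
    (hN : l.length + y.length ≤ G.N) :
    WP G.w G.S appendStmt 2280 (fun s' => G.Output (l ++ y) s' ∧
      ∀ r, r < 20 ∨ 26 ≤ r → s'.reg r = s.reg r) s := by
  refine WP.frame ?_ (by decide)
  obtain ⟨f, h, hf⟩ := h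
  have hB := hG.B_pos
  have hdrop : (l.drop (f * G.B)).length = l.length - f * G.B := by simp
  have hacc : s.reg 21 + s.reg 23 <<< s.reg 22 = bitVal ((l ++ y).drop (f * G.B)) := by
    rw [List.drop_append_of_le_length h.le, bitVal_append, hdrop, h.acc, hV, h.cnt,
      Nat.shiftLeft_eq, mul_comm (bitVal y)]
  have hlt : ∀ f' ≥ f, bitVal ((l ++ y).drop (f' * G.B)) < 2 ^ G.w := by
    intro f' hf'
    refine (bitVal_lt _).trans_le (Nat.pow_le_pow_right (by norm_num) ?_)
    have := hG.le_w
    have := Nat.mul_le_mul_right G.B hf'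
    rw [List.length_drop, List.length_append]
    rw [Nat.succ_mul] at hf
    omega
  have hcnt : s.reg 22 + s.reg 24 = (l ++ y).length - f * G.B := by
    rw [h.cnt, hL, List.length_append]
    have := h.le
    omega
  have hlt0 := hlt f le_rfl
  have hNw := hG.N_lt
  refine WP.mono (WP.seq (t := 3) (t' := 325 * (5 + 2) + 2)
    (Q' := fun s => G.Written (l ++ y) f s) (WP.block ?_ ?_ (by decide)) ?_) (by norm_num)
    (fun s h => h)
  · simp only [OkAll, Instr.Ok, Instr.apply, Instr.exec, Store.at, BinOp.eval,
        Function.update_apply]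
    simp only [Nat.reduceEqDiff, if_true, if_false]
    rw [List.length_append] at hcnt
    refine ⟨by omega, by omega, by omega, trivial⟩
  · refine ⟨h.regs.of_eq ?_, ?_, ?_, ?_, ?_, ?_, ?_⟩
    · intro r hr
      simp [show r ≠ 21 by omega, show r ≠ 22 by omega, show r ≠ 25 by omega]
    · simpa using h.ptr
    · simpa using hacc
    · simpa using hcnt
    · rw [List.length_append]; have := h.le; omega
    · intro j hj
      have hjf : j * G.B + G.B ≤ f * G.B := by rw [← Nat.succ_mul]; exact Nat.mul_le_mul_right _ hj
      have hle := h.le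
      simp only [applyAll, Instr.apply, Instr.exec, Store.at]
      rw [h.word j hj, List.drop_append_of_le_length (by omega),
        List.take_append_of_le_length (by simp; omega)]
    · simpa using h.frame
  · intro s' hs'
    refine WP.while (fun n s => ∃ f' ≥ f, G.Written (l ++ y) f' s ∧
      (l ++ y).length < (f' + 1 + n) * G.B)
      ?_ ?_ 325 s' ⟨f, le_rfl, hs', ?_⟩
    · rintro n s ⟨f', hf', h, hn⟩ hc
      rw [h.regs.r15, h.cnt] at hc
      have hfB : (f' + 1) * G.B ≤ (l ++ y).length := by rw [Nat.succ_mul]; omega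
      have hf1 : f' + 1 ≤ G.N / G.B := by
        rw [Nat.le_div_iff_mul_le hB]
        rw [List.length_append] at hfB; omega
      have hn0 : n ≠ 0 := by
        rintro rfl
        rw [add_zero] at hn; omega
      obtain ⟨n, rfl⟩ := Nat.exists_eq_succ_of_ne_zero hn0
      refine ⟨n, rfl, WP.block ?_ ?_ (by decide)⟩
      · have h1 : s.reg 21 < 2 ^ G.w := by
          rw [h.acc]; exact hlt f' hf'
        have h2 : s.reg 21 % 2 ^ G.B ≤ s.reg 21 := Nat.mod_le _ _
        have h3 : s.reg 21 / 2 ^ G.B ≤ s.reg 21 := Nat.div_le_self _ _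
        have hS := hG.le_S
        have hS' := hG.S_le
        have hl : (l ++ y).length ≤ G.N := by rw [List.length_append]; exact hN
        simp only [OkAll, Instr.Ok, Instr.apply, Instr.exec, Store.at, BinOp.eval,
          Function.update_apply]
        simp only [Nat.reduceEqDiff, if_false, h.regs.r16, h.ptr, h.cnt, h.regs.r14,
          h.regs.r3]
        refine ⟨by omega, by omega, by omega, by omega, by omega, trivial⟩
      · have hd : G.B ≤ ((l ++ y).drop (f' * G.B)).length := by
          rw [List.length_drop]; omega
        obtain ⟨hmod, hdiv⟩ := bitVal_mod_div _ hd
        refine ⟨f' + 1, by omega, ⟨h.regs.of_eq ?_, ?_, ?_, ?_, hfB, ?_, ?_⟩, ?_⟩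
        · intro r hr
          simp [show r ≠ 21 by omega, show r ≠ 22 by omega, show r ≠ 25 by omega,
            show r ≠ 20 by omega]
        · simp [h.ptr, h.regs.r3]; omega
        · simp only [applyAll, Instr.apply, Instr.exec, Store.at, BinOp.eval,
            Function.update_apply]
          simp only [Nat.reduceEqDiff, if_true, if_false, h.regs.r16, h.acc]
          rw [hdiv, List.drop_drop, Nat.succ_mul]
        · simp [h.cnt, h.regs.r14, Nat.succ_mul]; omega
        · intro j hj
          simp only [applyAll, Instr.apply, Instr.exec, Store.at, BinOp.eval,
            Function.update_apply]
          simp only [Nat.reduceEqDiff, if_true, if_false, h.regs.r16, h.acc, h.ptr]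
          by_cases hjf : j = f'
          · subst hjf
            rw [if_pos rfl, hmod]
          · rw [if_neg (by omega)]
            exact h.word j (by omega)
        · intro a ha
          simp only [applyAll, Instr.apply, Instr.exec, Store.at, BinOp.eval,
            Function.update_apply]
          simp only [Nat.reduceEqDiff, if_true, if_false, h.regs.r16, h.acc, h.ptr]
          rw [if_neg (ha f' (by omega))]
          exact h.frame a fun j hj => ha j (by omega)
        · rw [show f' + 1 + 1 + n = f' + 1 + (n + 1) by ring]; exact hn
    · rintro n s ⟨f', -, h, hn⟩ hc
      rw [h.regs.r15, h.cnt] at hc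
      refine ⟨f', h, ?_⟩
      rw [Nat.succ_mul]
      have := h.le
      omega
    · have h1 : 54 * G.h + 271 ≤ 325 * G.B := by have := hG.h_le; omega
      rw [add_mul, List.length_append]
      omega

/-- Append a fixed string to the output. -/
def litStmt (y : List Bool) : Stmt :=
  .block [.const 23 (bitVal y), .const 24 y.length] ;; appendStmt

theorem wp_lit (hG : G.Valid) {l y : List Bool} {s : Store} (h : G.Output l s)
    (hy : y.length ≤ 271) (hN : l.length + y.length ≤ G.N) :
    WP G.w G.S (litStmt y) 2282 (fun s' => G.Output (l ++ y) s') s := by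
  have hw := hG.le_w
  have h1 : bitVal y < 2 ^ G.w :=
    (bitVal_lt y).trans_le (Nat.pow_le_pow_right (by norm_num) (by omega))
  have hNw := hG.N_lt
  refine WP.seq (t := 2) (t' := 2280) (Q' := fun s => G.Output l s ∧ s.reg 23 = bitVal y ∧
    s.reg 24 = y.length) (WP.block ⟨h1, ?_, trivial⟩ ⟨h.of_eq ?_ rfl, ?_, ?_⟩ le_rfl)
    fun s' hs' => (wp_append hG hs'.1 hs'.2.1 hs'.2.2 (by omega) hN).mono le_rfl fun s h => h.1
  · simp only [Instr.Ok]; omega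
  · intro r hr
    simp [show r ≠ 23 by omega, show r ≠ 24 by omega]
  · simp
  · simp

/-- Append the codes of the first (at most `h`) symbols of the input word in register `27` to the
output; register `28` contains the number of symbols that are left in the word. -/
def chunkStmt (prime : Bool) : Stmt :=
  .block [.op .sub 25 28 8, .op .sub 29 28 25, .op .sub 28 28 29, .op .shl 25 2 29,
    .op .mod 26 27 25, .op .div 27 27 25, .op .add 26 9 26, .load 23 26, .const 24 symbolDiff,
    .op .mul 23 23 24, .op .sub 25 25 2, .op .add 25 9 25, .load 26 25,
    .const 24 (bitVal (symbolCode prime false)), .op .mul 26 26 24, .op .add 23 23 26,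
    .const 24 54, .op .mul 24 24 29] ;; appendStmt

/-- The code of the chunk is computed from the table by `bitVal_innerCode`. -/
theorem wp_chunk (hG : G.Valid) (prime : Bool) {l y : List Bool} {s : Store} (h : G.Output l s)
    (hx : s.reg 27 = bitVal y) (hc : s.reg 28 = y.length) (hN : l.length + 54 * y.length ≤ G.N)
    (hy : 0 < y.length) (hyb : y.length ≤ G.b) :
    WP G.w G.S (chunkStmt prime) 2298 (fun s' =>
      G.Output (l ++ innerCode prime (y.take G.h)) s' ∧ s'.reg 27 = bitVal (y.drop G.h) ∧
        s'.reg 28 = (y.drop G.h).length) s := by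
  obtain ⟨d, hd⟩ : ∃ d, d = min y.length G.h := ⟨_, rfl⟩
  have hd' : y.length - (y.length - G.h) = d := by omega
  have htake : y.take G.h = y.take d := by
    rw [hd]; rcases le_total y.length G.h with h' | h'
    · rw [min_eq_left h', List.take_of_length_le h', List.take_length]
    · rw [min_eq_right h']
  have hdrop : y.drop G.h = y.drop d := by
    rw [hd]; rcases le_total y.length G.h with h' | h'
    · rw [min_eq_left h', List.drop_of_length_le h', List.drop_length]
    · rw [min_eq_right h']
  have hdy : d ≤ y.length := by omega
  have hdh : d ≤ G.h := by omega
  rw [htake, hdrop]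
  obtain ⟨hmod, hdiv⟩ := bitVal_mod_div y hdy
  have hl1 : (y.take d).length = d := by simp [hdy]
  -- `d` is the length of the chunk, which is the number in register `29`.
  have hval := bitVal_innerCode prime (y.take d)
  have hlen := length_innerCode prime (y.take d)
  have hvlt := bitVal_lt (innerCode prime (y.take d))
  have hidx := bitVal_lt (y.take d)
  rw [hl1] at hval hlen hidx
  rw [hlen] at hvlt
  have hpow : 2 ^ d ≤ 2 ^ G.h := Nat.pow_le_pow_right (by norm_num) hdh
  have hpow0 : 0 < 2 ^ d := by positivity
  have hw := hG.le_w
  have hpw : 2 ^ (54 * d) ≤ 2 ^ G.w := Nat.pow_le_pow_right (by norm_num) (by omega)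
  have hpd : 2 ^ d < 2 ^ G.w := Nat.pow_lt_pow_right (by norm_num) (by omega)
  have hp54 : 2 ^ 54 ≤ 2 ^ G.w := Nat.pow_le_pow_right (by norm_num) (by omega)
  have hsd : symbolDiff < 2 ^ 54 := by
    have := bitVal_lt (symbolCode false true)
    rw [length_symbolCode] at this
    unfold symbolDiff; omega
  have hsc : bitVal (symbolCode prime false) < 2 ^ 54 := by
    have := bitVal_lt (symbolCode prime false)
    rwa [length_symbolCode] at this
  have htab := hG.tab_le
  have hS := hG.le_S
  have hSw := hG.S_le
  have hNw := hG.N_lt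
  have hyN : y.length < 2 ^ G.w := by omega
  have hb := hG.b_le
  have hxlt : bitVal (y.drop d) < 2 ^ G.w :=
    (bitVal_lt _).trans_le (Nat.pow_le_pow_right (by norm_num) (by rw [List.length_drop]; omega))
  have hm1 : s.mem (G.tab + bitVal (y.take d)) = spread (bitVal (y.take d)) := by
    rw [h.mem_of_lt (by omega), hG.table _ (by omega)]
  have hm2 : s.mem (G.tab + (2 ^ d - 1)) = spread (2 ^ d - 1) := by
    rw [h.mem_of_lt (by omega), hG.table _ (by omega)]
  refine WP.mono (WP.seq (t := 18) (Q' := fun s' => G.Output l s' ∧ s'.reg 23 =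
    bitVal (innerCode prime (y.take d)) ∧ s'.reg 24 = (innerCode prime (y.take d)).length ∧
    s'.reg 27 = bitVal (y.drop d) ∧ s'.reg 28 = (y.drop d).length)
    (WP.block ?_ ?_ le_rfl)
    fun s' hs' => (wp_append hG hs'.1 hs'.2.1 hs'.2.2.1 (by omega) (by omega)).mono le_rfl
      fun s'' h'' => ⟨h''.1, ?_, ?_⟩) (by norm_num) fun s h => h
  · simp only [OkAll, Instr.Ok, Instr.apply, Instr.exec, Store.at, BinOp.eval,
        Function.update_apply]
    simp only [Nat.reduceEqDiff, if_true, if_false, hc, h.regs.r8, hd', h.regs.r2,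
      Nat.shiftLeft_eq, one_mul, hx, hmod, hdiv, h.regs.r9, hm1, hm2, and_true]
    refine ⟨by omega, by omega, by omega, by omega, by omega, by omega, by omega, by omega,
      by omega, by omega, by omega, by omega, by omega, by omega, by omega, by omega, by omega,
      by omega⟩
  · refine ⟨h.of_eq ?_ ?_, ?_, ?_, ?_, ?_⟩
    · intro r hr
      simp only [applyAll, Instr.apply, Instr.exec, Store.at, Function.update_apply]
      simp only [show r ≠ 23 by omega, show r ≠ 24 by omega, show r ≠ 25 by omega,
        show r ≠ 26 by omega, show r ≠ 27 by omega, show r ≠ 28 by omega, show r ≠ 29 by omega,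
        if_false]
    · rfl
    all_goals
      simp only [applyAll, Instr.apply, Instr.exec, Store.at, BinOp.eval, Function.update_apply]
      simp only [Nat.reduceEqDiff, if_true, if_false, hc, h.regs.r8, hd', h.regs.r2,
        Nat.shiftLeft_eq, one_mul, hx, hmod, hdiv, h.regs.r9, hm1, hm2]
    · exact hval.symm
    · exact hlen.symm
    · simp
  · rw [h''.2 27 (by norm_num)]; exact hs'.2.2.2.1
  · rw [h''.2 28 (by norm_num)]; exact hs'.2.2.2.2

/-- Append the codes of the symbols of the input word in register `27`, whose number is in
register `28`. -/
def wordStmt (prime : Bool) : Stmt := .whileLt 1 28 (chunkStmt prime)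

/-- A word consists of at most two chunks. -/
theorem wp_word (hG : G.Valid) (prime : Bool) {l y : List Bool} {s : Store} (h : G.Output l s)
    (hx : s.reg 27 = bitVal y) (hc : s.reg 28 = y.length) (hN : l.length + 54 * y.length ≤ G.N)
    (hy : y.length ≤ G.b) :
    WP G.w G.S (wordStmt prime) 4602 (fun s' => G.Output (l ++ innerCode prime y) s') s := by
  have hb := hG.b_le
  refine WP.mono (WP.while (t := 2298) (fun n s => ∃ l' y', l' ++ innerCode prime y' =
    l ++ innerCode prime y ∧ G.Output l' s ∧ s.reg 27 = bitVal y' ∧ s.reg 28 = y'.length ∧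
    y'.length ≤ n * G.h ∧ y'.length ≤ G.b) ?_ ?_ 2 s ⟨l, y, rfl, h, hx, hc, by omega, hy⟩)
        (by norm_num) fun s h => h
  · rintro n s ⟨l', y', he, ho, hx, hc, hn, hyb⟩ hlt
    rw [ho.regs.r1, hc] at hlt
    have hn0 : n ≠ 0 := by rintro rfl; omega
    obtain ⟨n, rfl⟩ := Nat.exists_eq_succ_of_ne_zero hn0
    have hlen := congrArg List.length he
    simp only [List.length_append, length_innerCode] at hlen
    refine ⟨n, rfl, (wp_chunk hG prime ho hx hc (by omega) hlt hyb).mono le_rfl fun s' hs' =>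
      ⟨l' ++ innerCode prime (y'.take G.h), y'.drop G.h, ?_, hs'.1, hs'.2.1, hs'.2.2, ?_, ?_⟩⟩
    · rw [← he, List.append_assoc]
      congr 1
      rw [innerCode, innerCode, ← List.flatMap_append, List.take_append_drop, innerCode]
    · rw [List.length_drop]
      rw [Nat.succ_mul] at hn; omega
    · rw [List.length_drop]; omega
  · rintro n s ⟨l', y', he, ho, hx, hc, hn, hyb⟩ hlt
    rw [ho.regs.r1, hc] at hlt
    have : y' = [] := by rw [← List.length_eq_zero_iff]; omega
    rw [this] at he
    simp only [innerCode, List.flatMap_nil, List.append_nil] at he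
    rw [he] at ho
    exact ho

/-- The cells from address `a` on, all of them below the address of the table, contain the packed
representation of `z`. -/
def Layout.Packed (G : Layout) (a : ℕ) (z : List Bool) : Prop :=
  ∀ j, j * G.b < z.length → a + j < G.tab ∧ G.M (a + j) = bitVal ((z.drop (j * G.b)).take G.b)

/-- Append the codes of the symbols of the packed string at the address in register `30`, whose
length is in register `31`. -/
def stringStmt (prime : Bool) : Stmt :=
  .whileLt 1 31 (.block [.load 27 30, .op .sub 25 31 7, .op .sub 28 31 25, .op .add 31 25 1,
    .op .add 30 30 2] ;; wordStmt prime)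

theorem wp_string (hG : G.Valid) (prime : Bool) {l z : List Bool} {a n : ℕ} {s : Store}
    (h : G.Output l s) (ha : s.reg 30 = a) (hz : s.reg 31 = z.length) (hp : G.Packed a z)
    (hN : l.length + 54 * z.length ≤ G.N) (hn : z.length ≤ n * G.b) :
    WP G.w G.S (stringStmt prime) (n * 4609 + 2)
      (fun s' => G.Output (l ++ innerCode prime z) s') s := by
  have hb := hG.b_pos
  have htab : G.tab ≤ G.base := (Nat.le_add_right _ _).trans hG.tab_le
  have hS : G.base + 4 ≤ G.S :=
    (Nat.add_le_add_left (Nat.mul_le_mul_left 2 (Nat.le_add_left 2 _)) _).trans hG.le_S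
  have hSw := hG.S_le
  have hNw := hG.N_lt
  refine WP.mono (WP.while (t := 4607) (fun n s => ∃ l' z' a', l' ++ innerCode prime z' =
    l ++ innerCode prime z ∧ G.Output l' s ∧ s.reg 30 = a' ∧ s.reg 31 = z'.length ∧ G.Packed a' z' ∧
    z'.length ≤ n * G.b) ?_ ?_ n s ⟨l, z, a, rfl, h, ha, hz, hp, hn⟩) (by omega) fun s h => h
  · rintro n s ⟨l', z', a', he, ho, ha, hz, hp, hn⟩ hlt
    rw [ho.regs.r1, hz] at hlt
    have hn0 : n ≠ 0 := by rintro rfl; omega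
    obtain ⟨n, rfl⟩ := Nat.exists_eq_succ_of_ne_zero hn0
    have hlen := congrArg List.length he
    simp only [List.length_append, length_innerCode] at hlen
    obtain ⟨hp1, hp2⟩ := hp 0 (by omega)
    rw [add_zero] at hp1 hp2
    rw [zero_mul, List.drop_zero] at hp2
    have hp3 : s.mem a' = bitVal (z'.take G.b) := by rw [ho.mem_of_lt (by omega), hp2]
    have hl1 : (z'.take G.b).length = z'.length - (z'.length - G.b) := by
      rw [List.length_take]; omega
    refine ⟨n, rfl, WP.mono (WP.seq (t := 5) (t' := 4602) (Q' := fun s => G.Output l' s ∧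
      s.reg 27 = bitVal (z'.take G.b) ∧ s.reg 28 = (z'.take G.b).length ∧ s.reg 30 = a' + 1 ∧
      s.reg 31 = (z'.drop G.b).length) (WP.block ?_ ⟨ho.of_eq ?_ rfl, ?_⟩ (by decide))
      fun s' hs' => ((wp_word hG prime hs'.1 hs'.2.1 hs'.2.2.1 (by omega)
        (List.length_take_le _ _)).frame (lo := 20) (hi := 30) (by cases prime <;> decide)).mono
          le_rfl fun s'' h'' => ⟨_, z'.drop G.b, a' + 1, ?_, h''.1, ?_, ?_, ?_, ?_⟩) le_rfl
      fun s h => h⟩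
    · simp only [OkAll, Instr.Ok, Instr.apply, Instr.exec, Store.at, BinOp.eval,
        Function.update_apply]
      simp only [Nat.reduceEqDiff, if_true, if_false, hz, ho.regs.r7, ho.regs.r1, ho.regs.r2, ha,
        and_true]
      refine ⟨by omega, by omega, by omega, by omega, by omega⟩
    · intro r hr
      simp only [applyAll, Instr.apply, Instr.exec, Store.at, Function.update_apply]
      simp only [show r ≠ 25 by omega, show r ≠ 27 by omega, show r ≠ 28 by omega,
        show r ≠ 30 by omega, show r ≠ 31 by omega, if_false]
    · simp only [applyAll, Instr.apply, Instr.exec, Store.at, BinOp.eval, Function.update_apply]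
      simp only [Nat.reduceEqDiff, if_true, if_false, hz, ho.regs.r7, ho.regs.r1, ho.regs.r2, ha,
        hp3, hl1, List.length_drop, add_zero, and_self]
    · rw [← he, List.append_assoc]
      congr 1
      rw [innerCode, innerCode, ← List.flatMap_append, List.take_append_drop, innerCode]
    · rw [h''.2 30 (by norm_num)]; exact hs'.2.2.2.1
    · rw [h''.2 31 (by norm_num)]; exact hs'.2.2.2.2
    · intro j hj
      rw [List.length_drop] at hj
      have := hp (j + 1) (by rw [Nat.succ_mul]; omega)
      rw [List.drop_drop, add_assoc, add_comm 1 j, show G.b + j * G.b = (j + 1) * G.b by ring]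
      exact this
    · rw [List.length_drop]
      rw [Nat.succ_mul] at hn; omega
  · rintro n s ⟨l', z', a', he, ho, ha, hz, hp, hn⟩ hlt
    rw [ho.regs.r1, hz] at hlt
    have : z' = [] := by rw [← List.length_eq_zero_iff]; omega
    rw [this] at he
    simp only [innerCode, List.flatMap_nil, List.append_nil] at he
    rw [he] at ho
    exact ho

/-- Append one piece of the encoding of the pattern at the address in register `32`. -/
def pieceStmt : Piece → Stmt
  | .lit y => litStmt y
  | .pat prime => .block [.op .add 30 32 1, .op .add 31 6 1] ;; stringStmt prime

/-- A piece leaves the loop over the patterns undisturbed, that is, registers `32` and `33`. -/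
theorem writesIn_pieceStmt (p : Piece) : (pieceStmt p).writesIn 20 32 = true := by
  cases p with
  | lit y => rfl
  | pat prime => cases prime <;> rfl

theorem wp_piece (hG : G.Valid) {l P : List Bool} {a n : ℕ} {s : Store} (p : Piece)
    (h : G.Output l s) (ha : s.reg 32 = a) (hP : P.length = G.m) (hp : G.Packed a P)
    (hlit : ∀ y, p = .lit y → y.length ≤ 271)
    (hN : l.length + (p.out P).length ≤ G.N) (hn : P.length ≤ n * G.b) (ha' : a ≤ G.tab) :
    WP G.w G.S (pieceStmt p) (n * 4609 + 2282) (fun s' => G.Output (l ++ p.out P) s' ∧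
      ∀ r, r < 20 ∨ 32 ≤ r → s'.reg r = s.reg r) s := by
  refine WP.frame ?_ (writesIn_pieceStmt p)
  cases p with
  | lit y => exact (wp_lit hG h (hlit y rfl) hN).mono (by omega) fun s h => h
  | pat prime =>
    have htab : G.tab ≤ G.base := (Nat.le_add_right _ _).trans hG.tab_le
    have hS : G.base + 4 ≤ G.S :=
      (Nat.add_le_add_left (Nat.mul_le_mul_left 2 (Nat.le_add_left 2 _)) _).trans hG.le_S
    have hSw := hG.S_le
    have hNw := hG.N_lt
    rw [Piece.out, length_innerCode] at hN
    refine WP.mono (WP.seq (t := 2) (Q' := fun s => G.Output l s ∧ s.reg 30 = a ∧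
      s.reg 31 = P.length) (WP.block ?_ ⟨h.of_eq ?_ rfl, ?_, ?_⟩ le_rfl)
      fun s' hs' => wp_string hG prime hs'.1 hs'.2.1 hs'.2.2 hp hN hn) (by omega) fun s h => h
    · simp [h.regs.r6, h.regs.r1, ha, ← hP]
      omega
    · intro r hr
      simp [show r ≠ 30 by omega, show r ≠ 31 by omega]
    · simp [ha, h.regs.r1]
    · simp [h.regs.r6, h.regs.r1, hP]

/-- Append several pieces of the encoding of the pattern at the address in register `32`. -/
def piecesStmt : List Piece → Stmt
  | [] => .block []
  | p :: ps => pieceStmt p ;; piecesStmt ps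

theorem writesIn_piecesStmt (ps : List Piece) : (piecesStmt ps).writesIn 20 32 = true := by
  induction ps with
  | nil => rfl
  | cons p ps ih => rw [piecesStmt, Stmt.writesIn, writesIn_pieceStmt, ih]; rfl

theorem wp_pieces (hG : G.Valid) {P : List Bool} {a n : ℕ} (hP : P.length = G.m)
    (hp : G.Packed a P) (hn : P.length ≤ n * G.b) (ha' : a ≤ G.tab) (ps : List Piece)
    (hlit : ∀ y, .lit y ∈ ps → y.length ≤ 271) : ∀ {l : List Bool} {s : Store},
    G.Output l s → s.reg 32 = a → l.length + (ps.flatMap (Piece.out P)).length ≤ G.N →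
    WP G.w G.S (piecesStmt ps) (ps.length * (n * 4609 + 2282))
      (fun s' => G.Output (l ++ ps.flatMap (Piece.out P)) s') s := by
  induction ps with
  | nil =>
    intro l s h _ _
    exact WP.block trivial (by simpa [applyAll] using h) (by simp)
  | cons p ps ih =>
    intro l s h ha hN
    rw [List.flatMap_cons, List.length_append] at hN
    refine WP.mono (WP.seq (wp_piece hG p h ha hP hp (fun y hy => hlit y (by simp [hy])) (by omega)
      hn ha') fun s' hs' => ih (fun y hy => hlit y (by simp [hy])) hs'.1 (by
        rw [hs'.2 32 (by norm_num), ha]) (by rw [List.length_append]; omega)) ?_ ?_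
    · rw [List.length_cons, Nat.succ_mul]; omega
    · intro s hs
      rwa [List.flatMap_cons, ← List.append_assoc]

/-- The packed representations of the patterns `D` fill the memory from address `a` to the table. -/
def Layout.PatternsAt (G : Layout) (a : ℕ) (D : List (List Bool)) : Prop :=
  a + D.length * G.pw ≤ G.tab ∧
    ∀ i P, D[i]? = some P → P.length = G.m ∧ G.Packed (a + i * G.pw) P

theorem Layout.PatternsAt.tail {a : ℕ} {P : List Bool} {D : List (List Bool)}
    (h : G.PatternsAt a (P :: D)) : G.PatternsAt (a + G.pw) D := by
  refine ⟨?_, fun i Q hQ => ?_⟩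
  · have := h.1
    rw [List.length_cons, Nat.succ_mul] at this; omega
  · have := h.2 (i + 1) Q (by simpa using hQ)
    rwa [Nat.succ_mul, add_comm (i * G.pw), ← add_assoc] at this

/-- Append the given pieces of the encodings of all patterns. -/
def patternsStmt (ps : List Piece) : Stmt :=
  .block [.op .add 32 11 1, .op .add 33 5 1] ;;
  .whileLt 1 33 (piecesStmt ps ;; .block [.op .add 32 32 10, .op .sub 33 33 2])

theorem wp_patterns (hG : G.Valid) {l : List Bool} {D : List (List Bool)} {s : Store}
    (ps : List Piece) (h : G.Output l s) (hk : D.length = G.k) (hkw : G.k < 2 ^ G.w)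
    (hp : G.PatternsAt G.pat D) (hlit : ∀ y, .lit y ∈ ps → y.length ≤ 271)
    (hN : l.length + (piecesOut ps D).length ≤ G.N) (hm : G.m ≤ G.pw * G.b) :
    WP G.w G.S (patternsStmt ps) (G.k * (ps.length * (G.pw * 4609 + 2282) + 4) + 4)
      (fun s' => G.Output (l ++ piecesOut ps D) s') s := by
  have htab : G.tab ≤ G.base := (Nat.le_add_right _ _).trans hG.tab_le
  have hS : G.base + 4 ≤ G.S :=
    (Nat.add_le_add_left (Nat.mul_le_mul_left 2 (Nat.le_add_left 2 _)) _).trans hG.le_S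
  have hSw := hG.S_le
  refine WP.mono (WP.seq (t := 2) (Q' := fun s => G.Output l s ∧ s.reg 32 = G.pat ∧
    s.reg 33 = G.k) (WP.block ?_ ⟨h.of_eq ?_ rfl, ?_, ?_⟩ le_rfl)
    fun s' hs' => WP.while (t := ps.length * (G.pw * 4609 + 2282) + 2) (fun n s => ∃ l' D' a',
      l' ++ piecesOut ps D' = l ++ piecesOut ps D ∧ G.Output l' s ∧ s.reg 32 = a' ∧ s.reg 33 = n ∧
      D'.length = n ∧ G.PatternsAt a' D' ∧ n ≤ G.k) ?_ ?_ G.k s'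
      ⟨l, D, G.pat, rfl, hs'.1, hs'.2.1, hs'.2.2, hk, hp, le_rfl⟩) (le_of_eq (by ring)) fun s h => h
  · have := hp.1
    simp [h.regs.r5, h.regs.r11, h.regs.r1]
    omega
  · intro r hr
    simp [show r ≠ 32 by omega, show r ≠ 33 by omega]
  · simp [h.regs.r11, h.regs.r1]
  · simp [h.regs.r5, h.regs.r1]
  · rintro n s ⟨l', D', a', he, ho, ha, hn, hD, hp, hnk⟩ hlt
    rw [ho.regs.r1, hn] at hlt
    obtain ⟨P, D', rfl⟩ := List.exists_cons_of_length_pos (hD ▸ hlt)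
    obtain ⟨n, rfl⟩ := Nat.exists_eq_succ_of_ne_zero hlt.ne'
    obtain ⟨hP, hpk⟩ := hp.2 0 P rfl
    rw [zero_mul, add_zero] at hpk
    have hp1 := hp.tail.1
    have hlen := congrArg List.length he
    have hcons : piecesOut ps (P :: D') = ps.flatMap (Piece.out P) ++ piecesOut ps D' := rfl
    rw [List.length_append, List.length_append, hcons, List.length_append] at hlen
    refine ⟨n, rfl, WP.seq ((wp_pieces hG hP hpk (hP.trans_le hm) (by omega) ps hlit ho ha
      (by omega)).frame (writesIn_piecesStmt ps)) fun s' hs' => WP.block ?_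
        ⟨l' ++ ps.flatMap (Piece.out P), D', a' + G.pw, ?_, hs'.1.of_eq ?_ rfl, ?_, ?_, ?_, hp.tail,
            by omega⟩ le_rfl⟩
    · simp [hs'.1.regs.r10, hs'.2 32, hs'.2 33, ha, hn]
      omega
    · rw [← he, hcons, List.append_assoc]
    · intro r hr
      simp [show r ≠ 32 by omega, show r ≠ 33 by omega]
    · simp [hs'.1.regs.r10, hs'.2 32, ha]
    · simp [hs'.1.regs.r2, hs'.2 33, hn]
    · simpa using hD
  · rintro n s ⟨l', D', a', he, ho, ha, hn, hD, hp, hnk⟩ hlt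
    rw [ho.regs.r1, hn] at hlt
    obtain rfl : D' = [] := List.length_eq_zero_iff.1 (by omega)
    have hnil : piecesOut ps [] = [] := rfl
    rw [hnil, List.append_nil] at he
    rw [he] at ho
    exact ho

end WordRAM

/-! ### The memory images of the inputs -/

theorem length_pack (b : ℕ) (x : List Bool) : (pack b x).length = (x.length + b - 1) / b := by
  simp [pack]

theorem pack_getD {b : ℕ} (hb : 0 < b) (x : List Bool) (j : ℕ) :
    (pack b x).getD j 0 = bitVal ((x.drop (j * b)).take b) := by
  rw [List.getD_eq_getElem?_getD, pack, List.getElem?_map]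
  by_cases hj : j < (x.length + b - 1) / b
  · rw [List.getElem?_range hj]; rfl
  · rw [List.getElem?_eq_none (by simpa using hj)]
    have : ¬ (j + 1) * b ≤ x.length + b - 1 := fun h => hj ((Nat.le_div_iff_mul_le hb).2 h)
    rw [Nat.succ_mul] at this
    rw [List.drop_of_length_le (by omega), List.take_nil]
    rfl

theorem lt_length_pack {b : ℕ} (hb : 0 < b) {x : List Bool} {j : ℕ} (hj : j * b < x.length) :
    j < (pack b x).length := by
  rw [length_pack]
  refine (Nat.le_div_iff_mul_le hb).2 ?_
  rw [Nat.succ_mul]; omega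

theorem length_le_length_pack_mul {b : ℕ} (hb : 0 < b) (x : List Bool) :
    x.length ≤ (pack b x).length * b := by
  by_contra h
  exact lt_irrefl _ (lt_length_pack hb (not_le.1 h))

theorem lzInput_getD_succ (x : List Bool) (j : ℕ) : (lzInput x).getD (j + 1) 0 =
    bitVal ((x.drop (j * bitLen x.length)).take (bitLen x.length)) :=
  pack_getD (Nat.succ_pos _) x j

theorem dmInput_getD_text (T : List Bool) (m : ℕ) (D : List (List Bool)) {j : ℕ}
    (hj : j < (pack (bitLen T.length) T).length) :
    (dmInput T m D).getD (3 + j) 0 = (pack (bitLen T.length) T).getD j 0 := by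
  rw [dmInput, List.append_assoc, List.getD_append_right _ _ _ _ (by simp),
    List.getD_append _ _ _ _ (by simpa using hj)]
  simp

theorem dmInput_getD_pattern (T : List Bool) {m : ℕ} {D : List (List Bool)}
    (hD : ∀ P ∈ D, P.length = m) {i j : ℕ} {P : List Bool} (hP : D[i]? = some P)
    (hj : j < (pack (bitLen T.length) P).length) :
    (dmInput T m D).getD (3 + (pack (bitLen T.length) T).length +
      i * ((m + bitLen T.length - 1) / bitLen T.length) + j) 0 =
        (pack (bitLen T.length) P).getD j 0 := by
  have h : ∀ (D : List (List Bool)) (i : ℕ), (∀ P ∈ D, P.length = m) → D[i]? = some P →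
      (D.flatMap (pack (bitLen T.length)))[i * ((m + bitLen T.length - 1) / bitLen T.length) + j]? =
        (pack (bitLen T.length) P)[j]? := by
    intro D
    induction D with
    | nil => intro i _ h; simp at h
    | cons Q D ih =>
      intro i hD hP
      have hQ : (pack (bitLen T.length) Q).length =
          (m + bitLen T.length - 1) / bitLen T.length := by
        rw [length_pack, hD Q (by simp)]
      rw [List.flatMap_cons]
      cases i with
      | zero =>
        obtain rfl : Q = P := by simpa using hP
        rw [zero_mul, zero_add, List.getElem?_append_left hj]
      | succ i =>
        rw [List.getElem?_append_right (by rw [hQ, Nat.succ_mul]; omega), hQ,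
          ← ih i (fun P hP => hD P (by simp [hP])) (by simpa using hP)]
        congr 1
        rw [Nat.succ_mul]; omega
  rw [dmInput, List.getD_eq_getElem?_getD, List.getD_eq_getElem?_getD,
    List.getElem?_append_right (by simp; omega), ← h D i hD hP]
  congr 2
  simp; omega

theorem length_dmInput (T : List Bool) {m : ℕ} {D : List (List Bool)}
    (hD : ∀ P ∈ D, P.length = m) : (dmInput T m D).length = 3 + (pack (bitLen T.length) T).length +
      D.length * ((m + bitLen T.length - 1) / bitLen T.length) := by
  have h : (D.flatMap (pack (bitLen T.length))).length =
      D.length * ((m + bitLen T.length - 1) / bitLen T.length) := by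
    induction D with
    | nil => simp
    | cons Q D ih =>
      rw [List.flatMap_cons, List.length_append, ih fun P hP => hD P (by simp [hP]), length_pack,
        hD Q (by simp), List.length_cons, Nat.succ_mul, add_comm]
  rw [dmInput, List.length_append, h]
  simp; omega

namespace WordRAM

attribute [local simp] OkAll applyAll Instr.Ok Instr.apply Instr.exec Store.at BinOp.eval
  Function.update_apply

/-! ### The program that writes an input for the parity problem -/

/-- Compute the number of bits of the positive number in register `src`. -/
def bitLenStmt (dst src : ℕ) : Stmt :=
  .block [.op .add 25 src 1, .const dst 0] ;;
  .whileLt 1 25 (.block [.op .div 25 25 3, .op .add dst dst 2])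

theorem wp_bitLen {w S dst src v : ℕ} {s : Store} (h1 : s.reg 1 = 0) (h2 : s.reg 2 = 1)
    (h3 : s.reg 3 = 2) (hd : 3 < dst) (hd' : dst ≠ 25) (hv : s.reg src = v)
    (hs : 0 < v) (hw : v < 2 ^ w) :
    WP w S (bitLenStmt dst src) (bitLen v * 4 + 4) (fun s' => s'.mem = s.mem ∧
      s'.reg dst = bitLen v ∧ ∀ r, r ≠ dst → r ≠ 25 → s'.reg r = s.reg r) s := by
  have hdig : (Nat.digits 2 v).length = bitLen v := by
    rw [Nat.length_digits 2 v (by norm_num) (by omega), bitLen]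
  have hvle := bitLen_le_self hs
  refine WP.mono (WP.seq (t := 2) (Q' := fun s' => s'.mem = s.mem ∧ s'.reg dst = 0 ∧
    s'.reg 25 = v ∧ ∀ r, r ≠ dst → r ≠ 25 → s'.reg r = s.reg r)
    (WP.block ?_ ⟨rfl, ?_, ?_, ?_⟩ le_rfl) fun s₁ hs₁ => WP.while (t := 2)
      (fun n s' => s'.mem = s.mem ∧ s'.reg dst + n = bitLen v ∧
          n = (Nat.digits 2 (s'.reg 25)).length ∧
        s'.reg 25 < 2 ^ w ∧ ∀ r, r ≠ dst → r ≠ 25 → s'.reg r = s.reg r) ?_ ?_ (bitLen v) s₁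
        ⟨hs₁.1, by omega, by rw [hs₁.2.2.1, hdig], by omega, hs₁.2.2.2⟩)
      (le_of_eq (by ring)) fun s h => h
  · simp [h1, hv]; omega
  · simp
  · simp [Ne.symm hd', h1, hv]
  · intro r hr hr'
    simp [hr, hr']
  · rintro n s₂ ⟨hm, hn, hn', hlt, hr⟩ hc
    rw [hr 1 (by omega) (by omega), h1] at hc
    rw [Nat.digits_def' (by norm_num) hc, List.length_cons] at hn'
    have h4 : s₂.reg 25 / 2 ≤ s₂.reg 25 := Nat.div_le_self _ _
    refine ⟨_, hn', WP.block ?_ ⟨hm, ?_, ?_, ?_, ?_⟩ le_rfl⟩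
    · simp [hr 3 (by omega) (by omega), hr 2 (by omega) (by omega), h2, h3, hd']
      omega
    · simp [hr 2 (by omega) (by omega), h2, hd']
      omega
    · simp [hr 3 (by omega) (by omega), h3, Ne.symm hd']
    · simp [hr 3 (by omega) (by omega), h3, Ne.symm hd']
      omega
    · intro r hr1 hr2
      simp [hr1, hr2, hr]
  · rintro n s₂ ⟨hm, hn, hn', hlt, hr⟩ hc
    rw [hr 1 (by omega) (by omega), h1] at hc
    have h0 : s₂.reg 25 = 0 := by omega
    rw [h0] at hn'
    simp only [Nat.digits_zero, List.length_nil] at hn'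
    exact ⟨hm, by omega, hr⟩

/-- Write the string `parityString full T D`, without its length, to the memory. -/
def emitStmt (full : Bool) : Stmt :=
  litStmt (codePreamble 7 ++ codes [0]) ;;
  (.block [.const 30 3, .op .add 31 4 1] ;; stringStmt false) ;;
  litStmt (codes [1, 5]) ;;
  patternsStmt gadgetPieces ;;
  litStmt (codes [6]) ;;
  (if full then patternsStmt pairPieces ;; litStmt (codes [0]) else .block []) ;;
  .block [.store 20 21]

variable {G : Layout}

/-- The last, incomplete word is written; the words after it are `0` already. -/
theorem wp_flush (hG : G.Valid) {l : List Bool} {s : Store} (h : G.Output l s) (hl : l.length = G.N)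
    (h0 : ∀ j, G.M (G.base + 2 * (j + 1)) = 0) :
    WP G.w G.S (.block [.store 20 21]) 1 (fun s' =>
      (∀ j, s'.mem (G.base + 2 * (j + 1)) = bitVal ((l.drop (j * G.B)).take G.B)) ∧
      ∀ a, (∀ j, a ≠ G.base + 2 * (j + 1)) → s'.mem a = G.M a) s := by
  obtain ⟨f, h, hf⟩ := h
  have hS := hG.le_S
  have hfN : f ≤ G.N / G.B := by
    rw [Nat.le_div_iff_mul_le hG.B_pos, ← hl]; exact h.le
  refine WP.block ?_ ⟨fun j => ?_, fun a ha => ?_⟩ le_rfl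
  · simp [h.ptr]; omega
  · simp only [applyAll, Instr.apply, Instr.exec, Store.at, Function.update_apply, h.ptr]
    rw [Nat.succ_mul] at hf
    rcases lt_trichotomy j f with hj | hj | hj
    · rw [if_neg (by omega), h.word j hj]
    · subst hj
      rw [if_pos rfl, h.acc, List.take_of_length_le]
      rw [List.length_drop]; omega
    · have hfj : (f + 1) * G.B ≤ j * G.B := Nat.mul_le_mul_right _ hj
      rw [Nat.succ_mul] at hfj
      rw [if_neg (by omega), h.frame _ fun i hi => by omega, h0, List.drop_of_length_le (by omega),
        List.take_nil]
      rfl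
  · simp only [applyAll, Instr.apply, Instr.exec, Store.at, Function.update_apply, h.ptr]
    rw [if_neg (ha f), h.frame a fun j _ => ha j]

theorem length_lit_gadgetPieces (y : List Bool) (hy : .lit y ∈ gadgetPieces) : y.length ≤ 271 := by
  simp only [gadgetPieces, List.mem_cons, Piece.lit.injEq, reduceCtorEq, List.not_mem_nil, or_false,
    false_or] at hy
  rcases hy with rfl | rfl | rfl | rfl <;> simp [length_codes]

theorem length_lit_pairPieces (y : List Bool) (hy : .lit y ∈ pairPieces) : y.length ≤ 271 := by
  simp only [pairPieces, List.mem_cons, Piece.lit.injEq, reduceCtorEq, List.not_mem_nil, or_false,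
    false_or] at hy
  rcases hy with rfl | rfl | rfl <;> simp [length_codes]

/-- The layout describes the instance `T`, `D`, stored in the memory. -/
structure Layout.Holds (G : Layout) (T : List Bool) (D : List (List Bool)) : Prop where
  text : G.Packed 3 T
  patterns : G.PatternsAt G.pat D
  n_eq : T.length = G.n
  k_eq : D.length = G.k
  n_lt : G.n < 2 ^ G.w
  k_lt : G.k < 2 ^ G.w
  k_pos : 0 < G.k
  m_le : G.m ≤ G.pw * G.b

theorem wp_emit (hG : G.Valid) {T : List Bool} {D : List (List Bool)} (full : Bool) {tw : ℕ}
    (hI : G.Holds T D) (htw : T.length ≤ tw * G.b)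
    (hN : (parityString full T D).length = G.N) (h0 : ∀ j, G.M (G.base + 2 * (j + 1)) = 0)
    {s : Store} (h : G.Output [] s) :
    WP G.w G.S (emitStmt full)
      (tw * 4609 + G.k * (13 * (G.pw * 4609 + 2282) + 8) + 11423) (fun s' =>
      (∀ j, s'.mem (G.base + 2 * (j + 1)) =
        bitVal (((parityString full T D).drop (j * G.B)).take G.B)) ∧
      ∀ a, (∀ j, a ≠ G.base + 2 * (j + 1)) → s'.mem a = G.M a) s := by
  have hlen := hN
  have hw := hG.le_w
  have h4 : 2 ^ 2 ≤ 2 ^ G.w := Nat.pow_le_pow_right (by norm_num) (by omega)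
  have hnw := hI.n_lt
  simp only [parityString, List.length_append] at hlen
  have hA : (codePreamble 7 ++ codes [0]).length = 271 := by
    rw [List.length_append, length_codePreamble_seven, length_codes]; rfl
  refine WP.mono (WP.seq (wp_lit hG h (by rw [hA]) (by simp; omega)) fun s₁ h₁ =>
    WP.seq (WP.seq (t := 2) (Q' := fun s => G.Output ([] ++ (codePreamble 7 ++ codes [0])) s ∧
      s.reg 30 = 3 ∧ s.reg 31 = T.length) (WP.block ?_ ⟨h₁.of_eq ?_ rfl, ?_, ?_⟩ le_rfl)
      fun s₂ h₂ => wp_string hG false h₂.1 h₂.2.1 h₂.2.2 hI.text ?_ htw) fun s₃ h₃ =>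
    WP.seq (wp_lit hG h₃ (by simp [length_codes]) ?_) fun s₄ h₄ =>
    WP.seq (wp_patterns hG gadgetPieces h₄ hI.k_eq hI.k_lt hI.patterns length_lit_gadgetPieces ?_
      hI.m_le) fun s₅ h₅ =>
    WP.seq (wp_lit hG h₅ (by simp [length_codes]) ?_) fun s₆ h₆ =>
    WP.seq (t := G.k * (5 * (G.pw * 4609 + 2282) + 4) + 4 + 2282)
      (Q' := G.Output (parityString full T D)) ?_ fun s₇ h₇ => wp_flush hG h₇ hN h0)
    ?_ fun s h => h
  · simp [h₁.regs.r4, h₁.regs.r1]; omega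
  · intro r hr
    simp [show r ≠ 30 by omega, show r ≠ 31 by omega]
  · simp
  · simp [h₁.regs.r4, h₁.regs.r1, hI.n_eq]
  · simp only [List.length_append, List.nil_append, ← length_innerCode false]; omega
  · simp only [List.length_append, List.nil_append]; omega
  · simp only [List.length_append, List.nil_append]; omega
  · simp only [List.length_append, List.nil_append]; omega
  · cases full with
    | false =>
      exact WP.block trivial (by simpa [parityString, applyAll] using h₆) (Nat.zero_le _)
    | true =>
      simp only [if_true, List.length_append] at hlen
      refine WP.seq (wp_patterns hG pairPieces h₆ hI.k_eq hI.k_lt hI.patterns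
          length_lit_pairPieces ?_
        hI.m_le) fun s₈ h₈ => (wp_lit hG h₈ (by simp [length_codes]) ?_).mono le_rfl fun s₉ h₉ => ?_
      · simp only [List.length_append, List.nil_append]; omega
      · simp only [List.length_append, List.nil_append]; omega
      · simpa [parityString] using h₉
  · rw [show gadgetPieces.length = 8 from rfl]
    obtain ⟨x, hx⟩ : ∃ x, x = G.pw * 4609 + 2282 := ⟨_, rfl⟩
    rw [← hx]
    have : G.k * (13 * x + 8) = G.k * (8 * x + 4) + G.k * (5 * x + 4) := by ring
    clear hlen hA h4 h0 hw hnw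
    omega

/-- Write the length of the string, and the string, to the memory; register `br` contains the
address. The first block computes the length, according to `length_parityString`. -/
def trackStmt (full : Bool) (br : ℕ) : Stmt :=
  .block [.const 25 3, .op .mul 25 25 6, .op .add 25 25 3, .const 26 (if full then 6 else 4),
    .op .mul 25 25 26, .const 26 4, .op .add 25 25 26, .op .mul 25 25 5, .const 26 18,
    .op .mul 25 25 26, .const 26 54, .op .mul 26 26 4, .op .add 17 25 26,
    .const 26 (if full then 343 else 325), .op .add 17 17 26] ;;
  bitLenStmt 14 17 ;;
  .block [.op .sub 15 14 2, .op .shl 16 2 14, .store br 17, .op .add 20 br 3, .const 21 0,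
    .const 22 0] ;;
  emitStmt full

theorem writesIn_patternsStmt (ps : List Piece) : (patternsStmt ps).writesIn 14 34 = true := by
  have h : ∀ st : Stmt, st.writesIn 20 32 = true → st.writesIn 14 34 = true := by
    intro st
    induction st with
    | block l =>
      intro h
      simp only [Stmt.writesIn, List.all_eq_true] at h ⊢
      intro I hI
      have := h I hI
      cases I <;> simp only [Instr.writesIn, Bool.and_eq_true,
          decide_eq_true_eq] at this ⊢ <;> omega
    | seq a b iha ihb =>
      intro h
      simp only [Stmt.writesIn, Bool.and_eq_true] at h ⊢
      exact ⟨iha h.1, ihb h.2⟩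
    | whileLt x y a ih => exact ih
  simp only [patternsStmt, Stmt.writesIn, h _ (writesIn_piecesStmt ps)]
  rfl

theorem writesIn_trackStmt (full : Bool) (br : ℕ) : (trackStmt full br).writesIn 14 34 = true := by
  have h := writesIn_patternsStmt gadgetPieces
  have h' := writesIn_patternsStmt pairPieces
  cases full
  · simp only [trackStmt, emitStmt, Stmt.writesIn, h]; rfl
  · simp only [trackStmt, emitStmt, Stmt.writesIn, h, h', if_true]; rfl

/-- The input for the given program is written to every other cell from address `base` on. The
memory `M` of the layout is that after the length of the string has been stored. -/
theorem wp_track (hG : G.Valid) {T : List Bool} {D : List (List Bool)} (full : Bool) {tw br : ℕ}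
    (hI : G.Holds T D) (hD : ∀ P ∈ D, P.length = G.m) (htw : T.length ≤ tw * G.b)
    (hN : (parityString full T D).length = G.N) (hB : G.B = bitLen G.N) {s : Store}
    (hs : G.BaseRegs s) (hbr : s.reg br = G.base) (hbr' : br < 14)
    (hM : G.M = Function.update s.mem G.base G.N)
    (h0 : ∀ j, s.mem (G.base + 2 * (j + 1)) = 0) :
    WP G.w G.S (trackStmt full br)
      (G.B * 4 + tw * 4609 + G.k * (13 * (G.pw * 4609 + 2282) + 8) + 11448) (fun s' =>
      ((∀ a, s'.mem (G.base + 2 * a) = (lzInput (parityString full T D)).getD a 0) ∧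
        ∀ a, (∀ j, a ≠ G.base + 2 * j) → s'.mem a = s.mem a) ∧
      ∀ r, r < 14 ∨ 34 ≤ r → s'.reg r = s.reg r) s := by
  refine WP.frame ?_ (writesIn_trackStmt full br)
  have hlen := length_parityString full T hD
  rw [hN, hI.n_eq, hI.k_eq] at hlen
  obtain ⟨F, hF⟩ : ∃ F, F = if full then 6 else 4 := ⟨_, rfl⟩
  obtain ⟨E, hE⟩ : ∃ E, E = if full then 343 else 325 := ⟨_, rfl⟩
  have hlen' : G.N = ((3 * G.m + 2) * F + 4) * G.k * 18 + 54 * G.n + E := by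
    rw [hlen, hF, hE]; cases full <;> simp <;> ring
  have hNw := hG.N_lt
  have hS := hG.le_S
  have hSw := hG.S_le
  have hF6 : F ≤ 6 := by rw [hF]; split_ifs <;> norm_num
  have hE3 : 325 ≤ E := by rw [hE]; split_ifs <;> norm_num
  have hw := hG.le_w
  have h10 : 2 ^ 10 ≤ 2 ^ G.w := Nat.pow_le_pow_right (by norm_num) (by omega)
  have hpB : 2 ^ G.B < 2 ^ G.w := Nat.pow_lt_pow_right (by norm_num) (by omega)
  refine WP.mono (WP.seq (t := 15) (Q' := fun s' => s'.mem = s.mem ∧ s'.reg 17 = G.N ∧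
    ∀ r < 14, s'.reg r = s.reg r) (WP.block ?_ ⟨rfl, ?_, ?_⟩ le_rfl) fun s₁ h₁ =>
    WP.seq (wp_bitLen (dst := 14) (src := 17) (by rw [h₁.2.2 1 (by norm_num), hs.r1])
        (by rw [h₁.2.2 2 (by norm_num), hs.r2])
      (by rw [h₁.2.2 3 (by norm_num), hs.r3]) (by norm_num) (by norm_num) h₁.2.1
      (by omega) hNw) fun s₂ h₂ =>
    have he : ∀ r < 14, s₂.reg r = s.reg r := fun r hr => by
      rw [h₂.2.2 r (by omega) (by omega), h₁.2.2 r hr]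
    WP.seq (t := 6) (Q' := G.Output []) (WP.block ?_ ?_ le_rfl) fun s₃ h₃ =>
      wp_emit hG full hI htw hN ?_ h₃) ?_ fun s₄ h₄ => ⟨?_, ?_⟩
  · obtain ⟨X, hX⟩ : ∃ X, X = (3 * G.m + 2) * F := ⟨_, rfl⟩
    have hF4 : 4 ≤ F := by rw [hF]; split_ifs <;> norm_num
    have hmX : (3 * G.m + 2) * 4 ≤ X := hX ▸ Nat.mul_le_mul_left _ hF4
    have hk : X + 4 ≤ (X + 4) * G.k := Nat.le_mul_of_pos_right _ hI.k_pos
    rw [← hX] at hlen'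
    simp only [OkAll, Instr.Ok, Instr.apply, Instr.exec, Store.at, BinOp.eval,
        Function.update_apply]
    simp only [Nat.reduceEqDiff, if_true, if_false, hs.r3, hs.r4, hs.r5, hs.r6, ← hF, ← hE, ← hX]
    refine ⟨by omega, by omega, by omega, by omega, by omega, by omega, by omega, by omega,
      by omega, by omega, by omega, by omega, by omega, by omega, by omega, trivial⟩
  · simp only [applyAll, Instr.apply, Instr.exec, Store.at, BinOp.eval, Function.update_apply]
    simp only [Nat.reduceEqDiff, if_true, if_false, hs.r3, hs.r4, hs.r5, hs.r6, ← hF, ← hE]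
    rw [hlen']
  · intro r hr
    simp only [applyAll, Instr.apply, Instr.exec, Store.at, Function.update_apply]
    simp only [show r ≠ 25 by omega, show r ≠ 26 by omega, show r ≠ 17 by omega, if_false]
  · have hBw : G.B < 2 ^ G.w := by have := Nat.lt_two_pow_self (n := G.B); omega
    have hS' : G.base + 4 ≤ G.S :=
      (Nat.add_le_add_left (Nat.mul_le_mul_left 2 (Nat.le_add_left 2 _)) _).trans hS
    simp only [OkAll, Instr.Ok, Instr.apply, Instr.exec, Store.at, BinOp.eval,
        Function.update_apply]
    simp only [Nat.reduceEqDiff, if_false, he 2 (by norm_num), he 3 (by norm_num), he br hbr',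
      h₂.2.1, ← hB, hs.r2, hs.r3, hbr, show br ≠ 15 by omega, show br ≠ 16 by omega,
      Nat.one_shiftLeft]
    refine ⟨by omega, by omega, by omega, by omega, by omega, by omega, trivial⟩
  · refine ⟨0, ⟨⟨hs.of_eq ?_, ?_, ?_, ?_⟩, ?_, ?_, ?_, ?_, ?_, ?_⟩, ?_⟩
    · intro r hr
      simp only [applyAll, Instr.apply, Instr.exec, Store.at, Function.update_apply]
      simp only [show r ≠ 15 by omega, show r ≠ 16 by omega, show r ≠ 20 by omega,
        show r ≠ 21 by omega, show r ≠ 22 by omega, if_false, he r (by omega)]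
    · simp [h₂.2.1, ← hB]
    · simp [h₂.2.1, ← hB, he 2, hs.r2]
    · simp [h₂.2.1, ← hB, he 2, hs.r2, Nat.one_shiftLeft]
    · simp [he 3, hs.r3, he br hbr', hbr, show br ≠ 15 by omega, show br ≠ 16 by omega]
    · simp [bitVal_nil]
    · simp
    · simp
    · simp
    · intro a _
      simp only [applyAll, Instr.apply, Instr.exec, Store.at, BinOp.eval, Function.update_apply]
      simp only [show br ≠ 15 by omega, show br ≠ 16 by omega, if_false, Nat.reduceEqDiff,
        he br hbr', hbr, h₂.1, h₁.1, h₂.2.2 17 (by norm_num) (by norm_num), h₁.2.1, hM,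
        Function.update_apply]
    · simp [hG.B_pos]
  · intro j
    rw [hM, Function.update_of_ne (by omega), h0]
  · rw [← hB]
    exact le_of_eq (by ring)
  · rintro (_ | a)
    · rw [Nat.mul_zero, add_zero, h₄.2 _ fun j => by omega, hM, Function.update_self, ← hN]
      rfl
    · rw [h₄.1, lzInput_getD_succ, hN, ← hB]
  · intro a ha
    rw [h₄.2 a fun j => ha (j + 1), hM, Function.update_of_ne (show a ≠ G.base from ha 0)]

/-! ### The parameters and the table -/

theorem spread_lt (h : ℕ) : ∀ i < 2 ^ h, spread i < 2 ^ (54 * h) := by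
  induction h with
  | zero =>
    intro i hi
    obtain rfl : i = 0 := by simpa using hi
    simp [spread_zero]
  | succ h ih =>
    intro i hi
    rcases Nat.eq_zero_or_pos i with rfl | h0
    · rw [spread_zero]; positivity
    · rw [spread_eq h0, Nat.mul_succ, pow_add]
      have := ih (i / 2) (by rw [pow_succ] at hi; omega)
      have h2 : i % 2 < 2 := Nat.mod_lt _ (by norm_num)
      omega

/-- The parameters of an instance. A chunk has half as many symbols as an input word, up to
rounding, so that the table, which follows the input, is small. -/
def instanceLayout (w S : ℕ) (T : List Bool) (m : ℕ) (D : List (List Bool)) (N base : ℕ)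
    (M : ℕ → ℕ) :
    Layout where
  w := w
  S := S
  n := T.length
  k := D.length
  m := m
  b := bitLen T.length
  pw := (m + bitLen T.length - 1) / bitLen T.length
  pat := 3 + (pack (bitLen T.length) T).length
  h := bitLen T.length / 2 + 1
  tab := (dmInput T m D).length
  N := N
  B := bitLen N
  base := base
  M := M

/-- Store the parameters of the instance in registers, and compute the table. The entry number `i`
is obtained from entry number `i / 2` by `spread_eq`. -/
def prepareStmt : Stmt :=
  .block [.const 1 0, .const 2 1, .const 3 2, .load 4 1, .load 5 2, .load 6 3] ;;
  bitLenStmt 7 4 ;;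
  .block [.op .div 8 7 3, .op .add 8 8 2, .op .add 10 6 7, .op .sub 10 10 2, .op .div 10 10 7,
    .const 25 3, .op .add 11 4 7, .op .sub 11 11 2, .op .div 11 11 7, .op .add 11 25 11,
    .op .mul 9 5 10, .op .add 9 11 9, .op .shl 25 2 8, .op .add 12 9 25, .op .add 13 12 2,
    .const 26 1] ;;
  .whileLt 26 25 (.block [.op .div 27 26 3, .op .add 27 9 27, .load 27 27, .const 28 (2 ^ 54),
    .op .mul 27 28 27, .op .mod 28 26 3, .op .add 27 28 27, .op .add 28 9 26, .store 28 27,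
    .op .add 26 26 2])

theorem wp_prepare {w S : ℕ} {T : List Bool} {m : ℕ} {D : List (List Bool)} (hT : 0 < T.length)
    (hm : 0 < m) (hk : 0 < D.length) (hD : ∀ P ∈ D, P.length = m)
    (hnw : 2 * T.length < 2 ^ w) (hmw : m + T.length < 2 ^ w) {tab h : ℕ} {s : Store}
    (htab : tab = (dmInput T m D).length) (hh : h = bitLen T.length / 2 + 1)
    (hS : tab + 2 ^ h + 2 ≤ S) (hSw : S ≤ 2 ^ w) (hw : 54 * h < w)
    (hs : ∀ r, s.reg r = 0) (hM : ∀ a, s.mem a = (dmInput T m D).getD a 0) :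
    WP w S prepareStmt (bitLen T.length * 4 + 2 ^ h * 12 + 28) (fun s' =>
      ((∀ N base M, (instanceLayout w S T m D N base M).BaseRegs s') ∧ s'.reg 12 = tab + 2 ^ h ∧
        s'.reg 13 = tab + 2 ^ h + 1 ∧ (∀ i < 2 ^ h, s'.mem (tab + i) = spread i) ∧
        ∀ a, (∀ i < 2 ^ h, a ≠ tab + i) → s'.mem a = (dmInput T m D).getD a 0) ∧
      ∀ r, r < 1 ∨ 29 ≤ r → s'.reg r = 0) s := by
  refine WP.mono (WP.frame (lo := 1) (hi := 29) ?_ rfl) le_rfl fun s' hs' =>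
    ⟨hs'.1, fun r hr => (hs'.2 r hr).trans (hs r)⟩
  obtain ⟨b, hb⟩ : ∃ b, b = bitLen T.length := ⟨_, rfl⟩
  have hb1 : 1 ≤ b := hb ▸ Nat.succ_pos _
  have hbn : b ≤ T.length := hb ▸ bitLen_le_self hT
  obtain ⟨pw, hpw⟩ : ∃ pw, pw = (m + b - 1) / b := ⟨_, rfl⟩
  obtain ⟨tw, htw⟩ : ∃ tw, tw = (T.length + b - 1) / b := ⟨_, rfl⟩
  have hlp : (pack (bitLen T.length) T).length = tw := by rw [length_pack, htw, hb]
  have htab' : tab = 3 + tw + D.length * pw := by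
    rw [htab, length_dmInput T hD, hlp, hpw, hb]
  have hpw0 : 0 < pw := hpw ▸ Nat.div_pos (by omega) hb1
  have hkp : D.length ≤ D.length * pw := Nat.le_mul_of_pos_right _ hpw0
  have hpk : pw ≤ D.length * pw := Nat.le_mul_of_pos_left _ hk
  have h54 : 2 ^ 54 < 2 ^ w := Nat.pow_lt_pow_right (by norm_num) (by omega)
  have hh0 : 0 < 2 ^ h := by positivity
  have hdiv1 := Nat.div_le_self (m + b - 1) b
  have hdiv2 := Nat.div_le_self (T.length + b - 1) b
  rw [← hpw] at hdiv1
  rw [← htw] at hdiv2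
  have hm0 : s.mem 0 = T.length := hM 0
  have hm1 : s.mem 1 = D.length := hM 1
  have hm2 : s.mem 2 = m := hM 2
  rw [← hb] at hh
  rw [← hb]
  refine WP.mono (WP.seq (t := 6) (Q' := fun s' => s'.mem = s.mem ∧ s'.reg 1 = 0 ∧ s'.reg 2 = 1 ∧
    s'.reg 3 = 2 ∧ s'.reg 4 = T.length ∧ s'.reg 5 = D.length ∧ s'.reg 6 = m)
    (WP.block ?_ ?_ le_rfl) fun s₁ h₁ =>
    WP.seq (wp_bitLen (dst := 7) (src := 4) h₁.2.1 h₁.2.2.1 h₁.2.2.2.1 (by norm_num) (by norm_num)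
      h₁.2.2.2.2.1 hT (by omega)) fun s₂ h₂ =>
    WP.seq (t := 16) (Q' := fun s' => s'.mem = s.mem ∧ (s'.reg 26 = 1 ∧ s'.reg 25 = 2 ^ h) ∧
      s'.reg 12 = tab + 2 ^ h ∧ s'.reg 13 = tab + 2 ^ h + 1 ∧
      ∀ N base M, (instanceLayout w S T m D N base M).BaseRegs s')
      (WP.block ?_ ?_ le_rfl) fun s₃ h₃ => WP.while (t := 10) (fun n s' =>
        (s'.reg 26 + n = 2 ^ h ∧ 0 < s'.reg 26 ∧ s'.reg 25 = 2 ^ h) ∧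
        (∀ i < s'.reg 26, s'.mem (tab + i) = spread i) ∧
        (∀ a, (∀ i < 2 ^ h, a ≠ tab + i) → s'.mem a = (dmInput T m D).getD a 0) ∧
        ∀ r < 14, s'.reg r = s₃.reg r) ?_ ?_ (2 ^ h - 1) s₃ ?_) ?_ fun s h => h
  · simp
    omega
  · simp [hm0, hm1, hm2]
  · obtain ⟨hmem, r1, r2, r3, r4, r5, r6⟩ := h₁
    obtain ⟨hmem2, r7, hr⟩ := h₂
    simp only [OkAll, Instr.Ok, Instr.apply, Instr.exec, Store.at, BinOp.eval,
        Function.update_apply]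
    simp only [Nat.reduceEqDiff, if_true, if_false, r7, ← hb,
      hr 2 (by norm_num) (by norm_num), hr 3 (by norm_num) (by norm_num),
      hr 4 (by norm_num) (by norm_num), hr 5 (by norm_num) (by norm_num),
      hr 6 (by norm_num) (by norm_num), r2, r3, r4, r5, r6, ← hh, ← hpw, ← htw, ← htab',
      Nat.one_shiftLeft]
    refine ⟨by omega, by omega, by omega, by omega, by omega, by omega, by omega,
        by omega, by omega,
      by omega, by omega, by omega, by omega, by omega, by omega, by omega, trivial⟩
  · obtain ⟨hmem, r1, r2, r3, r4, r5, r6⟩ := h₁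
    obtain ⟨hmem2, r7, hr⟩ := h₂
    refine ⟨by simp [hmem, hmem2], ?_, ?_, ?_, fun N base M =>
        ⟨?_, ?_, ?_, ?_, ?_, ?_, ?_, ?_, ?_, ?_, ?_⟩⟩
    all_goals
      simp only [applyAll, Instr.apply, Instr.exec, Store.at, BinOp.eval, Function.update_apply,
        instanceLayout]
      simp only [Nat.reduceEqDiff, if_true, if_false, r7, ← hb, hr 1 (by norm_num) (by norm_num),
        hr 2 (by norm_num) (by norm_num), hr 3 (by norm_num) (by norm_num),
        hr 4 (by norm_num) (by norm_num), hr 5 (by norm_num) (by norm_num),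
        hr 6 (by norm_num) (by norm_num), r1, r2, r3, r4, r5, r6, ← hh, ← hpw, ← htw, ← htab',
        Nat.one_shiftLeft, ← htab, and_self]
    rw [hb, hlp]
  · rintro n s' ⟨⟨hn, hi, h25⟩, htb, hin, hr⟩ hlt
    have hB := h₃.2.2.2.2 0 0 s.mem
    have e1 : s'.reg 2 = 1 := (hr 2 (by norm_num)).trans hB.r2
    have e2 : s'.reg 3 = 2 := (hr 3 (by norm_num)).trans hB.r3
    have e3 : s'.reg 9 = tab := (hr 9 (by norm_num)).trans (hB.r9.trans htab.symm)
    obtain ⟨i, hi'⟩ : ∃ i, i = s'.reg 26 := ⟨_, rfl⟩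
    rw [← hi'] at hn hi htb hlt
    rw [h25] at hlt
    have hrec := spread_eq hi
    have hsp := spread_lt h i hlt
    have hpow : 2 ^ (54 * h) < 2 ^ w := Nat.pow_lt_pow_right (by norm_num) hw
    have hl : s'.mem (tab + i / 2) = spread (i / 2) := htb _ (by omega)
    refine ⟨n - 1, by omega, WP.block ?_ ⟨?_, ?_, ?_, ?_⟩ le_rfl⟩
    · simp only [OkAll, Instr.Ok, Instr.apply, Instr.exec, Store.at, BinOp.eval,
        Function.update_apply]
      simp only [Nat.reduceEqDiff, if_true, if_false, ← hi', e1, e2, e3, hl]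
      refine ⟨by omega, by omega, by omega, by omega, by omega, by omega, by omega, by omega,
        by omega, by omega, trivial⟩
    · simp [← hi', e1, h25]
      omega
    · simp only [applyAll, Instr.apply, Instr.exec, Store.at, BinOp.eval, Function.update_apply]
      simp only [Nat.reduceEqDiff, if_true, if_false, ← hi', e1, e2, e3, hl]
      intro j hj
      by_cases hji : j = i
      · rw [if_pos (by rw [hji]), hji, hrec, add_comm]
      · rw [if_neg (by omega)]
        exact htb j (by omega)
    · simp only [applyAll, Instr.apply, Instr.exec, Store.at, BinOp.eval, Function.update_apply]
      simp only [Nat.reduceEqDiff, if_true, if_false, ← hi', e2, e3, hl]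
      intro a ha
      rw [if_neg (ha i hlt), hin a ha]
    · intro r hr'
      simp only [applyAll, Instr.apply, Instr.exec, Store.at, Function.update_apply]
      simp only [show r ≠ 26 by omega, show r ≠ 27 by omega, show r ≠ 28 by omega,
          if_false, hr r hr']
  · rintro n s' ⟨⟨hn, hi, h25⟩, htb, hin, hr⟩ hlt
    rw [h25] at hlt
    refine ⟨fun N base M => (h₃.2.2.2.2 N base M).of_eq fun r hr' => hr r (by omega), ?_, ?_,
      fun i hi' => htb i (by omega), hin⟩
    · rw [hr 12 (by norm_num), h₃.2.2.1]
    · rw [hr 13 (by norm_num), h₃.2.2.2.1]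
  · rw [h₃.2.1.1, h₃.2.1.2, h₃.1]
    refine ⟨⟨by omega, by norm_num, rfl⟩, ?_, fun a _ => hM a, fun r _ => rfl⟩
    intro i hi
    obtain rfl : i = 0 := by omega
    rw [hM, List.getD_eq_default _ _ (by omega), spread_zero]
  · omega

end WordRAM

/-! ### The program for Dictionary Matching -/

namespace WordRAM

/-- The part of the program before the two runs of the given program. -/
def setupStmt : Stmt := prepareStmt ;; trackStmt true 12 ;; trackStmt false 13

/-- Write the two strings to the memory, interleaved with each other, run the given program on both
of them, and combine the results. The registers of the given program become the registers with
even numbers from `64` on in the first run, and those with odd numbers from `65` on in the second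
run; register `40` is used for addresses. -/
def matchingProgram (p : Program) : Program :=
  setupStmt.compile 0 ++ relocate p setupStmt.size 64 12 40 ++
    relocate p (setupStmt.size + 3 * p.length) 65 13 40 ++
    [.op .add 0 64 65, .op .add 0 0 2, .op .mod 0 0 3]

theorem valid_instanceLayout {w S : ℕ} {T : List Bool} {m : ℕ} {D : List (List Bool)} {N base : ℕ}
    {M : ℕ → ℕ} (hTN : T.length ≤ N)
    (hw : bitLen N + (54 * (bitLen T.length / 2 + 1) + 271) ≤ w)
    (hS : base + 2 * (N / bitLen N + 2) ≤ S) (hSw : S ≤ 2 ^ w) (hNw : N < 2 ^ w)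
    (hbase : (dmInput T m D).length + 2 ^ (bitLen T.length / 2 + 1) ≤ base)
    (hM : ∀ i < 2 ^ (bitLen T.length / 2 + 1), M ((dmInput T m D).length + i) = spread i) :
    (instanceLayout w S T m D N base M).Valid where
  B_pos := Nat.succ_pos _
  b_pos := Nat.succ_pos _
  b_le := by simp only [instanceLayout]; omega
  h_le := by
    have : bitLen T.length ≤ bitLen N := Nat.succ_le_succ (Nat.log_mono_right hTN)
    have : 0 < bitLen T.length := Nat.succ_pos _
    simp only [instanceLayout]; omega
  le_w := hw
  le_S := hS
  S_le := hSw
  N_lt := hNw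
  tab_le := hbase
  table := hM

theorem holds_instanceLayout {w S : ℕ} {T : List Bool} {m : ℕ} {D : List (List Bool)} {N base : ℕ}
    {M : ℕ → ℕ} (hD : ∀ P ∈ D, P.length = m) (hk : 0 < D.length) (hnw : T.length < 2 ^ w)
    (hkw : D.length < 2 ^ w)
    (hM : ∀ a < (dmInput T m D).length, M a = (dmInput T m D).getD a 0) :
    (instanceLayout w S T m D N base M).Holds T D := by
  have hb : 0 < bitLen T.length := Nat.succ_pos _
  have hlen := length_dmInput T hD
  refine ⟨fun j hj => ?_, ⟨?_, fun i P hP => ⟨hD P (List.mem_of_getElem? hP), fun j hj => ?_⟩⟩, rfl,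
    rfl, hnw, hkw, hk, ?_⟩
  · simp only [instanceLayout] at hj ⊢
    have h := lt_length_pack hb hj
    have h' : 3 + j < (dmInput T m D).length := by omega
    exact ⟨h', by rw [hM _ h', dmInput_getD_text T m D h, pack_getD hb]⟩
  · simp only [instanceLayout]; omega
  · simp only [instanceLayout] at hj ⊢
    have h := lt_length_pack hb hj
    have hPm := hD P (List.mem_of_getElem? hP)
    have hi : i + 1 ≤ D.length := (List.getElem?_eq_some_iff.1 hP).1
    have hi' := Nat.mul_le_mul_right ((m + bitLen T.length - 1) / bitLen T.length) hi
    rw [Nat.succ_mul] at hi'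
    have h2 := h
    rw [length_pack, hPm] at h2
    have h' : 3 + (pack (bitLen T.length) T).length +
        i * ((m + bitLen T.length - 1) / bitLen T.length) + j < (dmInput T m D).length := by omega
    exact ⟨h', by rw [hM _ h', dmInput_getD_pattern T hD hP h, pack_getD hb]⟩
  · simp only [instanceLayout]
    obtain ⟨P, hP⟩ := List.exists_mem_of_length_pos hk
    have := length_le_length_pack_mul hb P
    rwa [length_pack, hD P hP] at this

/-- The number of steps for the parameters, the table and the two strings, where `B` and `B'` are
the word lengths of the strings, and `tw` and `pw` are the numbers of words of the text and of a
pattern. -/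
def setupTime (n k pw B B' : ℕ) (tw : ℕ) : ℕ :=
  bitLen n * 4 + 2 ^ (bitLen n / 2 + 1) * 12 + 28 +
    (B * 4 + tw * 4609 + k * (13 * (pw * 4609 + 2282) + 8) + 11448 +
      (B' * 4 + tw * 4609 + k * (13 * (pw * 4609 + 2282) + 8) + 11448))

theorem wp_setup {w S : ℕ} {T : List Bool} {m : ℕ} {D : List (List Bool)} (hT : 0 < T.length)
    (hm : 0 < m) (hk : 0 < D.length) (hD : ∀ P ∈ D, P.length = m) {A N N' : ℕ}
    (hA : A = (dmInput T m D).length + 2 ^ (bitLen T.length / 2 + 1))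
    (hN : (parityString true T D).length = N) (hN' : (parityString false T D).length = N')
    (hw : bitLen N + (54 * (bitLen T.length / 2 + 1) + 271) ≤ w)
    (hS : A + 1 + 2 * (N / bitLen N + 2) ≤ S) (hS' : A + 1 + 2 * (N' / bitLen N' + 2) ≤ S)
    (hSw : S ≤ 2 ^ w) (hNw : N < 2 ^ w) {s : Store}
    (hs : ∀ r, s.reg r = 0) (hM : ∀ a, s.mem a = (dmInput T m D).getD a 0) :
    WP w S setupStmt (setupTime T.length D.length ((m + bitLen T.length - 1) / bitLen T.length)
        (bitLen N) (bitLen N') (pack (bitLen T.length) T).length) (fun s' =>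
      (∀ a, s'.mem (A + 2 * a) = (lzInput (parityString true T D)).getD a 0) ∧
      (∀ a, s'.mem (A + 1 + 2 * a) = (lzInput (parityString false T D)).getD a 0) ∧
      s'.reg 12 = A ∧ s'.reg 13 = A + 1 ∧ s'.reg 2 = 1 ∧ s'.reg 3 = 2 ∧
      ∀ r ≥ 34, s'.reg r = 0) s := by
  have hlen := length_parityString true T hD
  have hlen' := length_parityString false T hD
  rw [hN] at hlen
  rw [hN'] at hlen'
  simp only [if_true, Bool.false_eq_true, if_false] at hlen hlen'
  have hNN : N' ≤ N := by
    rw [hlen, hlen']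
    gcongr <;> norm_num
  have hb : 0 < bitLen T.length := Nat.succ_pos _
  have hkN : D.length ≤ N := by rw [hlen]; nlinarith
  have hmN : m + T.length ≤ N := by rw [hlen]; nlinarith
  have hBB : bitLen N' ≤ bitLen N := Nat.succ_le_succ (Nat.log_mono_right hNN)
  have hdA : (dmInput T m D).length < A := by
    rw [hA]; exact Nat.lt_add_of_pos_right (by positivity)
  have hS0 : A + 1 ≤ S := (Nat.le_add_right _ _).trans hS
  have hS4 : A + 5 ≤ S :=
    (Nat.add_le_add_left (Nat.mul_le_mul_left 2 (Nat.le_add_left 2 _)) (A + 1)).trans hS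
  refine WP.seq (wp_prepare hT hm hk hD (by omega) (by omega) rfl rfl (by omega) hSw
      (by omega) hs hM)
    fun s₁ h₁ => ?_
  obtain ⟨⟨hB, r12, r13, htab, hmem⟩, hr⟩ := h₁
  rw [← hA] at r12 r13
  have h0 : ∀ a ≥ A, s₁.mem a = 0 := by
    intro a ha
    rw [hmem a fun i hi => by omega, List.getD_eq_default _ _ (by omega)]
  refine WP.seq (wp_track (G := instanceLayout w S T m D N A (Function.update s₁.mem A N))
      (valid_instanceLayout (by omega) hw (by omega) hSw hNw (by omega) ?_) true
      (tw := (pack (bitLen T.length) T).length) (br := 12)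
      (holds_instanceLayout hD hk (by omega) (by omega) ?_) hD
          (length_le_length_pack_mul hb T) hN rfl
      (hB _ _ _) r12 (by norm_num) rfl (fun j => h0 _ (by simp only [instanceLayout]; omega)))
    fun s₂ h₂ => ?_
  · intro i hi
    rw [Function.update_of_ne (by omega), htab i hi]
  · intro a ha
    rw [Function.update_of_ne (by omega), hmem a fun i _ => by omega]
  obtain ⟨⟨hin, hfr⟩, hr₂⟩ := h₂
  simp only [instanceLayout] at hin hfr
  have hlow : ∀ a < A, s₂.mem a = s₁.mem a := fun a ha => hfr a fun j => by omega
  refine (wp_track (G := instanceLayout w S T m D N' (A + 1) (Function.update s₂.mem (A + 1) N'))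
      (valid_instanceLayout (by omega)
        ((Nat.add_le_add_right hBB _).trans hw) hS' hSw (by omega) (by omega) ?_) false
      (tw := (pack (bitLen T.length) T).length) (br := 13)
      (holds_instanceLayout hD hk (by omega) (by omega) ?_) hD
          (length_le_length_pack_mul hb T) hN' rfl
      ((hB _ _ _).of_eq fun r hr => hr₂ r (by omega)) ((hr₂ 13 (by norm_num)).trans r13)
      (by norm_num) rfl (fun j => ?_)).mono le_rfl fun s₃ h₃ => ?_
  · intro i hi
    rw [Function.update_of_ne (by omega), hlow _ (by omega), htab i hi]
  · intro a ha
    rw [Function.update_of_ne (by omega), hlow _ (by omega), hmem a fun i _ => by omega]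
  · simp only [instanceLayout]
    rw [hfr _ fun j => by omega, h0 _ (by omega)]
  · obtain ⟨⟨hin₃, hfr₃⟩, hr₃⟩ := h₃
    simp only [instanceLayout] at hin₃ hfr₃
    have hrr : ∀ r, r < 14 ∨ 34 ≤ r → s₃.reg r = s₁.reg r := fun r h => (hr₃ r h).trans (hr₂ r h)
    refine ⟨fun a => ?_, hin₃, ?_, ?_, ?_, ?_, ?_⟩
    · rw [hfr₃ _ fun j => by omega, hin]
    · rw [hrr 12 (by norm_num), r12]
    · rw [hrr 13 (by norm_num), r13]
    · rw [hrr 2 (by norm_num), (hB 0 0 s.mem).r2]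
    · rw [hrr 3 (by norm_num), (hB 0 0 s.mem).r3]
    · intro r hr'
      rw [hrr r (by omega), hr r (by omega)]

theorem lt_of_mem_pack {b x : ℕ} {y : List Bool} (h : x ∈ pack b y) : x < 2 ^ b := by
  rw [pack, List.mem_map] at h
  obtain ⟨j, -, rfl⟩ := h
  exact (bitVal_lt _).trans_le (Nat.pow_le_pow_right (by norm_num) (List.length_take_le _ _))

theorem dmInput_getD_lt {T : List Bool} {m : ℕ} {D : List (List Bool)} {w : ℕ}
    (hnw : T.length < 2 ^ w) (hkw : D.length < 2 ^ w) (hmw : m < 2 ^ w) (hbw : bitLen T.length ≤ w)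
    (a : ℕ) : (dmInput T m D).getD a 0 < 2 ^ w := by
  have hpow : 2 ^ bitLen T.length ≤ 2 ^ w := Nat.pow_le_pow_right (by norm_num) hbw
  by_cases ha : a < (dmInput T m D).length
  · rw [List.getD_eq_getElem _ _ ha]
    have hmem := List.getElem_mem ha
    generalize (dmInput T m D)[a] = x at hmem
    rw [dmInput, List.mem_append, List.mem_append, List.mem_flatMap] at hmem
    rcases hmem with (h | h) | ⟨P, -, h⟩
    · simp only [List.mem_cons, List.not_mem_nil, or_false] at h
      omega
    · exact (lt_of_mem_pack h).trans_le hpow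
    · exact (lt_of_mem_pack h).trans_le hpow
  · rw [List.getD_eq_default _ _ (not_lt.1 ha)]
    positivity

theorem computes_matchingProgram {p : Program} {w S : ℕ} {T : List Bool} {m : ℕ}
    {D : List (List Bool)} (hT : 0 < T.length)
    (hm : 0 < m) (hk : 0 < D.length) (hD : ∀ P ∈ D, P.length = m) {A N N' : ℕ}
    (hA : A = (dmInput T m D).length + 2 ^ (bitLen T.length / 2 + 1))
    (hN : (parityString true T D).length = N) (hN' : (parityString false T D).length = N')
    (hw : bitLen N + (54 * (bitLen T.length / 2 + 1) + 271) ≤ w)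
    (hS : A + 1 + 2 * (N / bitLen N + 2) ≤ S) (hS' : A + 1 + 2 * (N' / bitLen N' + 2) ≤ S)
    (hSw : S ≤ 2 ^ w) (hNw : N < 2 ^ w) {o t s₁ w₁ o' t' s₁' w₁' : ℕ}
    (c : Computes p (lzInput (parityString true T D)) o t s₁ w₁)
    (c' : Computes p (lzInput (parityString false T D)) o' t' s₁' w₁')
    (ho : o ≤ 1) (ho' : o' ≤ 1) (hw₁ : w₁ ≤ w) (hw₁' : w₁' ≤ w)
    (hs₁ : A + 1 + 2 * s₁ ≤ S) (hs₁' : A + 1 + 2 * s₁' ≤ S) :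
    ∃ τ ≤ setupTime T.length D.length ((m + bitLen T.length - 1) / bitLen T.length)
        (bitLen N) (bitLen N') (pack (bitLen T.length) T).length + 3 * t + 3 * t' + 3,
      Computes (matchingProgram p) (dmInput T m D) ((o + o' + 1) % 2) τ S w := by
  obtain ⟨q, hq⟩ : ∃ q, q = matchingProgram p := ⟨_, rfl⟩
  have hcode : CodeAt q 0 (matchingProgram p) := by
    intro i I hI
    rwa [zero_add, hq]
  have hq1 := hcode.left.left.left
  have hq2 := hcode.left.left.right
  have hq3 := hcode.left.right
  have hq4 := hcode.right
  simp only [List.length_append, Stmt.length_compile, length_relocate, zero_add] at hq2 hq3 hq4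
  have hlen := length_parityString true T hD
  rw [hN] at hlen
  simp only [if_true] at hlen
  have hkN : D.length ≤ N := by rw [hlen]; nlinarith
  have hmN : m + T.length ≤ N := by rw [hlen]; nlinarith
  have hb : bitLen T.length ≤ bitLen N := Nat.succ_le_succ (Nat.log_mono_right (by omega))
  have h4 : 2 ^ 2 ≤ 2 ^ w := Nat.pow_le_pow_right (by norm_num) (by omega)
  -- The strings are written.
  obtain ⟨s, τ, hex, hτ, hin, hin', r12, r13, r2, r3, hr⟩ := wp_setup hT hm hk hD hA hN
      hN' hw hS hS'
    hSw hNw (s := ⟨fun _ => 0, fun a => (dmInput T m D).getD a 0⟩) (fun _ => rfl) (fun _ => rfl)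
  have hfit : (⟨fun _ => 0, fun a => (dmInput T m D).getD a 0⟩ : Store).Fits w :=
    ⟨fun _ => by simp, fun a => dmInput_getD_lt (by omega) (by omega) (by omega) (by omega) a⟩
  have reach1 := hex.reaches hfit hq1
  rw [zero_add] at reach1
  -- The given program is run on the first string.
  obtain ⟨s', τ', reach2, hτ', sim⟩ := Simulates.run (s₀ := s) (b := 12) (tmp := 40) (R := 64)
    (S := s₁) hq2 (by norm_num) (by norm_num) (by norm_num) hw₁ (by omega) hSw t
    (c := initial (lzInput (parityString true T D))) (s := s)
    ⟨fun r => hr _ (by omega), hin, r12, fun _ _ _ => rfl, fun _ _ => rfl⟩ reach1.fitsIn c.halts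
    c.space c.words
  -- The given program is run on the second string.
  obtain ⟨s'', τ'', reach3, hτ'', sim'⟩ := Simulates.run (s₀ := s') (b := 13) (tmp := 40) (R := 65)
    (S := s₁') hq3 (by norm_num) (by norm_num) (by norm_num) hw₁' hs₁' hSw t'
    (c := initial (lzInput (parityString false T D))) (s := s')
    ⟨fun r => by rw [sim.reg_frame _ (by omega) (by omega), hr _ (by omega)]; rfl,
      fun a => by rw [sim.mem_frame _ (by omega), hin']; rfl,
      by rw [sim.reg_frame _ (by omega) (by omega), r13], fun _ _ _ => rfl, fun _ _ => rfl⟩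
    reach2.fitsIn c'.halts c'.space c'.words
  have e1 : s''.reg 64 = o := by
    rw [sim'.reg_frame _ (by omega) (by omega)]
    exact (sim.reg 0).trans c.output
  have e2 : s''.reg 65 = o' := (sim'.reg 0).trans c'.output
  have e3 : s''.reg 2 = 1 := by
    rw [sim'.reg_frame _ (by omega) (by omega), sim.reg_frame _ (by omega) (by omega), r2]
  have e4 : s''.reg 3 = 2 := by
    rw [sim'.reg_frame _ (by omega) (by omega), sim.reg_frame _ (by omega) (by omega), r3]
  -- The results are combined.
  have reach4 := reaches_applyAll (S := S) (s := s'')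
    (l := [.op .add 0 64 65, .op .add 0 0 2, .op .mod 0 0 3]) (by
      simp only [OkAll, Instr.Ok, Instr.apply, Instr.exec, Store.at, BinOp.eval,
        Function.update_apply]
      simp only [if_true, if_false, OfNat.ofNat_ne_zero, e1, e2, e3, e4]
      refine ⟨by omega, by omega, by omega, trivial⟩) reach3.fitsIn hq4
  simp only [initial, Nat.zero_min, mul_zero, add_zero] at reach2 reach3
  have reach := ((reach1.trans reach2).trans reach3).trans reach4
  rw [hq] at reach
  refine ⟨_, ?_, ?_, ?_, reach.space, reach.words⟩
  · simp only [List.length_cons, List.length_nil]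
    omega
  · rw [show initial (dmInput T m D) =
      Store.at ⟨fun _ => 0, fun a => (dmInput T m D).getD a 0⟩ 0 from rfl, reach.run_eq]
    simp only [Halted, Store.at, matchingProgram, List.length_append, Stmt.length_compile,
      length_relocate]
    omega
  · rw [show initial (dmInput T m D) =
      Store.at ⟨fun _ => 0, fun a => (dmInput T m D).getD a 0⟩ 0 from rfl, reach.run_eq]
    simp only [applyAll, Instr.apply, Instr.exec, Store.at, BinOp.eval, Function.update_apply]
    simp only [if_true, if_false, OfNat.ofNat_ne_zero, e1, e2, e3, e4]

end WordRAM

/-! ### Resource bounds -/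

theorem lt_two_pow_bitLen (n : ℕ) : n < 2 ^ bitLen n := Nat.lt_pow_succ_log_self (by norm_num) n

theorem bitLen_mono {m n : ℕ} (h : m ≤ n) : bitLen m ≤ bitLen n :=
  Nat.succ_le_succ (Nat.log_mono_right h)

theorem bitLen_mul_le (C n : ℕ) : bitLen (C * n) ≤ bitLen C + bitLen n := by
  have hlt : C * n < 2 ^ (bitLen C + bitLen n) := by
    rw [pow_add]
    exact Nat.mul_lt_mul'' (lt_two_pow_bitLen C) (lt_two_pow_bitLen n)
  exact Nat.log_lt_of_lt_pow' (by unfold bitLen; omega) hlt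

theorem lt_bitLen_mul (n : ℕ) : n < bitLen n * (n / bitLen n + 1) :=
  Nat.lt_mul_div_succ n (Nat.succ_pos _)

/-- The size of the table is bounded by the number of words of the text. -/
theorem two_pow_half_bitLen_le {n : ℕ} (hn : 0 < n) :
    2 ^ (bitLen n / 2 + 1) ≤ 8 * (n / bitLen n + 1) := by
  obtain ⟨b, hb⟩ : ∃ b, b = bitLen n := ⟨_, rfl⟩
  have hY := lt_bitLen_mul n
  rw [← hb] at hY ⊢
  have hb0 : 0 < b := hb ▸ Nat.succ_pos _
  have hbn : 2 ^ b ≤ 2 * n := by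
    rw [hb, bitLen, pow_succ, mul_comm]
    exact Nat.mul_le_mul_left 2 (Nat.pow_log_le_self 2 hn.ne')
  have h1 : b / 2 < 2 ^ (b / 2) := Nat.lt_two_pow_self
  have h2 : 2 ^ (b / 2) * 2 ^ (b / 2) ≤ 2 ^ b := by
    rw [← pow_add]
    exact Nat.pow_le_pow_right (by norm_num) (by omega)
  have h3 : b ≤ 2 * 2 ^ (b / 2) := by omega
  refine Nat.le_of_mul_le_mul_left ?_ hb0
  calc b * 2 ^ (b / 2 + 1) ≤ 2 * 2 ^ (b / 2) * 2 ^ (b / 2 + 1) := Nat.mul_le_mul_right _ h3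
    _ = 4 * (2 ^ (b / 2) * 2 ^ (b / 2)) := by ring
    _ ≤ 8 * n := by omega
    _ ≤ b * (8 * (n / b + 1)) := by rw [Nat.mul_left_comm]; omega

theorem bitLen_le_mul {n : ℕ} (hn : 0 < n) : bitLen n ≤ 8 * (n / bitLen n + 1) := by
  refine le_trans ?_ (two_pow_half_bitLen_le hn)
  have h1 : bitLen n / 2 < 2 ^ (bitLen n / 2) := Nat.lt_two_pow_self
  rw [pow_succ]; omega

section Instance

variable {c m : ℕ} {T : List Bool} {D : List (List Bool)}

theorem IsDMInstance.text_pos (h : IsDMInstance c T m D) : 0 < T.length :=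
  List.length_pos_iff.2 h.text_nonempty

theorem IsDMInstance.card_pos (h : IsDMInstance c T m D) : 0 < D.length := by
  have h1 := h.text_pos
  have h2 := h.card_lower
  by_contra h3
  obtain h3 : D.length = 0 := by omega
  rw [h3] at h2
  omega

theorem IsDMInstance.card_le (h : IsDMInstance c T m D) :
    D.length ≤ c * (T.length / bitLen T.length + 1) := by
  refine Nat.le_of_mul_le_mul_right ?_ (Nat.succ_pos (Nat.log 2 T.length))
  refine h.card_upper.trans ?_
  have := Nat.mul_le_mul_left c (lt_bitLen_mul T.length).le
  rw [mul_assoc, mul_comm _ (Nat.log 2 T.length).succ]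
  exact this

theorem IsDMInstance.words_le (h : IsDMInstance c T m D) :
    (m + bitLen T.length - 1) / bitLen T.length ≤ c + 1 := by
  refine Nat.div_le_of_le_mul ?_
  have := h.length_upper
  rw [Nat.mul_succ, mul_comm]
  omega

theorem length_pack_le (T : List Bool) :
    (pack (bitLen T.length) T).length ≤ T.length / bitLen T.length + 1 := by
  have hb : 0 < bitLen T.length := Nat.succ_pos _
  rw [length_pack, ← Nat.add_div_right _ hb]
  exact Nat.div_le_div_right (by omega)

theorem IsDMInstance.length_parityString_le (h : IsDMInstance c T m D) (full : Bool) :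
    (parityString full T D).length ≤ (324 * c * c + 288 * c + 397) * T.length := by
  rw [length_parityString full T h.length_eq]
  have h1 := h.text_pos
  have h2 : D.length ≤ c * T.length :=
    (Nat.le_mul_of_pos_right _ (Nat.succ_pos _)).trans h.card_upper
  have h3 : m * D.length ≤ c * c * T.length := by
    calc m * D.length ≤ c * bitLen T.length * D.length := Nat.mul_le_mul_right _ h.length_upper
      _ = c * (D.length * bitLen T.length) := by ring
      _ ≤ c * (c * T.length) := Nat.mul_le_mul_left _ h.card_upper
      _ = _ := by ring
  cases full
  · simp only [Bool.false_eq_true, if_false]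
    nlinarith
  · simp only [if_true]
    nlinarith

theorem IsDMInstance.length_dmInput_le (h : IsDMInstance c T m D) :
    (dmInput T m D).length + 2 ^ (bitLen T.length / 2 + 1) ≤
      (c * (c + 1) + 12) * (T.length / bitLen T.length + 1) := by
  have h1 := two_pow_half_bitLen_le h.text_pos
  have h2 := length_pack_le T
  have h3 := Nat.mul_le_mul h.card_le h.words_le
  rw [length_dmInput T h.length_eq]
  obtain ⟨Y, hY⟩ : ∃ Y, Y = T.length / bitLen T.length + 1 := ⟨_, rfl⟩
  have hY1 : 1 ≤ Y := by rw [hY]; exact Nat.succ_pos _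
  rw [← hY] at h1 h2 h3 ⊢
  have e : (c * (c + 1) + 12) * Y = c * Y * (c + 1) + 12 * Y := by ring
  rw [e]
  omega

end Instance

namespace WordRAM

/-- All accessed addresses fit in words, so the bound on the space may be assumed to be at most
`2 ^ w`, however large it is. -/
theorem Computes.space_min {p : Program} {x : List ℕ} {o t s w : ℕ} (h : Computes p x o t s w) :
    Computes p x o t (min s (2 ^ w)) w where
  halts := h.halts
  output := h.output
  words := h.words
  space i hi a ha := by
    refine lt_min (h.space i hi a ha) ?_
    rcases ha with ⟨r, y, -, rfl⟩ | ⟨y, r, -, rfl⟩ <;> exact (h.words i hi.le).1 _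

theorem setupTime_le {n k pw B B' tw c C : ℕ} (hn : 0 < n) (hk : k ≤ c * (n / bitLen n + 1))
    (hpw : pw ≤ c + 1) (htw : tw ≤ n / bitLen n + 1) (hB : B ≤ (bitLen C + 1) * bitLen n)
    (hB' : B' ≤ (bitLen C + 1) * bitLen n) : setupTime n k pw B B' tw ≤
      (156 + 2 * ((bitLen C + 1) * 32 + 4609 + c * (13 * ((c + 1) * 4609 + 2282) + 8) + 11448)) *
        (n / bitLen n + 1) := by
  have h1 := two_pow_half_bitLen_le hn
  have h2 := bitLen_le_mul hn
  obtain ⟨Y, hY⟩ : ∃ Y, Y = n / bitLen n + 1 := ⟨_, rfl⟩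
  have hY1 : 1 ≤ Y := by rw [hY]; exact Nat.succ_pos _
  rw [← hY] at hk htw h1 h2 ⊢
  have h4 : k * (13 * (pw * 4609 + 2282) + 8) ≤ c * Y * (13 * ((c + 1) * 4609 + 2282) + 8) := by
    gcongr
  obtain ⟨Z, hZ⟩ : ∃ Z, Z = 13 * ((c + 1) * 4609 + 2282) + 8 := ⟨_, rfl⟩
  obtain ⟨E, hE⟩ : ∃ E, E = bitLen C + 1 := ⟨_, rfl⟩
  unfold setupTime
  rw [← hZ] at h4 ⊢
  rw [← hE] at hB hB' ⊢
  have h3 := Nat.mul_le_mul_left E h2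
  have e1 : E * (8 * Y) = 8 * (E * Y) := by ring
  have e : (156 + 2 * (E * 32 + 4609 + c * Z + 11448)) * Y =
      156 * Y + 64 * (E * Y) + 2 * (c * Y * Z) + 32114 * Y := by ring
  rw [e]
  linarith

end WordRAM

/-- The reduction of Dictionary Matching to the parity of the number of phrases. -/
theorem solvesDictionaryMatching_matchingProgram {v : LZVariant} {p : WordRAM.Program}
    {time space : ℕ → ℝ} (H : SolvesLZParity v p time space) :
    SolvesDictionaryMatching (WordRAM.matchingProgram p) time space := by
  intro c
  -- `C * n` bounds the lengths of the strings, `E` and `Q` are the factors of the number of words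
  -- in the space and time for writing them, and this number is at most `K₀` times the given
  -- bounds.
  obtain ⟨K₀, hK₀⟩ := H.lower_bound
  obtain ⟨C, hC⟩ : ∃ C, C = 324 * c * c + 288 * c + 397 := ⟨_, rfl⟩
  obtain ⟨K, hK⟩ := H C
  obtain ⟨E, hE⟩ : ∃ E, E = c * (c + 1) + 12 + 1 + 2 * C + 4 := ⟨_, rfl⟩
  obtain ⟨Q, hQ⟩ : ∃ Q, Q = 156 + 2 * ((bitLen C + 1) * 32 + 4609 +
    c * (13 * ((c + 1) * 4609 + 2282) + 8) + 11448) := ⟨_, rfl⟩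
  refine ⟨((Q + 3) * K₀ + 6 * K) + (E * K₀ + 4 * K) + (E + K + bitLen C + 384), ?_⟩
  intro T m D hI
  have hn := hI.text_pos
  obtain ⟨n, hn'⟩ : ∃ n, n = T.length := ⟨_, rfl⟩
  obtain ⟨b, hb⟩ : ∃ b, b = bitLen n := ⟨_, rfl⟩
  obtain ⟨Y, hY⟩ : ∃ Y, Y = n / b + 1 := ⟨_, rfl⟩
  obtain ⟨x, hx⟩ : ∃ x, x = parityString true T D := ⟨_, rfl⟩
  obtain ⟨x', hx'⟩ : ∃ x', x' = parityString false T D := ⟨_, rfl⟩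
  have hxC : x.length ≤ C * n := by rw [hx, hC, hn']; exact hI.length_parityString_le true
  have hxC' : x'.length ≤ C * n := by rw [hx', hC, hn']; exact hI.length_parityString_le false
  have hnx : n ≤ x.length := by rw [hx, hn', length_parityString _ _ hI.length_eq]; omega
  have hnx' : n ≤ x'.length := by rw [hx', hn', length_parityString _ _ hI.length_eq]; omega
  rw [← hn'] at hn
  obtain ⟨t, s, w, hcomp, ht, hs, hw⟩ := hK n hn x hxC
  obtain ⟨t', s', w', hcomp', ht', hs', hw'⟩ := hK n hn x' hxC'
  obtain ⟨hY₁, hY₂⟩ := hK₀ n hn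
  rw [← hb, ← hY] at hY₁ hY₂
  rw [← hb] at hw hw'
  obtain ⟨A, hA⟩ : ∃ A, A = (dmInput T m D).length + 2 ^ (bitLen T.length / 2 + 1) := ⟨_, rfl⟩
  have hAY : A ≤ (c * (c + 1) + 12) * Y := by
    rw [hA, hY, hb, hn']; exact hI.length_dmInput_le
  -- The number of words of the strings.
  have hwords : ∀ y : List Bool, n ≤ y.length → y.length ≤ C * n →
      y.length / bitLen y.length ≤ C * Y := by
    intro y h1 h2
    refine (Nat.div_le_div_left (c := b) (hb ▸ bitLen_mono h1) (hb ▸ Nat.succ_pos _)).trans ?_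
    refine Nat.div_le_of_le_mul (h2.trans ?_)
    have h3 := lt_bitLen_mul n
    rw [← hb, ← hY] at h3
    rw [Nat.mul_left_comm]
    exact Nat.mul_le_mul_left _ h3.le
  -- The space bounds for the two runs, cut off so that all addresses fit in words.
  obtain ⟨σ, hσ⟩ : ∃ σ, σ = min s (2 ^ w) := ⟨_, rfl⟩
  obtain ⟨σ', hσ'⟩ : ∃ σ', σ' = min s' (2 ^ w') := ⟨_, rfl⟩
  obtain ⟨S, hS⟩ : ∃ S, S = A + 1 + 2 * (C * Y + 2) + 2 * σ + 2 * σ' := ⟨_, rfl⟩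
  have hY0 : 1 ≤ Y := by rw [hY]; exact Nat.succ_pos _
  have hSE : S ≤ E * Y + 2 * σ + 2 * σ' := by
    have e : E * Y = (c * (c + 1) + 12) * Y + Y + 2 * (C * Y) + 4 * Y := by rw [hE]; ring
    rw [hS, e]
    omega
  -- The word length has to suffice for addresses below `S`, and for the pending bits after an
  -- addition to the output.
  obtain ⟨w₀, hw₀⟩ : ∃ w₀, w₀ = E + b + K * b + 3 +
    (bitLen x.length + (54 * (b / 2 + 1) + 271)) := ⟨_, rfl⟩
  have hSw : S ≤ 2 ^ w₀ := by
    have h1 : Y ≤ 2 ^ b := by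
      have h2 := lt_two_pow_bitLen n
      rw [← hb] at h2
      have h3 := Nat.div_le_self n b
      omega
    have h2 : E < 2 ^ E := Nat.lt_two_pow_self
    have h3 : E * Y ≤ 2 ^ (E + b + K * b) :=
      calc E * Y ≤ 2 ^ E * 2 ^ b := Nat.mul_le_mul h2.le h1
        _ = 2 ^ (E + b) := (pow_add _ _ _).symm
        _ ≤ _ := Nat.pow_le_pow_right (by norm_num) (by omega)
    have h4 : 2 ^ w ≤ 2 ^ (E + b + K * b) := Nat.pow_le_pow_right (by norm_num) (by omega)
    have h5 : 2 ^ w' ≤ 2 ^ (E + b + K * b) := Nat.pow_le_pow_right (by norm_num) (by omega)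
    have h6 : σ ≤ 2 ^ w := hσ ▸ min_le_right _ _
    have h7 : σ' ≤ 2 ^ w' := hσ' ▸ min_le_right _ _
    calc S ≤ 2 ^ (E + b + K * b) * 2 ^ 3 := by omega
      _ = 2 ^ (E + b + K * b + 3) := (pow_add _ _ _).symm
      _ ≤ _ := Nat.pow_le_pow_right (by norm_num) (by omega)
  have hNw : x.length < 2 ^ w₀ :=
    (lt_two_pow_bitLen _).trans_le (Nat.pow_le_pow_right (by norm_num) (by omega))
  have hBx : bitLen x.length ≤ bitLen C + b := hb ▸ (bitLen_mono hxC).trans (bitLen_mul_le C n)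
  have hBx' : bitLen x'.length ≤ bitLen C + b := hb ▸ (bitLen_mono hxC').trans (bitLen_mul_le C n)
  have hb0 : 1 ≤ b := hb ▸ Nat.succ_pos _
  have hCb : bitLen C ≤ bitLen C * b := Nat.le_mul_of_pos_right _ hb0
  obtain ⟨τ, hτ, hfin⟩ := WordRAM.computes_matchingProgram (w := w₀) (S := S) (T := T) (m := m)
    (D := D) (by omega) hI.pattern_pos hI.card_pos hI.length_eq hA (congrArg List.length hx.symm)
    (congrArg List.length hx'.symm) (by rw [← hn', ← hb]; omega)
    (by have := hwords x hnx hxC; omega) (by have := hwords x' hnx' hxC'; omega) hSw hNw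
    (hx ▸ hcomp.space_min) (hx' ▸ hcomp'.space_min) (Nat.le_of_lt_succ (Nat.mod_lt _ (by norm_num)))
    (Nat.le_of_lt_succ (Nat.mod_lt _ (by norm_num)))
    (hw.trans (by omega)) (hw'.trans (by omega)) (by omega) (by omega)
  have hpar := lzSize_parityString v hI.pattern_pos hI.nodup hI.length_eq (T := T)
  -- The given bounds are nonnegative, because they are bounded from below.
  have hpos : ∀ f : ℝ, (Y : ℝ) ≤ K₀ * f → 0 ≤ f := by
    intro f hf
    have h1 : (1 : ℝ) ≤ Y := by exact_mod_cast hY0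
    by_contra h
    have := mul_nonpos_of_nonneg_of_nonpos (Nat.cast_nonneg (α := ℝ) K₀) (not_le.1 h).le
    linarith
  refine ⟨τ, S, w₀, hpar ▸ hfin, ?_, ?_, ?_⟩
  · have hset : τ ≤ Q * Y + 3 * t + 3 * t' + 3 * Y := by
      have h1 := WordRAM.setupTime_le (C := C) (by omega) hI.card_le hI.words_le (length_pack_le T)
        (B := bitLen x.length) (B' := bitLen x'.length) (by rw [← hn', ← hb, Nat.succ_mul]; omega)
        (by rw [← hn', ← hb, Nat.succ_mul]; omega)
      rw [← hn', ← hb, ← hY, ← hQ] at h1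
      rw [← hn', ← hb] at hτ
      omega
    have hset' : (τ : ℝ) ≤ Q * Y + 3 * t + 3 * t' + 3 * Y := by exact_mod_cast hset
    have hF := hpos _ hY₁
    rw [← hn']
    have h1 : (Q : ℝ) * Y ≤ Q * (K₀ * time n) := mul_le_mul_of_nonneg_left hY₁ (Nat.cast_nonneg Q)
    have h2 : (0 : ℝ) ≤ ((E * K₀ + 4 * K) + (E + K + bitLen C + 384) : ℕ) * time n := by positivity
    push_cast at h2 ⊢
    linarith
  · have hset : S ≤ E * Y + 2 * s + 2 * s' := by
      have h1 : σ ≤ s := hσ ▸ min_le_left _ _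
      have h2 : σ' ≤ s' := hσ' ▸ min_le_left _ _
      omega
    have hset' : (S : ℝ) ≤ E * Y + 2 * s + 2 * s' := by exact_mod_cast hset
    have hF := hpos _ hY₂
    rw [← hn']
    have h1 : (E : ℝ) * Y ≤ E * (K₀ * space n) := mul_le_mul_of_nonneg_left hY₂ (Nat.cast_nonneg E)
    have h2 : (0 : ℝ) ≤ (((Q + 3) * K₀ + 6 * K) + (E + K + bitLen C + 384) : ℕ) * space n := by
      positivity
    push_cast at h2 ⊢
    linarith
  · have h1 : w₀ ≤ (E + K + bitLen C + 384) * b := by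
      have h2 : E ≤ E * b := Nat.le_mul_of_pos_right _ hb0
      rw [hw₀, add_mul, add_mul, add_mul]
      omega
    rw [← hn', ← hb]
    exact h1.trans (Nat.mul_le_mul_right _ (Nat.le_add_left _ _))

theorem mainTheorem3 :
    -- the reduction, for both variants of the parsing
    (∀ (v : LZVariant) (p : WordRAM.Program) (time space : ℕ → ℝ),
      SolvesLZParity v p time space →
        ∃ q : WordRAM.Program, SolvesDictionaryMatching q time space) ∧
    -- the number of phrases of the encoding of an instance
    (∀ (v : LZVariant) (T : List Bool) (m : ℕ) (D : List (List Bool)),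
      T ≠ [] → 3 ≤ m → D.Nodup → (∀ P ∈ D, P.length = m) →
        ((∃ P ∈ D, P <:+: T) →
          (lzSize v (encS1 T ++ encS2 m D ++ encS3 m D) : ℤ) - lzSize v (encS1 T ++ encS2 m D) =
            2 * D.length) ∧
        ((¬ ∃ P ∈ D, P <:+: T) →
          (lzSize v (encS1 T ++ encS2 m D ++ encS3 m D) : ℤ) - lzSize v (encS1 T ++ encS2 m D) =
            2 * D.length + 1)) ∧
    -- the alphabet reduction
    (∀ (v : LZVariant) (σ : ℕ) (T : List ℕ),
      3 ≤ σ → T ≠ [] → (∀ a ∈ T, a < σ) →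
        (lzSize v (codePreamble σ ++ encodeString σ T) : ℤ) - lzSize v (codePreamble σ) =
          lzSize v T) := by
  refine ⟨fun v p time space H => ⟨_, solvesDictionaryMatching_matchingProgram H⟩, ?_, ?_⟩
  · intro v T m D _ hm hnd hD
    have h := lzSize_enc v T hm hnd hD
    refine ⟨fun hex => ?_, fun hex => ?_⟩
    · rw [if_pos hex] at h
      rw [h]; push_cast; ring
    · rw [if_neg hex] at h
      rw [h]; push_cast; ring
  · intro v σ T hσ hT0 hT
    rw [lzSize_codePreamble_append v σ T hσ hT0 hT]
    push_cast; ring
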